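/- Let $\beta,\gamma$ be real numbers with $\beta\gamma>1$ and $\beta\le 1<\gamma$, and put $\Delta_c=\frac{\sqrt{\beta\gamma}+1}{\sqrt{\beta\gamma}-1}$ and $\lambda_c=(\gamma/\beta)^{(\Delta_c+1)/2}$. For a finite simple graph $G=(V,E)$ and a field $\pi:V\to(0,\infty)$ let $$Z_{\beta,\gamma,\pi}(G)=\sum_{\sigma:V\to\{0,1\}}\beta^{m_0(\sigma)}\gamma^{m_1(\sigma)}\prod_{v:\,\sigma(v)=0}\pi(v),$$ where $m_i(\sigma)$ is the number of edges both of whose endpoints have spin $i$ under $\sigma$. Time is counted in steps of a deterministic real RAM: a machine with registers and arrays of exact real numbers (field operations and comparisons, no rounding) and of natural numbers (addition, truncated subtraction and comparisons; array indices), each elementary operation or test costing one step. Then there is a program, depending only on $\beta$ and $\gamma$, such that for every $\lambda$ with $0<\lambda<\lambda_c$ there are constants $M>1$, $\alpha\in(0,1)$ and $C$, depending only on $\beta,\gamma,\lambda$, with the following property. For every $n\ge 1$, every graph $G$ with $n$ vertices (without any bound on the degrees), given by its adjacency matrix, every field $\pi$ on $G$ with $0<\pi(v)\le\lambda$ for all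 $v$, and every $0<\varepsilon<1$, the program, on input $(\beta,\gamma,G,\pi,\varepsilon)$, halts after at most $$C\,n\left(\frac{n\lambda}{\varepsilon}\right)^{\frac{\log M}{-\log\alpha}}$$ steps with a number $\hat Z$ satisfying $|\hat Z-Z_{\beta,\gamma,\pi}(G)|\le\varepsilon\,Z_{\beta,\gamma,\pi}(G)$. In particular, for each fixed $\lambda<\lambda_c$ the number of steps is at most a polynomial in $n$ and $1/\varepsilon$, so that the program is an FPTAS for $Z_{\beta,\gamma,\pi}(G)$ on general graphs with fields in $(0,\lambda]$. -/

import Mathlib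

/-! ## Two-state spin systems -/

namespace TwoSpin

/-- The number of edges of `G` both of whose endpoints receive the spin `i` under `σ`. -/
noncomputable def monoEdges {V : Type*} (G : SimpleGraph V) (σ : V → Fin 2) (i : Fin 2) : ℕ :=
  {e ∈ G.edgeSet | ∀ v ∈ e, σ v = i}.ncard

/-- The weight `β ^ m₀(σ) * γ ^ m₁(σ) * ∏_{σ v = 0} π v` of a configuration `σ`. -/
noncomputable def weight {V : Type*} [Fintype V] (β γ : ℝ) (π : V → ℝ) (G : SimpleGraph V)
    (σ : V → Fin 2) : ℝ :=
  β ^ monoEdges G σ 0 * γ ^ monoEdges G σ 1 * ∏ v, if σ v = 0 then π v else 1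

/-- The partition function: the sum of the weights of all configurations. -/
noncomputable def partitionFunction {V : Type*} [Fintype V] [DecidableEq V] (β γ : ℝ) (π : V → ℝ)
    (G : SimpleGraph V) : ℝ :=
  ∑ σ : V → Fin 2, weight β γ π G σ

/-- The critical (possibly fractional) degree. -/
noncomputable def criticalDegree (β γ : ℝ) : ℝ :=
  (√(β * γ) + 1) / (√(β * γ) - 1)

/-- The critical external field `(γ / β) ^ ((Δ_c + 1) / 2)`. -/
noncomputable def criticalField (β γ : ℝ) : ℝ :=
  (γ / β) ^ ((criticalDegree β γ + 1) / 2)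

end TwoSpin

/-! ## The real RAM

A deterministic machine with registers and arrays that hold natural numbers, and registers and
arrays that hold exact real numbers. Arrays are indexed by the natural-number registers. Every
elementary operation and every test costs one step. Natural numbers can only be added, subtracted
(truncated at `0`) and compared, so that unit cost is not a hidden source of power. On reals the
machine has the four field operations and comparison, but neither rounding nor any conversion to
natural numbers. A program is a finite object that contains no real constants other than natural
numbers. -/

namespace RealRAM

/-- The memory of the machine. -/
structure Store where
  /-- natural-number registers -/
  ireg : ℕ → ℕ
  /-- real registers -/
  rreg : ℕ → ℝ
  /-- natural-number arrays: array number, then index -/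
  iarr : ℕ → ℕ → ℕ
  /-- real arrays: array number, then index -/
  rarr : ℕ → ℕ → ℝ

/-- Elementary operations. The first argument of an arithmetic operation or of a load is the target
register; in loads and stores `k` is the number of the array and `i` is the register that holds the
index. -/
inductive Op where
  | iconst (a : ℕ) (c : ℕ)
  | icopy (a b : ℕ)
  | iadd (a b c : ℕ)
  | isub (a b c : ℕ)
  | iload (a k i : ℕ)
  | istore (k i b : ℕ)
  | rconst (a : ℕ) (c : ℕ)
  | rcopy (a b : ℕ)
  | radd (a b c : ℕ)
  | rsub (a b c : ℕ)
  | rmul (a b c : ℕ)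
  | rdiv (a b c : ℕ)
  | rload (a k i : ℕ)
  | rstore (k i b : ℕ)

/-- Assign to a natural-number register. -/
def Store.setI (s : Store) (a v : ℕ) : Store := { s with ireg := Function.update s.ireg a v }

/-- Assign to a real register. -/
def Store.setR (s : Store) (a : ℕ) (v : ℝ) : Store := { s with rreg := Function.update s.rreg a v }

/-- Assign to cell `j` of the natural-number array `k`. -/
def Store.setIArr (s : Store) (k j v : ℕ) : Store :=
  { s with iarr := Function.update s.iarr k (Function.update (s.iarr k) j v) }

/-- Assign to cell `j` of the real array `k`. -/
def Store.setRArr (s : Store) (k j : ℕ) (v : ℝ) : Store :=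
  { s with rarr := Function.update s.rarr k (Function.update (s.rarr k) j v) }

/-- The effect of an elementary operation. Division by zero yields zero. -/
noncomputable def Op.exec : Op → Store → Store
  | .iconst a c, s => s.setI a c
  | .icopy a b, s => s.setI a (s.ireg b)
  | .iadd a b c, s => s.setI a (s.ireg b + s.ireg c)
  | .isub a b c, s => s.setI a (s.ireg b - s.ireg c)
  | .iload a k i, s => s.setI a (s.iarr k (s.ireg i))
  | .istore k i b, s => s.setIArr k (s.ireg i) (s.ireg b)
  | .rconst a c, s => s.setR a (c : ℝ)
  | .rcopy a b, s => s.setR a (s.rreg b)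
  | .radd a b c, s => s.setR a (s.rreg b + s.rreg c)
  | .rsub a b c, s => s.setR a (s.rreg b - s.rreg c)
  | .rmul a b c, s => s.setR a (s.rreg b * s.rreg c)
  | .rdiv a b c, s => s.setR a (s.rreg b / s.rreg c)
  | .rload a k i, s => s.setR a (s.rarr k (s.ireg i))
  | .rstore k i b, s => s.setRArr k (s.ireg i) (s.rreg b)

/-- Tests: comparisons of two registers. -/
inductive Test where
  | ilt (a b : ℕ)
  | ile (a b : ℕ)
  | ieq (a b : ℕ)
  | ine (a b : ℕ)
  | rlt (a b : ℕ)
  | rle (a b : ℕ)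

/-- The truth value of a test. -/
def Test.Holds : Test → Store → Prop
  | .ilt a b, s => s.ireg a < s.ireg b
  | .ile a b, s => s.ireg a ≤ s.ireg b
  | .ieq a b, s => s.ireg a = s.ireg b
  | .ine a b, s => s.ireg a ≠ s.ireg b
  | .rlt a b, s => s.rreg a < s.rreg b
  | .rle a b, s => s.rreg a ≤ s.rreg b

/-- Programs, with structured control flow: sequencing, branching and while-loops. -/
inductive Program where
  | op (o : Op)
  | seq (p q : Program)
  | ite (t : Test) (p q : Program)
  | loop (t : Test) (p : Program)

/-- A configuration: the list of programs still to be run, in order, and the memory. The machine has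
halted when the list is empty. -/
abbrev Config : Type := List Program × Store

open Classical in
/-- One step of the machine. -/
noncomputable def step : Config → Config
  | ([], s) => ([], s)
  | (.op o :: k, s) => (k, o.exec s)
  | (.seq p q :: k, s) => (p :: q :: k, s)
  | (.ite t p q :: k, s) => if t.Holds s then (p :: k, s) else (q :: k, s)
  | (.loop t p :: k, s) => if t.Holds s then (p :: .loop t p :: k, s) else (k, s)

/-- Started on the memory `s`, the program `P` has halted with memory `s'` after `m` steps. -/
def HaltsIn (P : Program) (s : Store) (m : ℕ) (s' : Store) : Prop :=
  step^[m] ([P], s) = ([], s')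

end RealRAM

/-! ## Approximation of the partition function by a real RAM -/

namespace TwoSpin

open Classical in
/-- The input of the algorithm: `n` in natural-number register `0`; `β`, `γ`, `ε` in the real
registers `0`, `1`, `2`; the adjacency matrix (entry `(i, j)` in cell `i * n + j`) in natural-number
array `0`; the field of vertex `i` in cell `i` of real array `0`; zeros elsewhere. -/
noncomputable def input (β γ : ℝ) (n : ℕ) (G : SimpleGraph (Fin n)) (π : Fin n → ℝ) (ε : ℝ) :
    RealRAM.Store where
  ireg a := if a = 0 then n else 0
  rreg a := if a = 0 then β else if a = 1 then γ else if a = 2 then ε else 0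
  iarr k c := if k = 0 ∧ ∃ i j : Fin n, c = i * n + j ∧ G.Adj i j then 1 else 0
  rarr k c := if h : k = 0 ∧ c < n then π ⟨c, h.2⟩ else 0

/-- On every graph with `n ≥ 1` vertices, every field with values in `(0, lam]` and every
`0 < ε < 1`, the program `P` halts within `T n ε` steps, with a number in real register `0` that
approximates the partition function within relative error `ε`. -/
def ApproximatesWithin (P : RealRAM.Program) (β γ lam : ℝ) (T : ℕ → ℝ → ℝ) : Prop :=
  ∀ (n : ℕ) (G : SimpleGraph (Fin n)) (π : Fin n → ℝ) (ε : ℝ),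
    0 < n → (∀ v, 0 < π v ∧ π v ≤ lam) → 0 < ε → ε < 1 →
    ∃ (m : ℕ) (s : RealRAM.Store),
      RealRAM.HaltsIn P (input β γ n G π ε) m s ∧
      (m : ℝ) ≤ T n ε ∧
      |s.rreg 0 - partitionFunction β γ π G| ≤ ε * partitionFunction β γ π G

/-- `P` is a fully polynomial-time approximation scheme for the partition function with parameters
`β`, `γ` and fields in `(0, lam]`: the number of steps is bounded by a polynomial in `n` and
`1 / ε`. (As `n` and `1 / ε` are at least `1`, it is enough to consider powers of their product.) -/
def IsFPTAS (P : RealRAM.Program) (β γ lam : ℝ) : Prop :=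
  ∃ (C : ℝ) (k : ℕ), ApproximatesWithin P β γ lam fun n ε => C * ((n : ℝ) * (1 / ε)) ^ k

end TwoSpin

open Filter Topology

namespace TwoSpin

/-! ## The message function and the critical field -/

/-! Eliminating the vertices one by one, each with spin `1`, writes the partition function as a
product of factors `(1 + R) * γ ^ d`, where `R` is the ratio of the weights with spin `0` and spin
`1` at the eliminated vertex and `d` is its current degree (`setPartition_eq_prod`). A ratio equals
the field at the vertex times a product of `msg` over ratios at its neighbours, taken in a smaller
graph (`ratio_eq_prod`). Pinned neighbours enter only as factors `β ≤ 1` or `1 / γ < 1` in the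
field, so fields never exceed `lam`. Since `msg` is increasing, cutting the recursion off with `0`
or with the field bounds every ratio from below and from above (`estimate_bounds`).

The gap between the two bounds is controlled in a potential whose derivative is `1 / max t (x * log
(lam / x))` on `[0, lam]`. The condition `lam < criticalField β γ` says exactly that `log lam` lies
below the minimum of `critFun`, and this rearranges to `x * log (lam / x) * slope x < lmsg x`. Along
the recursion the decays `lmsg` of the children add up to at most `log (lam / F)`, where `F` is the
new ratio, so this pointwise inequality gives a contraction by some `α < 1` whatever the degree. For
large degree `d` the value `F` is exponentially small in `d` and the floor `t` turns this into a
much better factor. Together they give the rate `(d + 1) ^ (-κ)` (`potential_step_le`,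
`exists_potential`).

The recursion is therefore truncated by a budget `B` that is divided by `d + 1` at a vertex with `d`
neighbours. The gap is then at most `K * B ^ (-κ)` (`exists_estimate_decay`), while the search takes
a number of rounds linear in `B` (`callBound_recursion`), with no bound on the degrees. A budget
polynomial in `n / ε` suffices.

The program computes both estimates and doubles the budget until they certify the relative error
`ε`. It needs none of `lam`, `K`, `κ`, so one program serves all subcritical `lam`; these constants
enter only the bound on the running time. The rest is a verification that a search with an explicit
stack on the real RAM carries this out (`searchNext_call`, `exec_searchStep`, `exec_approximate`).
-/

/-- The factor that a neighbour with ratio `x` contributes to a ratio. -/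
noncomputable def msg (β γ x : ℝ) : ℝ := (β * x + 1) / (x + γ)

theorem msg_pos {β γ x : ℝ} (hβ : 0 < β) (hγ : 1 < γ) (hx : 0 ≤ x) : 0 < msg β γ x := by
  unfold msg; positivity

theorem msg_le_msg {β γ x y : ℝ} (hβγ : 1 < β * γ) (hγ : 1 < γ) (hx : 0 ≤ x)
    (hxy : x ≤ y) : msg β γ x ≤ msg β γ y := by
  unfold msg
  rw [div_le_div_iff₀ (by linarith) (by linarith)]
  nlinarith

theorem msg_le_one {β γ x : ℝ} (hβ1 : β ≤ 1) (hγ : 1 < γ) (hx : 0 ≤ x) : msg β γ x ≤ 1 := by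
  unfold msg
  rw [div_le_one (by linarith)]
  nlinarith

/-- The decay `-log (msg β γ x)`. -/
noncomputable def lmsg (β γ x : ℝ) : ℝ := Real.log (x + γ) - Real.log (β * x + 1)

theorem exp_neg_lmsg {β γ x : ℝ} (hβ : 0 < β) (hγ : 1 < γ) (hx : 0 ≤ x) :
    Real.exp (-lmsg β γ x) = msg β γ x := by
  have h1 : 0 < x + γ := by linarith
  have h2 : 0 < β * x + 1 := by positivity
  rw [lmsg, neg_sub, Real.exp_sub, Real.exp_log h1, Real.exp_log h2, msg]

theorem lmsg_pos {β γ x : ℝ} (hβ : 0 < β) (hβ1 : β ≤ 1) (hγ : 1 < γ) (hx : 0 ≤ x) :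
    0 < lmsg β γ x := by
  have h2 : 0 < β * x + 1 := by positivity
  exact sub_pos.2 (Real.log_lt_log h2 (by nlinarith))

theorem lmsg_anti {β γ x y : ℝ} (hβ : 0 < β) (hβγ : 1 < β * γ) (hγ : 1 < γ)
    (hx : 0 ≤ x) (hxy : x ≤ y) : lmsg β γ y ≤ lmsg β γ x := by
  have h := msg_le_msg hβγ hγ hx hxy
  rw [← exp_neg_lmsg hβ hγ hx, ← exp_neg_lmsg hβ hγ (hx.trans hxy), Real.exp_le_exp] at h
  linarith

theorem hasDerivAt_lmsg {β γ x : ℝ} (hβ : 0 < β) (hγ : 1 < γ) (hx : 0 ≤ x) :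
    HasDerivAt (lmsg β γ) (-((β * γ - 1) / ((β * x + 1) * (x + γ)))) x := by
  have h1 : 0 < x + γ := by linarith
  have h2 : 0 < β * x + 1 := by positivity
  have a := ((hasDerivAt_id x).add_const γ).log h1.ne'
  have b := (((hasDerivAt_id x).const_mul β).add_const 1).log h2.ne'
  refine (a.sub b).congr_deriv ?_
  simp only [id]
  field_simp
  ring

/-- The function whose minimum over the positive reals is the logarithm of the critical field. -/
noncomputable def critFun (β γ x : ℝ) : ℝ :=
  lmsg β γ x * (β * x + (β * γ + 1) + γ / x) / (β * γ - 1) + Real.log x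

/-- The factor next to `lmsg` is `(β * x + 1) * (x + γ) / x`, so differentiating `lmsg` contributes
exactly `-1 / x`, which cancels the derivative of the logarithm. The sign is that of `β - γ / x ^
2`. -/
theorem hasDerivAt_critFun {β γ x : ℝ} (hβ : 0 < β) (hβγ : 1 < β * γ) (hγ : 1 < γ) (hx : 0 < x) :
    HasDerivAt (critFun β γ) ((β - γ / x ^ 2) * lmsg β γ x / (β * γ - 1)) x := by
  have h1 : 0 < x + γ := by linarith
  have h2 : 0 < β * x + 1 := by positivity
  have h3 : β * γ - 1 ≠ 0 := by linarith
  have a := hasDerivAt_lmsg hβ hγ hx.le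
  have b : HasDerivAt (fun x : ℝ => β * x + (β * γ + 1) + γ / x) (β - γ / x ^ 2) x := by
    have := (((hasDerivAt_id x).const_mul β).add_const (β * γ + 1)).add
      ((hasDerivAt_inv hx.ne').const_mul γ)
    refine this.congr_deriv ?_
    ring
  refine (((a.mul b).div_const (β * γ - 1)).add (Real.hasDerivAt_log hx.ne')).congr_deriv ?_
  have h4 : β * x + (β * γ + 1) + γ / x = (β * x + 1) * (x + γ) / x := by
    field_simp; ring
  rw [h4]
  field_simp
  ring

/-- `critFun` decreases up to `√(γ / β)` and increases afterwards; its value there is the logarithm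
of the critical field. -/
theorem log_criticalField_le {β γ x : ℝ} (hβ : 0 < β) (hβ1 : β ≤ 1) (hβγ : 1 < β * γ) (hγ : 1 < γ)
    (hx : 0 < x) : Real.log (criticalField β γ) ≤ critFun β γ x := by
  set s := √(β * γ) with hs
  have hs1 : 1 < s := by rw [hs]; exact Real.lt_sqrt_of_sq_lt (by linarith)
  have hss : s ^ 2 = β * γ := Real.sq_sqrt (by linarith)
  set y := s / β with hy
  have hy0 : 0 < y := by positivity
  have hy2 : β * y ^ 2 = γ := by rw [hy, div_pow, hss]; field_simp
  -- With `β * y = γ / y = s` one gets `lmsg y = log y`, and the factor becomes `(s + 1) ^ 2 / (s ^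
  -- 2 - 1)`, the critical degree `Δ`. The value is `(Δ + 1) * log y`, and `γ / β = y ^ 2`.
  have hval : critFun β γ y = Real.log (criticalField β γ) := by
    have hby : β * y = s := by rw [hy]; field_simp
    have hgy : γ / y = s := by rw [div_eq_iff hy0.ne', ← hy2, ← hby]; ring
    have hyg : y + γ = y * (s + 1) := by rw [← hy2, ← hby]; ring
    have hgb : γ / β = y ^ 2 := by rw [← hy2]; field_simp
    rw [critFun, lmsg, hby, hgy, hyg, Real.log_mul hy0.ne' (by linarith), criticalField,
      Real.log_rpow (by positivity), hgb, Real.log_pow, criticalDegree, ← hs, ← hss]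
    have : s - 1 ≠ 0 := by linarith
    have h2 : s ^ 2 - 1 ≠ 0 := by nlinarith
    have h3 : s ^ 2 - 1 = (s - 1) * (s + 1) := by ring
    rw [h3] at *
    have : s + 1 ≠ 0 := by linarith
    field_simp
    push_cast
    ring
  rw [← hval]
  have hcont : ∀ z, 0 < z → ContinuousAt (critFun β γ) z := fun z hz =>
    (hasDerivAt_critFun hβ hβγ hγ hz).continuousAt
  rcases le_total x y with hxy | hxy
  · refine antitoneOn_of_deriv_nonpos (convex_Icc x y)
      (fun z hz => (hcont z (hx.trans_le hz.1)).continuousWithinAt)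
      (fun z hz => ?_) (fun z hz => ?_) ⟨le_rfl, hxy⟩ ⟨hxy, le_rfl⟩ hxy
    all_goals
      rw [interior_Icc] at hz
      have hz0 := hx.trans hz.1
    · exact (hasDerivAt_critFun hβ hβγ hγ hz0).differentiableAt.differentiableWithinAt
    · rw [(hasDerivAt_critFun hβ hβγ hγ hz0).deriv]
      refine div_nonpos_of_nonpos_of_nonneg (mul_nonpos_of_nonpos_of_nonneg ?_
        (lmsg_pos hβ hβ1 hγ hz0.le).le) (by linarith)
      rw [sub_nonpos, le_div_iff₀ (by positivity), ← hy2]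
      have := pow_le_pow_left₀ hz0.le hz.2.le 2
      nlinarith
  · refine monotoneOn_of_deriv_nonneg (convex_Icc y x)
      (fun z hz => (hcont z (hy0.trans_le hz.1)).continuousWithinAt)
      (fun z hz => ?_) (fun z hz => ?_) ⟨le_rfl, hxy⟩ ⟨hxy, le_rfl⟩ hxy
    all_goals
      rw [interior_Icc] at hz
      have hz0 := hy0.trans hz.1
    · exact (hasDerivAt_critFun hβ hβγ hγ hz0).differentiableAt.differentiableWithinAt
    · rw [(hasDerivAt_critFun hβ hβγ hγ hz0).deriv]
      refine div_nonneg (mul_nonneg ?_ (lmsg_pos hβ hβ1 hγ hz0.le).le) (by linarith)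
      rw [sub_nonneg, div_le_iff₀ (by positivity), ← hy2]
      have := pow_le_pow_left₀ hy0.le hz.1.le 2
      nlinarith

/-! ## The potential -/

/-- `x * log (lam / x)`, extended continuously to `0`. -/
noncomputable def entropyWeight (lam x : ℝ) : ℝ := x * Real.log lam - x * Real.log x

theorem continuous_entropyWeight (lam : ℝ) : Continuous (entropyWeight lam) :=
  (continuous_id.mul continuous_const).sub Real.continuous_mul_log

/-- The logarithmic derivative of `msg`. -/
noncomputable def slope (β γ x : ℝ) : ℝ := (β * γ - 1) / ((β * x + 1) * (x + γ))

theorem slope_pos {β γ x : ℝ} (hβ : 0 < β) (hβγ : 1 < β * γ) (hγ : 1 < γ) (hx : 0 ≤ x) :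
    0 < slope β γ x := by
  have : 0 < β * γ - 1 := by linarith
  unfold slope; positivity

theorem slope_le {β γ x : ℝ} (hβ : 0 < β) (hβγ : 1 < β * γ) (hγ : 1 < γ) (hx : 0 ≤ x) :
    slope β γ x ≤ β * γ - 1 := by
  unfold slope
  have h : 1 ≤ (β * x + 1) * (x + γ) := by
    have : 0 ≤ β * x := by positivity
    nlinarith
  exact div_le_self (by linarith) h

/-- For `x > 0` one has `critFun x - log x = lmsg x / (x * slope x)`, so this is `log lam < critFun
x` rearranged. At `0` the left side vanishes. -/
theorem entropyWeight_mul_slope_lt {β γ lam x : ℝ} (hβ : 0 < β) (hβ1 : β ≤ 1) (hβγ : 1 < β * γ)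
    (hγ : 1 < γ) (hlam : 0 < lam) (hlc : lam < criticalField β γ) (hx : 0 ≤ x) :
    entropyWeight lam x * slope β γ x < lmsg β γ x := by
  have hL := lmsg_pos hβ hβ1 hγ hx
  rcases hx.eq_or_lt with rfl | hx
  · simpa [entropyWeight] using hL
  have h1 : Real.log lam - Real.log x < critFun β γ x - Real.log x :=
    sub_lt_sub_right ((Real.log_lt_log hlam hlc).trans_le
      (log_criticalField_le hβ hβ1 hβγ hγ hx)) _
  have h2 := slope_pos hβ hβγ hγ hx.le
  have h3 : x * (critFun β γ x - Real.log x) * slope β γ x = lmsg β γ x := by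
    have : β * γ - 1 ≠ 0 := by linarith
    have h1 : 0 < x + γ := by linarith
    have h2 : 0 < β * x + 1 := by positivity
    have h4 : β * x + (β * γ + 1) + γ / x = (β * x + 1) * (x + γ) / x := by
      field_simp; ring
    rw [critFun, slope, h4]
    field_simp
    ring
  calc entropyWeight lam x * slope β γ x
      = x * (Real.log lam - Real.log x) * slope β γ x := by rw [entropyWeight]; ring
    _ < x * (critFun β γ x - Real.log x) * slope β γ x := by gcongr
    _ = _ := h3

/-- Compactness of `[0, lam]` makes the strict inequality uniform. The floor `t > 0` is needed
because the entropy weight vanishes at both ends of the interval and its reciprocal could not serve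
as a derivative there. -/
theorem exists_contraction_constants {β γ lam : ℝ} (hβ : 0 < β) (hβ1 : β ≤ 1) (hβγ : 1 < β * γ)
    (hγ : 1 < γ) (hlam : 0 < lam) (hlc : lam < criticalField β γ) :
    ∃ α t : ℝ, 0 < α ∧ α < 1 ∧ 0 < t ∧ ∀ x, 0 ≤ x → x ≤ lam →
      max t (entropyWeight lam x) * slope β γ x ≤ α * lmsg β γ x := by
  have hcL : ContinuousOn (lmsg β γ) (Set.Icc 0 lam) := fun x hx =>
    (hasDerivAt_lmsg hβ hγ hx.1).continuousAt.continuousWithinAt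
  have hcS : ContinuousOn (slope β γ) (Set.Icc 0 lam) := by
    refine ContinuousOn.div continuousOn_const (by fun_prop) fun x hx => ?_
    have h1 : 0 < x + γ := by linarith [hx.1]
    have h2 : 0 < β * x + 1 := by have := hx.1; positivity
    positivity
  have hc : ContinuousOn (fun x => entropyWeight lam x * slope β γ x / lmsg β γ x)
      (Set.Icc 0 lam) :=
    ((continuous_entropyWeight lam).continuousOn.mul hcS).div hcL
      fun x hx => (lmsg_pos hβ hβ1 hγ hx.1).ne'
  obtain ⟨x₀, hx₀, hmax⟩ := isCompact_Icc.exists_isMaxOn ⟨0, le_rfl, hlam.le⟩ hc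
  set r := entropyWeight lam x₀ * slope β γ x₀ / lmsg β γ x₀
  have hr : r < 1 := (div_lt_one (lmsg_pos hβ hβ1 hγ hx₀.1)).2
    (entropyWeight_mul_slope_lt hβ hβ1 hβγ hγ hlam hlc hx₀.1)
  have hLm := lmsg_pos hβ hβ1 hγ hlam.le
  have hbg : 0 < β * γ - 1 := by linarith
  have hα : 0 < max r (1 / 2) := lt_max_of_lt_right (by norm_num)
  -- The `1 / 2` only keeps `α` positive. The floor `t` is chosen so that `t * slope ≤ α * lmsg`
  -- follows from `slope ≤ β * γ - 1` and `lmsg lam ≤ lmsg x`.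
  refine ⟨max r (1 / 2), max r (1 / 2) * lmsg β γ lam / (β * γ - 1), hα,
    max_lt hr (by norm_num), by positivity, fun x hx hxl => ?_⟩
  have hL := lmsg_pos hβ hβ1 hγ hx
  have hS := slope_pos hβ hβγ hγ hx
  rw [max_mul_of_nonneg _ _ hS.le]
  refine max_le ?_ ?_
  · calc max r (1 / 2) * lmsg β γ lam / (β * γ - 1) * slope β γ x
        ≤ max r (1 / 2) * lmsg β γ lam / (β * γ - 1) * (β * γ - 1) := by
          gcongr; exact slope_le hβ hβγ hγ hx
      _ = max r (1 / 2) * lmsg β γ lam := by field_simp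
      _ ≤ _ := by gcongr; exact lmsg_anti hβ hβγ hγ hx hxl
  · have := hmax (a := x) ⟨hx, hxl⟩
    have h2 : entropyWeight lam x * slope β γ x / lmsg β γ x ≤ r := this
    rw [div_le_iff₀ hL] at h2
    exact h2.trans (by gcongr; exact le_max_left _ _)

/-- Beyond some degree `D` the exponential bound beats `1 / (d + 1)`; for the finitely many smaller
degrees the constant bound `α` is enough once `κ` is small. Taking `D + 2` keeps the logarithm
positive even for `D = 0`. -/
theorem exists_rate_exponent {α A ρ : ℝ} (hα : 0 < α) (hα1 : α < 1) (hρ : 0 < ρ) (hρ1 : ρ < 1) :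
    ∃ κ : ℝ, 0 < κ ∧ ∀ (d : ℕ) (r : ℝ), r ≤ α → r ≤ A * d * ρ ^ d →
      r ≤ ((d : ℝ) + 1) ^ (-κ) := by
  have h2 := tendsto_pow_const_mul_const_pow_of_lt_one 2 hρ.le hρ1
  have h1 := tendsto_pow_const_mul_const_pow_of_lt_one 1 hρ.le hρ1
  have h : Tendsto (fun d : ℕ => A * ((d : ℝ) ^ 2 * ρ ^ d + (d : ℝ) ^ 1 * ρ ^ d)) atTop (𝓝 0) := by
    simpa using (h2.add h1).const_mul A
  obtain ⟨D, hD⟩ := eventually_atTop.1 (h.eventually (gt_mem_nhds one_pos))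
  have hlog : 0 < Real.log ((D : ℝ) + 2) := Real.log_pos (by linarith [D.cast_nonneg (α := ℝ)])
  have hla : 0 < -Real.log α := by linarith [Real.log_neg hα hα1]
  refine ⟨min 1 (-Real.log α / Real.log ((D : ℝ) + 2)), by positivity, fun d r hr1 hr2 => ?_⟩
  set κ := min 1 (-Real.log α / Real.log ((D : ℝ) + 2))
  have hd : (0 : ℝ) < d + 1 := by positivity
  rcases le_total D d with hDd | hDd
  · have h3 := hD d hDd
    have h4 : r ≤ ((d : ℝ) + 1) ^ (-1 : ℝ) := by
      rw [Real.rpow_neg_one, ← one_div, le_div_iff₀ hd]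
      refine le_trans (mul_le_mul_of_nonneg_right hr2 hd.le) (le_trans (le_of_eq ?_) h3.le)
      ring
    refine h4.trans (Real.rpow_le_rpow_of_exponent_le (by linarith [d.cast_nonneg (α := ℝ)]) ?_)
    exact neg_le_neg (min_le_left _ _)
  · refine hr1.trans ?_
    rw [← Real.log_le_log_iff hα (by positivity), Real.log_rpow hd]
    have h5 : κ * Real.log ((d : ℝ) + 1) ≤ -Real.log α := by
      calc κ * Real.log ((d : ℝ) + 1)
          ≤ -Real.log α / Real.log ((D : ℝ) + 2) * Real.log ((D : ℝ) + 2) := by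
            have : (d : ℝ) ≤ D := by exact_mod_cast hDd
            have h0 : 0 ≤ Real.log ((d : ℝ) + 1) := Real.log_nonneg (by linarith [d.cast_nonneg (α := ℝ)])
            refine mul_le_mul (min_le_right _ _) (Real.log_le_log hd (by linarith)) h0 ?_
            positivity
        _ = _ := by field_simp
    linarith

/-- The reciprocal of the derivative of the potential. -/
noncomputable def speed (lam t x : ℝ) : ℝ := max t (entropyWeight lam (max 0 (min x lam)))

theorem continuous_speed (lam t : ℝ) : Continuous (speed lam t) :=
  continuous_const.max ((continuous_entropyWeight lam).comp (by fun_prop))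

theorem speed_eq {lam t x : ℝ} (hx : 0 ≤ x) (hxl : x ≤ lam) :
    speed lam t x = max t (entropyWeight lam x) := by
  rw [speed, min_eq_left hxl, max_eq_right hx]

theorem entropyWeight_le {lam x : ℝ} (hlam : 0 < lam) (hx : 0 ≤ x) :
    entropyWeight lam x ≤ lam := by
  rcases hx.eq_or_lt with rfl | hx
  · simpa [entropyWeight] using hlam.le
  have h := Real.log_le_sub_one_of_pos (div_pos hlam hx)
  rw [Real.log_div hlam.ne' hx.ne'] at h
  calc entropyWeight lam x = x * (Real.log lam - Real.log x) := by rw [entropyWeight]; ring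
    _ ≤ x * (lam / x - 1) := by gcongr
    _ = lam - x := by field_simp
    _ ≤ lam := by linarith

theorem speed_pos {lam t : ℝ} (ht : 0 < t) (x : ℝ) : 0 < speed lam t x := lt_max_of_lt_left ht

theorem speed_le {lam t : ℝ} (hlam : 0 < lam) (x : ℝ) : speed lam t x ≤ max t lam :=
  max_le_max le_rfl (entropyWeight_le hlam (le_max_left _ _))

/-- The potential. -/
noncomputable def potential (lam t x : ℝ) : ℝ := ∫ y in (0 : ℝ)..x, (speed lam t y)⁻¹

theorem hasDerivAt_potential {lam t : ℝ} (ht : 0 < t) (x : ℝ) :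
    HasDerivAt (potential lam t) (speed lam t x)⁻¹ x := by
  have hc : Continuous fun y => (speed lam t y)⁻¹ :=
    (continuous_speed lam t).inv₀ fun y => (speed_pos ht y).ne'
  exact intervalIntegral.integral_hasDerivAt_right (hc.intervalIntegrable _ _)
    (hc.stronglyMeasurableAtFilter _ _) hc.continuousAt

theorem sub_le_mul_potential_sub {lam t : ℝ} (hlam : 0 < lam) (ht : 0 < t) {x y : ℝ} (h : x ≤ y) :
    y - x ≤ max t lam * (potential lam t y - potential lam t x) := by
  have hK : 0 < max t lam := lt_max_of_lt_left ht
  have := mul_sub_le_image_sub_of_le_deriv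
    (f := potential lam t) (C := (max t lam)⁻¹)
    (fun z => (hasDerivAt_potential ht z).differentiableAt)
    (fun z => by
      rw [(hasDerivAt_potential ht z).deriv]
      exact inv_anti₀ (speed_pos ht z) (speed_le hlam z)) h
  rwa [inv_mul_le_iff₀ hK] at this

theorem strictMono_potential {lam t : ℝ} (ht : 0 < t) : StrictMono (potential lam t) :=
  strictMono_of_deriv_pos fun z => by
    rw [(hasDerivAt_potential ht z).deriv]; exact inv_pos.2 (speed_pos ht z)

theorem continuous_potential {lam t : ℝ} (ht : 0 < t) : Continuous (potential lam t) :=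
  continuous_iff_continuousAt.2 fun z => (hasDerivAt_potential ht z).continuousAt

/-- The clamp inside `speed` keeps the derivative of the potential at least `1 / max t lam` on the
whole line, so the potential is unbounded in both directions and its inverse lives on all of `ℝ`. -/
theorem potential_surjective {lam t : ℝ} (hlam : 0 < lam) (ht : 0 < t) :
    Function.Surjective (potential lam t) := by
  have hK : 0 < max t lam := lt_max_of_lt_left ht
  have h0 : potential lam t 0 = 0 := by simp [potential]
  refine (continuous_potential ht).surjective ?_ ?_
  · refine tendsto_atTop_mono' _ (f₁ := fun x => (max t lam)⁻¹ * x) ?_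
      (tendsto_id.const_mul_atTop (inv_pos.2 hK))
    filter_upwards [eventually_ge_atTop 0] with x hx
    have := sub_le_mul_potential_sub hlam ht hx
    rw [h0] at this
    rw [inv_mul_le_iff₀ hK]
    linarith
  · refine tendsto_atBot_mono' _ (f₁ := fun x => (max t lam)⁻¹ * x) ?_
      (tendsto_id.const_mul_atBot (inv_pos.2 hK))
    filter_upwards [eventually_le_atBot 0] with x hx
    have := sub_le_mul_potential_sub hlam ht hx
    rw [h0] at this
    rw [le_inv_mul_iff₀ hK]
    linarith

/-- The inverse `θ` solves `θ' = speed θ`. It supplies paths between two ratios that are linear in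
the potential. -/
theorem exists_potential_inverse {lam t : ℝ} (hlam : 0 < lam) (ht : 0 < t) :
    ∃ θ : ℝ → ℝ, Monotone θ ∧ (∀ x, θ (potential lam t x) = x) ∧
      ∀ y, HasDerivAt θ (speed lam t (θ y)) y := by
  let e := (strictMono_potential (lam := lam) ht).orderIsoOfSurjective _
    (potential_surjective hlam ht)
  refine ⟨e.symm, e.symm.monotone, fun x => e.symm_apply_apply x, fun y => ?_⟩
  have h := (hasDerivAt_potential (lam := lam) ht (e.symm y))
  have := h.of_local_left_inverse (g := e.symm) e.symm.continuous.continuousAt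
    (inv_pos.2 (speed_pos ht _)).ne' (Eventually.of_forall fun z => e.apply_symm_apply z)
  simpa using this

/-- One step of the recursion contracts the potential by a factor that decays with the degree. -/
theorem potential_step_le {β γ lam : ℝ} (hβ : 0 < β) (hβ1 : β ≤ 1) (hβγ : 1 < β * γ)
    (hγ : 1 < γ) (hlam : 0 < lam) {α t κ : ℝ} (ht : 0 < t)
    (hc : ∀ x, 0 ≤ x → x ≤ lam →
      max t (entropyWeight lam x) * slope β γ x ≤ α * lmsg β γ x)
    (hα : 0 < α) (hκ : ∀ (d : ℕ) (r : ℝ), r ≤ α →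
      r ≤ lam / t * α * lmsg β γ 0 * d * msg β γ lam ^ d → r ≤ ((d : ℝ) + 1) ^ (-κ))
    {ι : Type*} (s : Finset ι) (p D : ℝ) (lo hi : ι → ℝ) (hp : 0 < p) (hpl : p ≤ lam)
    (hlo : ∀ i ∈ s, 0 ≤ lo i) (hlh : ∀ i ∈ s, lo i ≤ hi i) (hhi : ∀ i ∈ s, hi i ≤ lam)
    (hD0 : 0 ≤ D) (hD : ∀ i ∈ s, potential lam t (hi i) - potential lam t (lo i) ≤ D) :
    potential lam t (p * ∏ i ∈ s, msg β γ (hi i)) - potential lam t (p * ∏ i ∈ s, msg β γ (lo i))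
      ≤ ((s.card : ℝ) + 1) ^ (-κ) * D := by
  obtain ⟨θ, hθm, hθ, hθd⟩ := exists_potential_inverse (t := t) hlam ht
  -- All children move simultaneously from `lo` to `hi`, linearly in the potential; `F` is the value
  -- of the recursion along this path, and the mean value inequality is applied to its potential.
  let x : ι → ℝ → ℝ := fun i τ =>
    θ (potential lam t (lo i) + τ * (potential lam t (hi i) - potential lam t (lo i)))
  let F : ℝ → ℝ := fun τ => Real.exp (Real.log p + ∑ i ∈ s, -lmsg β γ (x i τ))
  have hΔ : ∀ i ∈ s, 0 ≤ potential lam t (hi i) - potential lam t (lo i) := fun i his =>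
    sub_nonneg.2 ((strictMono_potential ht).monotone (hlh i his))
  have hx : ∀ i ∈ s, ∀ τ, 0 ≤ τ → τ ≤ 1 → 0 ≤ x i τ ∧ x i τ ≤ lam := by
    intro i his τ h0 h1
    have hd := hΔ i his
    constructor
    · refine (hlo i his).trans ?_
      rw [← hθ (lo i)]
      exact hθm (by nlinarith)
    · refine le_trans ?_ (hhi i his)
      rw [← hθ (hi i)]
      exact hθm (by nlinarith)
  have hF : ∀ y : ι → ℝ, (∀ i ∈ s, 0 ≤ y i) →
      Real.exp (Real.log p + ∑ i ∈ s, -lmsg β γ (y i)) = p * ∏ i ∈ s, msg β γ (y i) := by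
    intro y hy
    rw [Real.exp_add, Real.exp_log hp, Real.exp_sum]
    congr 1
    exact Finset.prod_congr rfl fun i his => exp_neg_lmsg hβ hγ (hy i his)
  have hF0 : p * ∏ i ∈ s, msg β γ (lo i) = F 0 := by
    rw [← hF lo hlo]; simp [F, x, hθ]
  have hF1 : p * ∏ i ∈ s, msg β γ (hi i) = F 1 := by
    rw [← hF hi fun i his => (hlo i his).trans (hlh i his)]; simp [F, x, hθ]
  have hderiv : ∀ τ, 0 ≤ τ → τ ≤ 1 → HasDerivAt (fun τ => potential lam t (F τ))
      ((speed lam t (F τ))⁻¹ * (F τ * ∑ i ∈ s, slope β γ (x i τ) * (speed lam t (x i τ) *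
        (potential lam t (hi i) - potential lam t (lo i))))) τ := by
    intro τ h0 h1
    refine (hasDerivAt_potential ht (F τ)).comp τ ?_
    refine HasDerivAt.exp ?_
    refine HasDerivAt.const_add _ ?_
    refine HasDerivAt.fun_sum fun i his => ?_
    have hd : HasDerivAt (x i) (speed lam t (x i τ) *
        (potential lam t (hi i) - potential lam t (lo i))) τ := by
      refine (hθd _).comp τ ?_
      simpa using ((hasDerivAt_id τ).mul_const
        (potential lam t (hi i) - potential lam t (lo i))).const_add (potential lam t (lo i))
    have := ((hasDerivAt_lmsg hβ hγ (hx i his τ h0 h1).1).comp τ hd).neg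
    refine this.congr_deriv ?_
    rw [slope]; ring
  have hbound : ∀ τ, 0 ≤ τ → τ ≤ 1 →
      (speed lam t (F τ))⁻¹ * (F τ * ∑ i ∈ s, slope β γ (x i τ) * (speed lam t (x i τ) *
        (potential lam t (hi i) - potential lam t (lo i)))) ≤ ((s.card : ℝ) + 1) ^ (-κ) * D := by
    intro τ h0 h1
    have hFp : 0 < F τ := Real.exp_pos _
    have hsp := speed_pos (lam := lam) ht (F τ)
    set Λ := ∑ i ∈ s, lmsg β γ (x i τ) with hΛ
    have hΛ0 : 0 ≤ Λ := Finset.sum_nonneg fun i his =>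
      (lmsg_pos hβ hβ1 hγ (hx i his τ h0 h1).1).le
    have hlogF : Real.log (F τ) = Real.log p - Λ := by
      simp only [F, Real.log_exp, Finset.sum_neg_distrib, hΛ]; ring
    have hFlam : F τ ≤ lam := by
      rw [← Real.log_le_log_iff hFp hlam, hlogF]
      have := Real.log_le_log hp hpl
      linarith
    have h2 : ∑ i ∈ s, slope β γ (x i τ) * (speed lam t (x i τ) *
        (potential lam t (hi i) - potential lam t (lo i))) ≤ α * Λ * D := by
      rw [hΛ, Finset.mul_sum, Finset.sum_mul]
      refine Finset.sum_le_sum fun i his => ?_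
      obtain ⟨hx0, hx1⟩ := hx i his τ h0 h1
      have h3 := hc _ hx0 hx1
      rw [← speed_eq hx0 hx1] at h3
      have h4 := mul_pos (speed_pos (lam := lam) ht (x i τ)) (slope_pos hβ hβγ hγ hx0)
      calc _ = speed lam t (x i τ) * slope β γ (x i τ) *
            (potential lam t (hi i) - potential lam t (lo i)) := by ring
        _ ≤ speed lam t (x i τ) * slope β γ (x i τ) * D := by gcongr; exact hD i his
        _ ≤ _ := by gcongr
    -- The contraction factor is bounded twice: by `α` through the entropy weight, and by a quantity
    -- exponentially small in the degree through the floor `t`. The choice of `κ` combines the two.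
    have h5 : (speed lam t (F τ))⁻¹ * (F τ * (α * Λ)) ≤ ((s.card : ℝ) + 1) ^ (-κ) := by
      refine hκ _ _ ?_ ?_
      · rw [inv_mul_le_iff₀ hsp]
        have h6 : F τ * Λ ≤ speed lam t (F τ) := by
          rw [speed_eq hFp.le hFlam]
          refine le_trans ?_ (le_max_right _ _)
          -- Here the form of the potential pays off: the total decay is `log p - log F`, hence `F *
          -- Λ` is at most the entropy weight of `F`, independently of the number of children.
          have : Λ ≤ Real.log lam - Real.log (F τ) := by
            have := Real.log_le_log hp hpl
            linarith
          calc F τ * Λ ≤ F τ * (Real.log lam - Real.log (F τ)) := by gcongr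
            _ = _ := by rw [entropyWeight]; ring
        nlinarith
      · have h6 : F τ ≤ lam * msg β γ lam ^ s.card := by
          have : F τ = p * ∏ i ∈ s, msg β γ (x i τ) :=
            hF (fun i => x i τ) fun i his => (hx i his τ h0 h1).1
          rw [this]
          have h7 : ∏ i ∈ s, msg β γ (x i τ) ≤ msg β γ lam ^ s.card := by
            rw [← Finset.prod_const]
            exact Finset.prod_le_prod (fun i his => (msg_pos hβ hγ (hx i his τ h0 h1).1).le)
              fun i his => msg_le_msg hβγ hγ (hx i his τ h0 h1).1 (hx i his τ h0 h1).2
          have h8 : 0 ≤ ∏ i ∈ s, msg β γ (x i τ) :=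
            Finset.prod_nonneg fun i his => (msg_pos hβ hγ (hx i his τ h0 h1).1).le
          exact mul_le_mul hpl h7 h8 hlam.le
        have h7 : Λ ≤ s.card * lmsg β γ 0 := by
          rw [← nsmul_eq_mul]
          exact Finset.sum_le_card_nsmul _ _ _ fun i his =>
            lmsg_anti hβ hβγ hγ le_rfl (hx i his τ h0 h1).1
        have h8 : (speed lam t (F τ))⁻¹ ≤ t⁻¹ := inv_anti₀ ht (le_max_left _ _)
        have h9 := (msg_pos hβ hγ hlam.le)
        calc (speed lam t (F τ))⁻¹ * (F τ * (α * Λ))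
            ≤ t⁻¹ * (lam * msg β γ lam ^ s.card * (α * (s.card * lmsg β γ 0))) := by gcongr
          _ = _ := by ring
    calc _ ≤ (speed lam t (F τ))⁻¹ * (F τ * (α * Λ * D)) := by gcongr
      _ = (speed lam t (F τ))⁻¹ * (F τ * (α * Λ)) * D := by ring
      _ ≤ _ := by gcongr
  rw [hF0, hF1]
  have := (convex_Icc (0 : ℝ) 1).image_sub_le_mul_sub_of_deriv_le
    (f := fun τ => potential lam t (F τ)) (C := ((s.card : ℝ) + 1) ^ (-κ) * D)
    (fun τ hτ => (hderiv τ hτ.1 hτ.2).continuousAt.continuousWithinAt)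
    (fun τ hτ => by
      rw [interior_Icc] at hτ
      exact (hderiv τ hτ.1.le hτ.2.le).differentiableAt.differentiableWithinAt)
    (fun τ hτ => by
      rw [interior_Icc] at hτ
      rw [(hderiv τ hτ.1.le hτ.2.le).deriv]
      exact hbound τ hτ.1.le hτ.2.le) 0 ⟨le_rfl, zero_le_one⟩ 1 ⟨zero_le_one, le_rfl⟩ zero_le_one
  simpa using this

/-- A potential in which the recursion contracts by a negative power of one plus the degree. -/
theorem exists_potential {β γ lam : ℝ} (hβ : 0 < β) (hβ1 : β ≤ 1) (hβγ : 1 < β * γ)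
    (hγ : 1 < γ) (hlam : 0 < lam) (hlc : lam < criticalField β γ) :
    ∃ (Ψ : ℝ → ℝ) (K κ : ℝ), StrictMono Ψ ∧ 0 < K ∧ 0 < κ ∧
      (∀ x y, x ≤ y → y - x ≤ K * (Ψ y - Ψ x)) ∧
      ∀ (s : Finset ℕ) (p D : ℝ) (lo hi : ℕ → ℝ), 0 < p → p ≤ lam →
        (∀ i ∈ s, 0 ≤ lo i) → (∀ i ∈ s, lo i ≤ hi i) → (∀ i ∈ s, hi i ≤ lam) → 0 ≤ D →
        (∀ i ∈ s, Ψ (hi i) - Ψ (lo i) ≤ D) →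
        Ψ (p * ∏ i ∈ s, msg β γ (hi i)) - Ψ (p * ∏ i ∈ s, msg β γ (lo i))
          ≤ ((s.card : ℝ) + 1) ^ (-κ) * D := by
  obtain ⟨α, t, hα, hα1, ht, hc⟩ := exists_contraction_constants hβ hβ1 hβγ hγ hlam hlc
  have h1 : msg β γ lam < 1 := by
    rw [← exp_neg_lmsg hβ hγ hlam.le, Real.exp_lt_one_iff]
    linarith [lmsg_pos hβ hβ1 hγ hlam.le]
  obtain ⟨κ, hκ0, hκ⟩ := exists_rate_exponent (A := lam / t * α * lmsg β γ 0) hα hα1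
    (msg_pos hβ hγ hlam.le) h1
  exact ⟨potential lam t, max t lam, κ, strictMono_potential ht, lt_max_of_lt_left ht, hκ0,
    fun x y => sub_le_mul_potential_sub hlam ht,
    fun s p D lo hi hp hpl hlo hlh hhi hD0 hD =>
      potential_step_le hβ hβ1 hβγ hγ hlam ht hc hα hκ s p D lo hi hp hpl hlo hlh hhi hD0 hD⟩

/-! ## The partition function on a set of vertices, and its recursion -/

section SetPartition

variable {A : ℕ → ℕ → Prop} [DecidableRel A]

/-- The number of edges of the relation `A` inside `T`. -/
def edgesIn (A : ℕ → ℕ → Prop) [DecidableRel A] (T : Finset ℕ) : ℕ :=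
  ∑ u ∈ T, ∑ w ∈ T, if u < w ∧ A u w then 1 else 0

theorem edgesIn_insert (hA : ∀ u w, A u w → A w u) {v : ℕ} {T : Finset ℕ} (hv : v ∉ T) :
    edgesIn A (insert v T) = edgesIn A T + (T.filter (A v)).card := by
  simp only [edgesIn, Finset.sum_insert hv, lt_irrefl, false_and, if_false, zero_add,
    Finset.sum_add_distrib, Finset.card_filter]
  rw [← add_assoc, ← Finset.sum_add_distrib, add_comm]
  congr 1
  refine Finset.sum_congr rfl fun w hw => ?_
  have hne : w ≠ v := fun h => hv (h ▸ hw)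
  have : A w v ↔ A v w := ⟨hA _ _, hA _ _⟩
  rcases lt_or_gt_of_ne hne with h | h <;> simp [h, h.not_gt, this]

/-- The partition function of the subgraph induced on `S`. -/
noncomputable def setPartition (β γ : ℝ) (A : ℕ → ℕ → Prop) [DecidableRel A] (S : Finset ℕ)
    (π : ℕ → ℝ) : ℝ :=
  ∑ T ∈ S.powerset, β ^ edgesIn A T * γ ^ edgesIn A (S \ T) * ∏ u ∈ T, π u

/-- Multiply the field by `c` on the neighbours of `v`. -/
noncomputable def scaleNbrs (A : ℕ → ℕ → Prop) [DecidableRel A] (c : ℝ) (v : ℕ) (π : ℕ → ℝ)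
    (w : ℕ) : ℝ := if A v w then c * π w else π w

theorem prod_scaleNbrs (c : ℝ) (v : ℕ) (π : ℕ → ℝ) (T : Finset ℕ) :
    ∏ u ∈ T, scaleNbrs A c v π u = c ^ (T.filter (A v)).card * ∏ u ∈ T, π u := by
  rw [← Finset.prod_const, Finset.prod_filter, ← Finset.prod_mul_distrib]
  refine Finset.prod_congr rfl fun u _ => ?_
  unfold scaleNbrs
  split_ifs <;> simp

theorem setPartition_congr {β γ : ℝ} {S : Finset ℕ} {π π' : ℕ → ℝ} (h : ∀ u ∈ S, π u = π' u) :
    setPartition β γ A S π = setPartition β γ A S π' := by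
  refine Finset.sum_congr rfl fun T hT => ?_
  congr 1
  exact Finset.prod_congr rfl fun u hu => h u (Finset.mem_powerset.1 hT hu)

theorem setPartition_pos {β γ : ℝ} (hβ : 0 < β) (hγ : 0 < γ) {S : Finset ℕ} {π : ℕ → ℝ}
    (h : ∀ u ∈ S, 0 < π u) : 0 < setPartition β γ A S π := by
  refine Finset.sum_pos (fun T hT => ?_) ⟨∅, Finset.empty_mem_powerset S⟩
  have : 0 < ∏ u ∈ T, π u := Finset.prod_pos fun u hu => h u (Finset.mem_powerset.1 hT hu)
  positivity

/-- Here `T` is the set of vertices with spin `0`. Spin `0` at `v` costs `β` for each neighbour in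
`T`. Spin `1` gives `γ` for each neighbour outside `T`, which is `γ` to the full degree times `γ⁻¹`
for each neighbour in `T`. Both effects are changes of the field. -/
theorem setPartition_insert {β γ : ℝ} (hγ : γ ≠ 0) (hA : ∀ u w, A u w → A w u)
    {v : ℕ} {S : Finset ℕ} (hv : v ∉ S) (π : ℕ → ℝ) :
    setPartition β γ A (insert v S) π =
      γ ^ (S.filter (A v)).card * setPartition β γ A S (scaleNbrs A γ⁻¹ v π) +
        π v * setPartition β γ A S (scaleNbrs A β v π) := by
  rw [setPartition, Finset.sum_powerset_insert hv, setPartition, setPartition, Finset.mul_sum,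
    Finset.mul_sum]
  congr 1
  · refine Finset.sum_congr rfl fun T hT => ?_
    have hTS := Finset.mem_powerset.1 hT
    have hvT : v ∉ T := fun h => hv (hTS h)
    rw [Finset.insert_sdiff_of_notMem _ hvT,
      edgesIn_insert hA (fun h => hv (Finset.mem_sdiff.1 h).1), prod_scaleNbrs]
    have hcard : (S.filter (A v)).card = ((S \ T).filter (A v)).card + (T.filter (A v)).card := by
      rw [← Finset.card_union_of_disjoint, ← Finset.filter_union, Finset.sdiff_union_of_subset hTS]
      exact Finset.disjoint_filter_filter Finset.sdiff_disjoint
    rw [hcard, pow_add, pow_add, inv_pow]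
    field_simp
  · refine Finset.sum_congr rfl fun T hT => ?_
    have hTS := Finset.mem_powerset.1 hT
    have hvT : v ∉ T := fun h => hv (hTS h)
    have : insert v S \ insert v T = S \ T := by
      ext u
      simp only [Finset.mem_sdiff, Finset.mem_insert, not_or]
      constructor
      · rintro ⟨h | h, h1, h2⟩
        exacts [absurd h h1, ⟨h, h2⟩]
      · rintro ⟨h, h2⟩
        exact ⟨Or.inr h, fun e => hv (e ▸ h), h2⟩
    rw [this, edgesIn_insert hA hvT, Finset.prod_insert hvT, prod_scaleNbrs, pow_add]
    ring

/-- The ratio of the weights of the configurations with `σ v = 0` and those with `σ v = 1`. -/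
noncomputable def ratio (β γ : ℝ) (A : ℕ → ℕ → Prop) [DecidableRel A] (S : Finset ℕ)
    (π : ℕ → ℝ) (v : ℕ) : ℝ :=
  π v * setPartition β γ A (S.erase v) (scaleNbrs A β v π) /
    (γ ^ ((S.erase v).filter (A v)).card * setPartition β γ A (S.erase v) (scaleNbrs A γ⁻¹ v π))

theorem scaleNbrs_pos {c : ℝ} (hc : 0 < c) {π : ℕ → ℝ} {u : ℕ} (h : 0 < π u) (v : ℕ) :
    0 < scaleNbrs A c v π u := by
  unfold scaleNbrs; split_ifs <;> positivity

theorem ratio_pos {β γ : ℝ} (hβ : 0 < β) (hγ : 0 < γ) {S : Finset ℕ} {π : ℕ → ℝ}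
    (h : ∀ u ∈ S, 0 < π u) {v : ℕ} (hv : v ∈ S) : 0 < ratio β γ A S π v := by
  have h1 := setPartition_pos (A := A) (S := S.erase v) hβ hγ
    fun u hu => scaleNbrs_pos (A := A) hβ (h u (Finset.mem_of_mem_erase hu)) v
  have h2 := setPartition_pos (A := A) (S := S.erase v) hβ hγ
    fun u hu => scaleNbrs_pos (A := A) (inv_pos.2 hγ) (h u (Finset.mem_of_mem_erase hu)) v
  have := h v hv
  unfold ratio
  positivity

theorem setPartition_eq_mul_one_add_ratio {β γ : ℝ} (hβ : 0 < β) (hγ : 0 < γ)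
    (hA : ∀ u w, A u w → A w u) {S : Finset ℕ} {π : ℕ → ℝ}
    (h : ∀ u ∈ S, 0 < π u) {v : ℕ} (hv : v ∈ S) :
    setPartition β γ A S π = γ ^ ((S.erase v).filter (A v)).card *
      setPartition β γ A (S.erase v) (scaleNbrs A γ⁻¹ v π) * (1 + ratio β γ A S π v) := by
  have h2 := setPartition_pos (A := A) (S := S.erase v) hβ hγ
    fun u hu => scaleNbrs_pos (A := A) (inv_pos.2 hγ) (h u (Finset.mem_of_mem_erase hu)) v
  conv_lhs => rw [← Finset.insert_erase hv]
  rw [setPartition_insert hγ.ne' hA (Finset.notMem_erase v S), ratio]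
  generalize setPartition β γ A (S.erase v) (scaleNbrs A γ⁻¹ v π) = X at h2 ⊢
  field_simp

theorem scaleNbrs_congr {c : ℝ} {v u : ℕ} {π π' : ℕ → ℝ} (h : π u = π' u) :
    scaleNbrs A c v π u = scaleNbrs A c v π' u := by
  simp [scaleNbrs, h]

/-- The field at `v` enters the ratio at `v` only as a linear factor. -/
theorem ratio_congr {β γ : ℝ} {S : Finset ℕ} {π π' : ℕ → ℝ} {v : ℕ} (c : ℝ)
    (hv : π v = c * π' v) (h : ∀ u ∈ S, u ≠ v → π u = π' u) :
    ratio β γ A S π v = c * ratio β γ A S π' v := by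
  have h' : ∀ c', ∀ u ∈ S.erase v, scaleNbrs A c' v π u = scaleNbrs A c' v π' u := fun c' u hu =>
    scaleNbrs_congr (h u (Finset.mem_of_mem_erase hu) (Finset.ne_of_mem_erase hu))
  rw [ratio, ratio, setPartition_congr (h' _), setPartition_congr (h' _), hv]
  ring

/-- The field passed from a vertex `v` to its neighbour `u`: `v` is deleted, and the neighbours
of `v` before and after `u` see `v` with spin `0` and `1` respectively. -/
noncomputable def childRow (β γ : ℝ) (A : ℕ → ℕ → Prop) [DecidableRel A] (v u : ℕ) (ρ : ℕ → ℝ)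
    (w : ℕ) : ℝ :=
  if w = v then 0
  else if A v w then if w < u then β * ρ w else if u < w then ρ w / γ else ρ w
  else ρ w

/-- The field in which the neighbours of `v` below `j` see spin `0` and the others spin `1`. -/
noncomputable def hybridRow (β γ : ℝ) (A : ℕ → ℕ → Prop) [DecidableRel A] (v j : ℕ) (ρ : ℕ → ℝ)
    (w : ℕ) : ℝ :=
  if A v w then if w < j then β * ρ w else γ⁻¹ * ρ w else ρ w

theorem hybridRow_pos {β γ : ℝ} (hβ : 0 < β) (hγ : 0 < γ) {ρ : ℕ → ℝ} {w : ℕ} (h : 0 < ρ w)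
    (v j : ℕ) : 0 < hybridRow β γ A v j ρ w := by
  unfold hybridRow; split_ifs <;> positivity

theorem childRow_pos {β γ : ℝ} (hβ : 0 < β) (hγ : 0 < γ) {ρ : ℕ → ℝ} {w v : ℕ} (h : 0 < ρ w)
    (hwv : w ≠ v) (u : ℕ) : 0 < childRow β γ A v u ρ w := by
  unfold childRow; rw [if_neg hwv]; split_ifs <;> positivity

/-- Both hybrid fields coincide with the field passed to `j` except at `j`, where they carry the
extra factors `β` and `γ⁻¹`. With `R` the ratio at `j`, the quotient is `(1 + β * R) / (1 + R / γ) =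
γ * msg R`. -/
theorem setPartition_hybridRow_succ {β γ : ℝ} (hβ : 0 < β) (hγ : 0 < γ)
    (hA : ∀ u w, A u w → A w u) {S : Finset ℕ} {ρ : ℕ → ℝ} {v : ℕ}
    (h : ∀ u ∈ S, 0 < ρ u) (hv : v ∉ S) (j : ℕ) :
    setPartition β γ A S (hybridRow β γ A v (j + 1) ρ) =
      setPartition β γ A S (hybridRow β γ A v j ρ) *
        if j ∈ S ∧ A v j then γ * msg β γ (ratio β γ A S (childRow β γ A v j ρ) j) else 1 := by
  split_ifs with hj
  · obtain ⟨hjS, hvj⟩ := hj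
    have hjv : j ≠ v := fun e => hv (e ▸ hjS)
    have hc : ∀ u ∈ S, 0 < childRow β γ A v j ρ u := fun u hu =>
      childRow_pos hβ hγ (h u hu) (fun e : u = v => hv (e ▸ hu)) j
    have hr := ratio_pos (A := A) hβ hγ hc hjS
    have key : ∀ c : ℝ, 0 < c → ∀ i, hybridRow β γ A v i ρ j = c * childRow β γ A v j ρ j →
        (i = j ∨ i = j + 1) → setPartition β γ A S (hybridRow β γ A v i ρ) =
          γ ^ ((S.erase j).filter (A j)).card *
          setPartition β γ A (S.erase j) (scaleNbrs A γ⁻¹ j (childRow β γ A v j ρ)) *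
            (1 + c * ratio β γ A S (childRow β γ A v j ρ) j) := by
      intro c hc0 i hi hij
      have hagree : ∀ u ∈ S, u ≠ j → hybridRow β γ A v i ρ u = childRow β γ A v j ρ u := by
        intro u hu huj
        have huv : u ≠ v := fun e => hv (e ▸ hu)
        unfold hybridRow childRow
        rw [if_neg huv]
        by_cases hvu : A v u
        · rw [if_pos hvu, if_pos hvu]
          rcases lt_or_gt_of_ne huj with hlt | hlt
          · rw [if_pos hlt, if_pos (by omega)]
          · rw [if_neg (by omega), if_neg (by omega), if_pos hlt, div_eq_inv_mul]
        · rw [if_neg hvu, if_neg hvu]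
      rw [setPartition_eq_mul_one_add_ratio hβ hγ hA
        (fun u hu => hybridRow_pos hβ hγ (h u hu) v i) hjS,
        ratio_congr c hi hagree]
      congr 2
      exact setPartition_congr fun u hu => scaleNbrs_congr
        (hagree u (Finset.mem_of_mem_erase hu) (Finset.ne_of_mem_erase hu))
    rw [key β hβ (j + 1) (by simp [hybridRow, childRow, hvj, hjv]) (Or.inr rfl),
      key γ⁻¹ (inv_pos.2 hγ) j (by simp [hybridRow, childRow, hvj, hjv]) (Or.inl rfl), msg]
    field_simp
    ring
  · rw [mul_one]
    refine setPartition_congr fun u hu => ?_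
    unfold hybridRow
    by_cases hvu : A v u
    · have huj : u ≠ j := fun e => hj ⟨e ▸ hu, e ▸ hvu⟩
      have : u < j + 1 ↔ u < j := by omega
      simp [this]
    · simp [hvu]

/-- Telescoping over the hybrid fields: the neighbours of `v` switch one at a time, in increasing
order, from seeing spin `1` to seeing spin `0`. The factors `γ` collected on the way cancel the
power of `γ` in the denominator of the ratio. -/
theorem ratio_eq_prod {β γ : ℝ} (hβ : 0 < β) (hγ : 0 < γ)
    (hA : ∀ u w, A u w → A w u) {S : Finset ℕ} {ρ : ℕ → ℝ} {v : ℕ}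
    (h : ∀ u ∈ S, 0 < ρ u) :
    ratio β γ A S ρ v = ρ v * ∏ u ∈ (S.erase v).filter (A v),
      msg β γ (ratio β γ A (S.erase v) (childRow β γ A v u ρ) u) := by
  set S' := S.erase v with hS'
  have h' : ∀ u ∈ S', 0 < ρ u := fun u hu => h u (Finset.mem_of_mem_erase hu)
  have hv : v ∉ S' := Finset.notMem_erase v S
  obtain ⟨N, hN⟩ : ∃ N, S' ⊆ Finset.range N := S'.exists_nat_subset_range
  have htel : ∀ m, setPartition β γ A S' (hybridRow β γ A v m ρ) =
      setPartition β γ A S' (hybridRow β γ A v 0 ρ) * ∏ j ∈ Finset.range m,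
        if j ∈ S' ∧ A v j then γ * msg β γ (ratio β γ A S' (childRow β γ A v j ρ) j) else 1 := by
    intro m
    induction m with
    | zero => simp
    | succ m ih =>
      rw [setPartition_hybridRow_succ hβ hγ hA h' hv, ih, Finset.prod_range_succ, mul_assoc]
  have h0 : hybridRow β γ A v 0 ρ = scaleNbrs A γ⁻¹ v ρ := by
    ext w; simp [hybridRow, scaleNbrs]
  have hNe : setPartition β γ A S' (hybridRow β γ A v N ρ) =
      setPartition β γ A S' (scaleNbrs A β v ρ) :=
    setPartition_congr fun u hu => by
      have := Finset.mem_range.1 (hN hu)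
      simp [hybridRow, scaleNbrs, this]
  have hfil : (Finset.range N).filter (fun j => j ∈ S' ∧ A v j) = S'.filter (A v) := by
    ext u
    simp only [Finset.mem_filter, Finset.mem_range]
    exact ⟨fun hu => hu.2, fun hu => ⟨Finset.mem_range.1 (hN hu.1), hu⟩⟩
  have hpos := setPartition_pos (A := A) (S := S') hβ hγ
    fun u hu => scaleNbrs_pos (A := A) (inv_pos.2 hγ) (h' u hu) v
  have := htel N
  rw [← Finset.prod_filter, hfil, hNe, h0, Finset.prod_mul_distrib, Finset.prod_const] at this
  rw [ratio, ← hS', this]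
  generalize setPartition β γ A S' (scaleNbrs A γ⁻¹ v ρ) = X at hpos ⊢
  field_simp

end SetPartition

/-! ## Truncated recursion -/

section Estimate

variable {A : ℕ → ℕ → Prop} [DecidableRel A]

/-- The vertices below `n` on which the field is positive. -/
noncomputable def supp (n : ℕ) (ρ : ℕ → ℝ) : Finset ℕ := (Finset.range n).filter (0 < ρ ·)

/-- The neighbours of `v` on which the field is positive. -/
noncomputable def nbrs (n : ℕ) (A : ℕ → ℕ → Prop) [DecidableRel A] (ρ : ℕ → ℝ) (v : ℕ) :
    Finset ℕ :=
  (Finset.range n).filter fun u => A v u ∧ 0 < ρ u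

/-- The recursion for the ratio at `v` with `k` levels at most, truncated where the budget `B`,
which is divided by one plus the number of neighbours at each level, falls below `1`. A
truncated ratio is replaced by `c` times the field. -/
noncomputable def estimate (β γ : ℝ) (n : ℕ) (A : ℕ → ℕ → Prop) [DecidableRel A] (c : ℝ) :
    ℕ → ℝ → (ℕ → ℝ) → ℕ → ℝ
  | 0, _, ρ, v => c * ρ v
  | k + 1, B, ρ, v =>
    if B < 1 then c * ρ v
    else ρ v * ∏ u ∈ nbrs n A ρ v,
      msg β γ (estimate β γ n A c k (B / ((nbrs n A ρ v).card + 1)) (childRow β γ A v u ρ) u)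

theorem mem_supp {n : ℕ} {ρ : ℕ → ℝ} {v : ℕ} : v ∈ supp n ρ ↔ v < n ∧ 0 < ρ v := by
  simp [supp]

theorem childRow_pos_iff {β γ : ℝ} (hβ : 0 < β) (hγ : 0 < γ) {ρ : ℕ → ℝ} {v u w : ℕ} :
    0 < childRow β γ A v u ρ w ↔ w ≠ v ∧ 0 < ρ w := by
  unfold childRow
  split_ifs with h1 h2 h3 h4 <;> simp_all

/-- Deletion is recorded in the field itself: the remaining vertices are those with positive field.
-/
theorem supp_childRow {β γ : ℝ} (hβ : 0 < β) (hγ : 0 < γ) (n : ℕ) (ρ : ℕ → ℝ) (v u : ℕ) :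
    supp n (childRow β γ A v u ρ) = (supp n ρ).erase v := by
  ext w
  rw [Finset.mem_erase, mem_supp, mem_supp, childRow_pos_iff hβ hγ]
  tauto

theorem nbrs_eq_filter_erase (hirr : ∀ u, ¬A u u) (n : ℕ) (ρ : ℕ → ℝ) (v : ℕ) :
    nbrs n A ρ v = ((supp n ρ).erase v).filter (A v) := by
  ext u
  simp only [nbrs, Finset.mem_filter, Finset.mem_erase, mem_supp, Finset.mem_range]
  constructor
  · rintro ⟨h1, h2, h3⟩
    exact ⟨⟨fun e => hirr v (e ▸ h2), h1, h3⟩, h2⟩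
  · rintro ⟨⟨_, h1, h3⟩, h2⟩
    exact ⟨h1, h2, h3⟩

theorem mem_supp_childRow_of_mem_nbrs {β γ : ℝ} (hβ : 0 < β) (hγ : 0 < γ) (hirr : ∀ u, ¬A u u)
    {n : ℕ} {ρ : ℕ → ℝ} {u v : ℕ} (hu : u ∈ nbrs n A ρ v) :
    u ∈ supp n (childRow β γ A v u ρ) := by
  rw [supp_childRow hβ hγ]
  rw [nbrs_eq_filter_erase hirr] at hu
  exact (Finset.mem_filter.1 hu).1

theorem card_supp_childRow {β γ : ℝ} (hβ : 0 < β) (hγ : 0 < γ) {n k : ℕ} {ρ : ℕ → ℝ} {v : ℕ}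
    (hv : v ∈ supp n ρ) (hk : (supp n ρ).card ≤ k + 1) (u : ℕ) :
    (supp n (childRow β γ A v u ρ)).card ≤ k := by
  rw [supp_childRow hβ hγ, Finset.card_erase_of_mem hv]
  omega

theorem childRow_le {β γ : ℝ} (hβ1 : β ≤ 1) (hγ : 1 < γ) {ρ : ℕ → ℝ} {v w : ℕ} (u : ℕ)
    (h : 0 < ρ w) : childRow β γ A v u ρ w ≤ ρ w := by
  unfold childRow
  split_ifs
  · exact h.le
  · nlinarith
  · exact div_le_self h.le hγ.le
  · exact le_rfl
  · exact le_rfl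

theorem ratio_supp_eq_prod {β γ : ℝ} (hβ : 0 < β) (hγ : 0 < γ) (hA : ∀ u w, A u w → A w u)
    (hirr : ∀ u, ¬A u u) (n : ℕ) (ρ : ℕ → ℝ) (v : ℕ) :
    ratio β γ A (supp n ρ) ρ v = ρ v * ∏ u ∈ nbrs n A ρ v,
      msg β γ (ratio β γ A (supp n (childRow β γ A v u ρ)) (childRow β γ A v u ρ) u) := by
  rw [ratio_eq_prod hβ hγ hA (fun u hu => (mem_supp.1 hu).2), nbrs_eq_filter_erase hirr]
  simp only [supp_childRow hβ hγ]

theorem ratio_supp_pos {β γ : ℝ} (hβ : 0 < β) (hγ : 0 < γ) {n : ℕ} {ρ : ℕ → ℝ} {v : ℕ}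
    (hv : v ∈ supp n ρ) : 0 < ratio β γ A (supp n ρ) ρ v :=
  ratio_pos hβ hγ (fun _ hu => (mem_supp.1 hu).2) hv

/-- At a cut-off the ratio lies between `0` and the field because all messages are at most `1`;
monotonicity of `msg` carries the sandwich upwards. Each level deletes a vertex, so with `k` at
least the size of the support the level bound never cuts the recursion before the budget does. -/
theorem estimate_bounds {β γ : ℝ} (hβ : 0 < β) (hβ1 : β ≤ 1) (hβγ : 1 < β * γ) (hγ : 1 < γ)
    (hA : ∀ u w, A u w → A w u) (hirr : ∀ u, ¬A u u) {n : ℕ} (k : ℕ) :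
    ∀ (B : ℝ) (ρ : ℕ → ℝ) (v : ℕ), (supp n ρ).card ≤ k → v ∈ supp n ρ →
      0 ≤ estimate β γ n A 0 k B ρ v ∧
      estimate β γ n A 0 k B ρ v ≤ ratio β γ A (supp n ρ) ρ v ∧
      ratio β γ A (supp n ρ) ρ v ≤ estimate β γ n A 1 k B ρ v ∧
      estimate β γ n A 1 k B ρ v ≤ ρ v := by
  have hγ0 : 0 < γ := by linarith
  induction k with
  | zero =>
    intro B ρ v hk hv
    simp [Finset.card_eq_zero.1 (Nat.le_zero.1 hk)] at hv
  | succ k ih =>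
    intro B ρ v hk hv
    have hρ : 0 < ρ v := (mem_supp.1 hv).2
    have hc : ∀ u ∈ nbrs n A ρ v, _ := fun u hu =>
      ih (B / ((nbrs n A ρ v).card + 1)) _ u (card_supp_childRow (A := A) hβ hγ0 hv hk u)
        (mem_supp_childRow_of_mem_nbrs hβ hγ0 hirr hu)
    have hr : ∀ u ∈ nbrs n A ρ v, 0 ≤ ratio β γ A (supp n (childRow β γ A v u ρ))
        (childRow β γ A v u ρ) u := fun u hu =>
      (ratio_supp_pos hβ hγ0 (mem_supp_childRow_of_mem_nbrs hβ hγ0 hirr hu)).le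
    simp only [estimate]
    split_ifs with hB
    · refine ⟨by simp, by simpa using (ratio_supp_pos hβ hγ0 hv).le, ?_, by simp⟩
      rw [one_mul, ratio_supp_eq_prod hβ hγ0 hA hirr]
      exact mul_le_of_le_one_right hρ.le (Finset.prod_le_one
        (fun u hu => (msg_pos hβ hγ (hr u hu)).le) fun u hu => msg_le_one hβ1 hγ (hr u hu))
    · rw [ratio_supp_eq_prod hβ hγ0 hA hirr]
      refine ⟨?_, ?_, ?_, ?_⟩
      · exact mul_nonneg hρ.le (Finset.prod_nonneg fun u hu => (msg_pos hβ hγ (hc u hu).1).le)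
      · exact mul_le_mul_of_nonneg_left (Finset.prod_le_prod
          (fun u hu => (msg_pos hβ hγ (hc u hu).1).le)
          fun u hu => msg_le_msg hβγ hγ (hc u hu).1 (hc u hu).2.1) hρ.le
      · exact mul_le_mul_of_nonneg_left (Finset.prod_le_prod
          (fun u hu => (msg_pos hβ hγ (hr u hu)).le)
          fun u hu => msg_le_msg hβγ hγ (hr u hu) (hc u hu).2.2.1) hρ.le
      · have h1 : ∀ u ∈ nbrs n A ρ v, _ := fun u hu => (hr u hu).trans (hc u hu).2.2.1
        exact mul_le_of_le_one_right hρ.le (Finset.prod_le_one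
          (fun u hu => (msg_pos hβ hγ (h1 u hu)).le) fun u hu => msg_le_one hβ1 hγ (h1 u hu))

/-- The rate and the division of the budget fit together: `(d + 1) ^ (-κ) * (B / (d + 1)) ^ (-κ) = B
^ (-κ)`, so the bound passes unchanged from the children to the parent. -/
theorem exists_estimate_decay {β γ lam : ℝ} (hβ : 0 < β) (hβ1 : β ≤ 1) (hβγ : 1 < β * γ)
    (hγ : 1 < γ) (hlam : 0 < lam) (hlc : lam < criticalField β γ) :
    ∃ K κ : ℝ, 0 < K ∧ 0 < κ ∧ ∀ (A : ℕ → ℕ → Prop) [DecidableRel A] (n k : ℕ) (B : ℝ)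
      (ρ : ℕ → ℝ) (v : ℕ), (∀ u w, A u w → A w u) → (∀ u, ¬A u u) → 0 < B →
      (∀ w ∈ supp n ρ, ρ w ≤ lam) → (supp n ρ).card ≤ k → v ∈ supp n ρ →
      estimate β γ n A 1 k B ρ v - estimate β γ n A 0 k B ρ v ≤ K * B ^ (-κ) := by
  obtain ⟨Ψ, K, κ, hΨ, hK, hκ, hΨK, hstep⟩ := exists_potential hβ hβ1 hβγ hγ hlam hlc
  have hγ0 : 0 < γ := by linarith
  have hD : 0 < Ψ lam - Ψ 0 := sub_pos.2 (hΨ hlam)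
  refine ⟨K * (Ψ lam - Ψ 0), κ, mul_pos hK hD, hκ, ?_⟩
  intro A _ n k B ρ v hA hirr hB hρl hk hv
  have main : ∀ (k : ℕ) (B : ℝ) (ρ : ℕ → ℝ) (v : ℕ), 0 < B → (∀ w ∈ supp n ρ, ρ w ≤ lam) →
      (supp n ρ).card ≤ k → v ∈ supp n ρ →
      Ψ (estimate β γ n A 1 k B ρ v) - Ψ (estimate β γ n A 0 k B ρ v) ≤
        (Ψ lam - Ψ 0) * B ^ (-κ) := by
    intro k
    induction k with
    | zero =>
      intro B ρ v _ _ hk hv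
      simp [Finset.card_eq_zero.1 (Nat.le_zero.1 hk)] at hv
    | succ k ih =>
      intro B ρ v hB hρl hk hv
      have hρ : 0 < ρ v := (mem_supp.1 hv).2
      simp only [estimate]
      split_ifs with hB1
      · rw [one_mul, zero_mul]
        have h1 : Ψ (ρ v) ≤ Ψ lam := hΨ.monotone (hρl v hv)
        -- At a cut-off `B < 1`, so the bound is no smaller than the full range of the potential on
        -- `[0, lam]`.
        have h2 : 1 ≤ B ^ (-κ) := Real.one_le_rpow_of_pos_of_le_one_of_nonpos hB hB1.le
          (by linarith)
        nlinarith
      · set d := (nbrs n A ρ v).card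
        have hd : (0 : ℝ) < d + 1 := by positivity
        have hmem := fun u hu =>
          mem_supp_childRow_of_mem_nbrs (A := A) (ρ := ρ) (v := v) (n := n) (u := u) hβ hγ0 hirr hu
        have hcard := card_supp_childRow (A := A) hβ hγ0 hv hk
        have hchild : ∀ u, ∀ w ∈ supp n (childRow β γ A v u ρ), childRow β γ A v u ρ w ≤ lam := by
          intro u w hw
          rw [supp_childRow hβ hγ0] at hw
          have hw' := Finset.mem_of_mem_erase hw
          exact (childRow_le hβ1 hγ u (mem_supp.1 hw').2).trans (hρl w hw')
        have hb := fun u hu => estimate_bounds hβ hβ1 hβγ hγ hA hirr k (B / (d + 1))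
          (childRow β γ A v u ρ) u (hcard u) (hmem u hu)
        have := hstep (nbrs n A ρ v) (ρ v) ((Ψ lam - Ψ 0) * (B / (d + 1)) ^ (-κ))
          (fun u => estimate β γ n A 0 k (B / (d + 1)) (childRow β γ A v u ρ) u)
          (fun u => estimate β γ n A 1 k (B / (d + 1)) (childRow β γ A v u ρ) u)
          hρ (hρl v hv) (fun u hu => (hb u hu).1) (fun u hu => (hb u hu).2.1.trans (hb u hu).2.2.1)
          (fun u hu => (hb u hu).2.2.2.trans (hchild u u (hmem u hu)))
          (by positivity)
          (fun u hu => ih _ _ u (by positivity) (hchild u) (hcard u) (hmem u hu))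
        refine this.trans (le_of_eq ?_)
        rw [Real.div_rpow hB.le hd.le]
        have : ((d : ℝ) + 1) ^ (-κ) ≠ 0 := (Real.rpow_pos_of_pos hd _).ne'
        field_simp
        rfl
  have hb := estimate_bounds hβ hβ1 hβγ hγ hA hirr k B ρ v hk hv
  refine (hΨK _ _ (hb.2.1.trans hb.2.2.1)).trans ?_
  rw [mul_assoc]
  exact mul_le_mul_of_nonneg_left (main k B ρ v hB hρl hk hv) hK.le

/-! ## Elimination of the vertices one after another -/

/-- Delete `v`, giving it spin `1`. -/
noncomputable def nextRow (γ : ℝ) (A : ℕ → ℕ → Prop) [DecidableRel A] (v : ℕ) (ρ : ℕ → ℝ)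
    (w : ℕ) : ℝ :=
  if w = v then 0 else if A v w then ρ w / γ else ρ w

/-- The field after the deletion of the vertices below `j`. -/
noncomputable def rowAt (γ : ℝ) (A : ℕ → ℕ → Prop) [DecidableRel A] (π : ℕ → ℝ) : ℕ → ℕ → ℝ
  | 0 => π
  | j + 1 => nextRow γ A j (rowAt γ A π j)

/-- The estimate of the partition function. -/
noncomputable def estimateZ (β γ : ℝ) (n : ℕ) (A : ℕ → ℕ → Prop) [DecidableRel A] (c B : ℝ)
    (π : ℕ → ℝ) : ℕ → ℝ
  | 0 => 1
  | j + 1 => estimateZ β γ n A c B π j *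
      ((1 + estimate β γ n A c n B (rowAt γ A π j) j) * γ ^ (nbrs n A (rowAt γ A π j) j).card)

theorem nextRow_pos_iff {γ : ℝ} (hγ : 0 < γ) {ρ : ℕ → ℝ} {v w : ℕ} :
    0 < nextRow γ A v ρ w ↔ w ≠ v ∧ 0 < ρ w := by
  unfold nextRow
  split_ifs with h1 h2 <;> simp_all

theorem rowAt_pos_iff {γ : ℝ} (hγ : 0 < γ) {π : ℕ → ℝ} {n : ℕ} (hπ : ∀ w < n, 0 < π w)
    (j : ℕ) {w : ℕ} (hw : w < n) : 0 < rowAt γ A π j w ↔ j ≤ w := by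
  induction j with
  | zero => simp [rowAt, hπ w hw]
  | succ j ih => rw [rowAt, nextRow_pos_iff hγ, ih]; omega

theorem supp_rowAt {γ : ℝ} (hγ : 0 < γ) {π : ℕ → ℝ} {n : ℕ} (hπ : ∀ w < n, 0 < π w) (j : ℕ) :
    supp n (rowAt γ A π j) = Finset.Ico j n := by
  ext w
  rw [mem_supp, Finset.mem_Ico]
  constructor
  · rintro ⟨h1, h2⟩; exact ⟨(rowAt_pos_iff hγ hπ j h1).1 h2, h1⟩
  · rintro ⟨h1, h2⟩; exact ⟨h2, (rowAt_pos_iff hγ hπ j h2).2 h1⟩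

theorem rowAt_le {γ lam : ℝ} (hγ : 1 < γ) {π : ℕ → ℝ} {n : ℕ}
    (hl : ∀ w < n, π w ≤ lam) (j : ℕ) {w : ℕ} (hw : w ∈ supp n (rowAt γ A π j)) :
    rowAt γ A π j w ≤ lam := by
  have hγ0 : 0 < γ := by linarith
  induction j with
  | zero => exact hl w (mem_supp.1 hw).1
  | succ j ih =>
    have h1 := mem_supp.1 hw
    have h2 := (nextRow_pos_iff hγ0).1 h1.2
    refine le_trans ?_ (ih (mem_supp.2 ⟨h1.1, h2.2⟩))
    rw [rowAt, nextRow, if_neg h2.1]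
    split_ifs
    · exact div_le_self h2.2.le hγ.le
    · exact le_rfl

/-- The elimination of the vertices below `j` splits off a factor for each of them. -/
theorem setPartition_eq_mul_prod {β γ : ℝ} (hβ : 0 < β) (hγ : 0 < γ)
    (hA : ∀ u w, A u w → A w u) (hirr : ∀ u, ¬A u u) {π : ℕ → ℝ} {n : ℕ}
    (hπ : ∀ w < n, 0 < π w) (j : ℕ) (hj : j ≤ n) :
    setPartition β γ A (Finset.range n) π =
      setPartition β γ A (Finset.Ico j n) (rowAt γ A π j) *
      ∏ i ∈ Finset.range j, (1 + ratio β γ A (supp n (rowAt γ A π i)) (rowAt γ A π i) i) *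
        γ ^ (nbrs n A (rowAt γ A π i) i).card := by
  induction j with
  | zero => simp [rowAt]
  | succ j ih =>
    have hS := supp_rowAt (A := A) hγ hπ j
    have hjm : j ∈ supp n (rowAt γ A π j) := by rw [hS, Finset.mem_Ico]; omega
    have he : (Finset.Ico j n).erase j = Finset.Ico (j + 1) n := by
      ext w; simp only [Finset.mem_erase, Finset.mem_Ico]; omega
    have hn : setPartition β γ A (Finset.Ico (j + 1) n) (scaleNbrs A γ⁻¹ j (rowAt γ A π j)) =
        setPartition β γ A (Finset.Ico (j + 1) n) (rowAt γ A π (j + 1)) := by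
      refine setPartition_congr fun w hw => ?_
      have : w ≠ j := by have := (Finset.mem_Ico.1 hw).1; omega
      rw [rowAt, nextRow, if_neg this, scaleNbrs, div_eq_inv_mul]
    rw [ih (by omega), Finset.prod_range_succ, ← hS,
      setPartition_eq_mul_one_add_ratio (S := supp n (rowAt γ A π j)) hβ hγ hA
        (fun u hu => (mem_supp.1 hu).2) hjm,
      nbrs_eq_filter_erase hirr, hS, he, hn]
    ring

theorem setPartition_eq_prod {β γ : ℝ} (hβ : 0 < β) (hγ : 0 < γ)
    (hA : ∀ u w, A u w → A w u) (hirr : ∀ u, ¬A u u) {π : ℕ → ℝ} {n : ℕ}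
    (hπ : ∀ w < n, 0 < π w) :
    setPartition β γ A (Finset.range n) π =
      ∏ i ∈ Finset.range n, (1 + ratio β γ A (supp n (rowAt γ A π i)) (rowAt γ A π i) i) *
        γ ^ (nbrs n A (rowAt γ A π i) i).card := by
  rw [setPartition_eq_mul_prod hβ hγ hA hirr hπ n le_rfl]
  simp [setPartition, edgesIn]

theorem estimateZ_eq_prod (β γ : ℝ) (n : ℕ) (c B : ℝ) (π : ℕ → ℝ) (j : ℕ) :
    estimateZ β γ n A c B π j = ∏ i ∈ Finset.range j,
      (1 + estimate β γ n A c n B (rowAt γ A π i) i) * γ ^ (nbrs n A (rowAt γ A π i) i).card := by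
  induction j with
  | zero => simp [estimateZ]
  | succ j ih => rw [estimateZ, ih, Finset.prod_range_succ]

theorem estimateZ_bounds {β γ : ℝ} (hβ : 0 < β) (hβ1 : β ≤ 1) (hβγ : 1 < β * γ) (hγ : 1 < γ)
    (hA : ∀ u w, A u w → A w u) (hirr : ∀ u, ¬A u u) {n : ℕ} {π : ℕ → ℝ}
    (hπ : ∀ w < n, 0 < π w) (B : ℝ) :
    0 < estimateZ β γ n A 0 B π n ∧
    estimateZ β γ n A 0 B π n ≤ setPartition β γ A (Finset.range n) π ∧
    setPartition β γ A (Finset.range n) π ≤ estimateZ β γ n A 1 B π n := by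
  have hγ0 : 0 < γ := by linarith
  have hb : ∀ i ∈ Finset.range n, _ := fun i hi =>
    estimate_bounds (A := A) hβ hβ1 hβγ hγ hA hirr (n := n) n B (rowAt γ A π i) i
      (by rw [supp_rowAt hγ0 hπ, Nat.card_Ico]; omega)
      (by rw [supp_rowAt hγ0 hπ, Finset.mem_Ico]; have := Finset.mem_range.1 hi; omega)
  have hr : ∀ i ∈ Finset.range n, 0 ≤ ratio β γ A (supp n (rowAt γ A π i)) (rowAt γ A π i) i :=
    fun i hi => (hb i hi).1.trans (hb i hi).2.1
  rw [setPartition_eq_prod hβ hγ0 hA hirr hπ, estimateZ_eq_prod, estimateZ_eq_prod]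
  refine ⟨Finset.prod_pos fun i hi => ?_, Finset.prod_le_prod (fun i hi => ?_) fun i hi => ?_,
    Finset.prod_le_prod (fun i hi => ?_) fun i hi => ?_⟩
  · have := (hb i hi).1; positivity
  · have := (hb i hi).1; positivity
  · have := (hb i hi).2.1; gcongr
  · have := hr i hi; positivity
  · have := (hb i hi).2.2.1; gcongr

/-- The powers of `γ` are the same in both products, and each lower factor `1 + R` is at least `1`.
An additive gap `δ` therefore costs at most a factor `1 + δ ≤ exp δ` at each of the `n` vertices. -/
theorem estimateZ_le_exp_mul {β γ lam K κ : ℝ} (hβ : 0 < β) (hβ1 : β ≤ 1) (hβγ : 1 < β * γ)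
    (hγ : 1 < γ) (hA : ∀ u w, A u w → A w u) (hirr : ∀ u, ¬A u u) {n : ℕ} {π : ℕ → ℝ}
    (hπ : ∀ w < n, 0 < π w) (hl : ∀ w < n, π w ≤ lam) {B : ℝ}
    (hdec : ∀ (ρ : ℕ → ℝ) (v : ℕ), (∀ w ∈ supp n ρ, ρ w ≤ lam) → (supp n ρ).card ≤ n →
      v ∈ supp n ρ →
      estimate β γ n A 1 n B ρ v - estimate β γ n A 0 n B ρ v ≤ K * B ^ (-κ)) :
    estimateZ β γ n A 1 B π n ≤
      Real.exp (n * (K * B ^ (-κ))) * estimateZ β γ n A 0 B π n := by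
  have hγ0 : 0 < γ := by linarith
  have hcard : ∀ i ∈ Finset.range n, (supp n (rowAt γ A π i)).card ≤ n := fun i _ => by
    rw [supp_rowAt hγ0 hπ, Nat.card_Ico]; omega
  have hmem : ∀ i ∈ Finset.range n, i ∈ supp n (rowAt γ A π i) := fun i hi => by
    rw [supp_rowAt hγ0 hπ, Finset.mem_Ico]; have := Finset.mem_range.1 hi; omega
  have hb : ∀ i ∈ Finset.range n, _ := fun i hi =>
    estimate_bounds (A := A) hβ hβ1 hβγ hγ hA hirr (n := n) n B (rowAt γ A π i) i
      (hcard i hi) (hmem i hi)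
  rw [estimateZ_eq_prod, estimateZ_eq_prod, Real.exp_nat_mul]
  conv_rhs => rw [← Finset.card_range n, ← Finset.prod_const, Finset.card_range,
    ← Finset.prod_mul_distrib]
  refine Finset.prod_le_prod (fun i hi => ?_) fun i hi => ?_
  · have := ((hb i hi).1.trans (hb i hi).2.1).trans (hb i hi).2.2.1
    positivity
  · have h1 := hdec _ i (fun w hw => rowAt_le hγ hl i hw) (hcard i hi) (hmem i hi)
    have h0 := (hb i hi).1
    have h2 := ((hb i hi).2.1).trans (hb i hi).2.2.1
    rw [← mul_assoc]
    refine mul_le_mul_of_nonneg_right ?_ (by positivity)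
    have h3 := Real.add_one_le_exp (K * B ^ (-κ))
    nlinarith

end Estimate

end TwoSpin

namespace RealRAM

/-! ## Reasoning about programs -/

/-! ### Reading the memory back after one assignment. -/

section Reads

variable (s : Store) (a b k c j v : ℕ) (x : ℝ)

@[simp] theorem Store.setI_ireg : (s.setI a v).ireg b = if b = a then v else s.ireg b := by
  simp [Store.setI, Function.update_apply]
@[simp] theorem Store.setI_rreg : (s.setI a v).rreg = s.rreg := rfl
@[simp] theorem Store.setI_iarr : (s.setI a v).iarr = s.iarr := rfl
@[simp] theorem Store.setI_rarr : (s.setI a v).rarr = s.rarr := rfl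
@[simp] theorem Store.setR_rreg : (s.setR a x).rreg b = if b = a then x else s.rreg b := by
  simp [Store.setR, Function.update_apply]
@[simp] theorem Store.setR_ireg : (s.setR a x).ireg = s.ireg := rfl
@[simp] theorem Store.setR_iarr : (s.setR a x).iarr = s.iarr := rfl
@[simp] theorem Store.setR_rarr : (s.setR a x).rarr = s.rarr := rfl
@[simp] theorem Store.setIArr_iarr :
    (s.setIArr k j v).iarr a c = if a = k ∧ c = j then v else s.iarr a c := by
  by_cases h : a = k
  · subst h; simp [Store.setIArr, Function.update_apply]
  · simp [Store.setIArr, h]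
@[simp] theorem Store.setIArr_ireg : (s.setIArr k j v).ireg = s.ireg := rfl
@[simp] theorem Store.setIArr_rreg : (s.setIArr k j v).rreg = s.rreg := rfl
@[simp] theorem Store.setIArr_rarr : (s.setIArr k j v).rarr = s.rarr := rfl
@[simp] theorem Store.setRArr_rarr :
    (s.setRArr k j x).rarr a c = if a = k ∧ c = j then x else s.rarr a c := by
  by_cases h : a = k
  · subst h; simp [Store.setRArr, Function.update_apply]
  · simp [Store.setRArr, h]
@[simp] theorem Store.setRArr_ireg : (s.setRArr k j x).ireg = s.ireg := rfl
@[simp] theorem Store.setRArr_rreg : (s.setRArr k j x).rreg = s.rreg := rfl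
@[simp] theorem Store.setRArr_iarr : (s.setRArr k j x).iarr = s.iarr := rfl

end Reads

/-- Started on `s`, the program `P` halts within `c` steps in a memory that satisfies `Q`. -/
def Exec (P : Program) (s : Store) (c : ℕ) (Q : Store → Prop) : Prop :=
  ∃ m s', m ≤ c ∧ (∀ K, step^[m] (P :: K, s) = (K, s')) ∧ Q s'

theorem Exec.mono {P : Program} {s : Store} {c c' : ℕ} {Q Q' : Store → Prop}
    (h : Exec P s c Q) (hc : c ≤ c') (hQ : ∀ s', Q s' → Q' s') : Exec P s c' Q' := by
  obtain ⟨m, s', hm, hr, hq⟩ := h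
  exact ⟨m, s', hm.trans hc, hr, hQ _ hq⟩

theorem Exec.haltsIn {P : Program} {s : Store} {c : ℕ} {Q : Store → Prop} (h : Exec P s c Q) :
    ∃ m s', HaltsIn P s m s' ∧ m ≤ c ∧ Q s' := by
  obtain ⟨m, s', hm, hr, hq⟩ := h
  exact ⟨m, s', hr [], hm, hq⟩

theorem exec_op {o : Op} {s : Store} {Q : Store → Prop} (h : Q (o.exec s)) :
    Exec (.op o) s 1 Q :=
  ⟨1, _, le_rfl, fun _ => rfl, h⟩

/-- Since `Exec` quantifies over the programs still waiting, `p` may be run with `q` on top of that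
list. The additional step unpacks the `seq`. -/
theorem exec_seq {p q : Program} {s : Store} {c₁ c₂ : ℕ} {Q : Store → Prop}
    (h : Exec p s c₁ fun s' => Exec q s' c₂ Q) : Exec (.seq p q) s (c₁ + c₂ + 1) Q := by
  obtain ⟨m₁, s₁, hm₁, hr₁, m₂, s₂, hm₂, hr₂, hq⟩ := h
  refine ⟨m₂ + (m₁ + 1), s₂, by omega, fun K => ?_, hq⟩
  rw [Function.iterate_add_apply, Function.iterate_succ_apply]
  exact (congrArg _ (hr₁ (q :: K))).trans (hr₂ K)

theorem exec_ite {t : Test} {p q : Program} {s : Store} {c : ℕ} {Q : Store → Prop}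
    (h₁ : t.Holds s → Exec p s c Q) (h₂ : ¬t.Holds s → Exec q s c Q) :
    Exec (.ite t p q) s (c + 1) Q := by
  by_cases ht : t.Holds s
  · obtain ⟨m, s', hm, hr, hq⟩ := h₁ ht
    refine ⟨m + 1, s', by omega, fun K => ?_, hq⟩
    rw [Function.iterate_succ_apply]
    simpa [step, ht] using hr K
  · obtain ⟨m, s', hm, hr, hq⟩ := h₂ ht
    refine ⟨m + 1, s', by omega, fun K => ?_, hq⟩
    rw [Function.iterate_succ_apply]
    simpa [step, ht] using hr K

theorem exec_loop_exit {t : Test} {p : Program} {s : Store} {Q : Store → Prop}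
    (ht : ¬t.Holds s) (h : Q s) : Exec (.loop t p) s 1 Q :=
  ⟨1, s, le_rfl, fun K => by rw [Function.iterate_one]; simp [step, ht], h⟩

theorem exec_loop_step {t : Test} {p : Program} {s : Store} {c₁ c₂ : ℕ} {Q : Store → Prop}
    (ht : t.Holds s) (h : Exec p s c₁ fun s' => Exec (.loop t p) s' c₂ Q) :
    Exec (.loop t p) s (c₁ + c₂ + 1) Q := by
  obtain ⟨m₁, s₁, hm₁, hr₁, m₂, s₂, hm₂, hr₂, hq⟩ := h
  refine ⟨m₂ + (m₁ + 1), s₂, by omega, fun K => ?_, hq⟩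
  rw [Function.iterate_add_apply, Function.iterate_succ_apply]
  have : step (.loop t p :: K, s) = (p :: .loop t p :: K, s) := by simp [step, ht]
  rw [this]
  exact (congrArg _ (hr₁ _)).trans (hr₂ K)

/-- A loop that is left after `N` rounds at the latest. -/
theorem exec_loop {t : Test} {p : Program} (N : ℕ) (c : ℕ → ℕ) (I : ℕ → Store → Prop)
    (hstep : ∀ i s, i < N → I i s → t.Holds s → Exec p s (c i) (I (i + 1)))
    (hexit : ∀ s, I N s → ¬t.Holds s) {s : Store} (h : I 0 s) :
    Exec (.loop t p) s (∑ i ∈ Finset.range N, (c i + 1) + 1)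
      fun s' => (∃ i, i ≤ N ∧ I i s') ∧ ¬t.Holds s' := by
  -- Induction on the number `d` of rounds that may still follow.
  have main : ∀ d i s, i + d = N → I i s → Exec (.loop t p) s
      (∑ j ∈ Finset.range d, (c (i + j) + 1) + 1) fun s' => (∃ i, i ≤ N ∧ I i s') ∧ ¬t.Holds s' := by
    intro d
    induction d with
    | zero =>
      intro i s hi hI
      obtain rfl : i = N := hi
      exact (exec_loop_exit (hexit s hI) ⟨⟨i, le_rfl, hI⟩, hexit s hI⟩).mono (by simp) fun _ => id
    | succ d ih =>
      intro i s hi hI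
      by_cases ht : t.Holds s
      · refine (exec_loop_step ht ((hstep i s (by omega) hI ht).mono le_rfl fun s' hs' =>
          ih (i + 1) s' (by omega) hs')).mono ?_ fun _ => id
        rw [Finset.sum_range_succ', add_zero]
        have : ∑ j ∈ Finset.range d, (c (i + (j + 1)) + 1) =
            ∑ j ∈ Finset.range d, (c (i + 1 + j) + 1) :=
          Finset.sum_congr rfl fun j _ => by rw [add_right_comm, add_assoc]
        omega
      · exact (exec_loop_exit ht ⟨⟨i, by omega, hI⟩, ht⟩).mono (by omega) fun _ => id
  simpa using main N 0 s (by simp) h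

/-- A loop whose counter runs from `0` to `N`. -/
theorem exec_for {a b : ℕ} {p : Program} (N c : ℕ) (I : ℕ → Store → Prop)
    (ha : ∀ i s, I i s → s.ireg a = i) (hb : ∀ i s, I i s → s.ireg b = N)
    (hstep : ∀ i s, i < N → I i s → Exec p s c (I (i + 1))) {s : Store} (h : I 0 s) :
    Exec (.loop (.ilt a b) p) s (N * (c + 1) + 1) (I N) := by
  refine (exec_loop N (fun _ => c) I (fun i s hi hI _ => hstep i s hi hI)
    (fun s hI => ?_) h).mono (by simp) ?_
  · simp [Test.Holds, ha _ _ hI, hb _ _ hI]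
  · rintro s' ⟨⟨i, hi, hI⟩, ht⟩
    have : i = N := by
      simp only [Test.Holds, ha _ _ hI, hb _ _ hI] at ht
      omega
    exact this ▸ hI

/-- A loop that simulates the iteration of a function `f` until `done` is reached. -/
theorem exec_loop_simulation {α : Type*} {t : Test} {p : Program} {c : ℕ} (f : α → α)
    (done : α → Prop) (Rep : α → Store → Prop) (hf : ∀ x, done x → f x = x)
    (ht : ∀ x s, Rep x s → (t.Holds s ↔ ¬done x))
    (hstep : ∀ x s, Rep x s → ¬done x → Exec p s c (Rep (f x))) (m : ℕ) :
    ∀ {x : α} {s : Store}, Rep x s → done (f^[m] x) →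
      Exec (.loop t p) s (m * (c + 1) + 1) (Rep (f^[m] x)) := by
  induction m with
  | zero =>
    intro x s hx hd
    exact (exec_loop_exit (by rw [ht x s hx]; exact not_not.2 hd) hx).mono (by simp) fun _ => id
  | succ m ih =>
    intro x s hx hd
    by_cases hdx : done x
    · have hfix : f^[m + 1] x = x := Function.iterate_fixed (hf x hdx) _
      rw [hfix]
      exact (exec_loop_exit (by rw [ht x s hx]; exact not_not.2 hdx) hx).mono (by omega) fun _ => id
    · rw [Function.iterate_succ_apply] at hd ⊢
      refine (exec_loop_step ((ht x s hx).2 hdx) ((hstep x s hx hdx).mono le_rfl fun s' hs' =>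
        ih hs' hd)).mono ?_ fun _ => id
      rw [Nat.add_mul]; omega

/-- A sequence of elementary operations. -/
def block : List Op → Program
  | [] => .op (.icopy 1 1)
  | [o] => .op o
  | o :: o' :: os => .seq (.op o) (block (o' :: os))

theorem exec_block (os : List Op) {s : Store} {Q : Store → Prop}
    (h : Q (os.foldl (fun s o => o.exec s) s)) : Exec (block os) s (2 * os.length + 1) Q := by
  induction os generalizing s with
  | nil =>
    refine exec_op (o := .icopy 1 1) ?_
    have : Op.exec (.icopy 1 1) s = s := by simp [Op.exec, Store.setI]
    rw [this]; exact h
  | cons o os ih =>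
    cases os with
    | nil => exact (exec_op (o := o) h).mono (by simp) fun _ => id
    | cons o' os =>
      refine (exec_seq (exec_op (o := o) (ih h))).mono ?_ fun _ => id
      simp; omega

/-- `s'` differs from `s` only in the registers listed in `I` and `R` and in the arrays listed in
`IA` and `RA`. -/
structure Agree (I R IA RA : List ℕ) (s s' : Store) : Prop where
  ireg : ∀ a, a ∉ I → s'.ireg a = s.ireg a
  rreg : ∀ a, a ∉ R → s'.rreg a = s.rreg a
  iarr : ∀ k, k ∉ IA → s'.iarr k = s.iarr k
  rarr : ∀ k, k ∉ RA → s'.rarr k = s.rarr k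

theorem Agree.refl (I R IA RA : List ℕ) (s : Store) : Agree I R IA RA s s :=
  ⟨fun _ _ => rfl, fun _ _ => rfl, fun _ _ => rfl, fun _ _ => rfl⟩

theorem Agree.trans {I R IA RA I' R' IA' RA' : List ℕ} {s s' s'' : Store}
    (h : Agree I R IA RA s s') (h' : Agree I' R' IA' RA' s' s'') :
    Agree (I ++ I') (R ++ R') (IA ++ IA') (RA ++ RA') s s'' where
  ireg a ha := by
    rw [List.mem_append, not_or] at ha; rw [h'.ireg a ha.2, h.ireg a ha.1]
  rreg a ha := by
    rw [List.mem_append, not_or] at ha; rw [h'.rreg a ha.2, h.rreg a ha.1]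
  iarr a ha := by
    rw [List.mem_append, not_or] at ha; rw [h'.iarr a ha.2, h.iarr a ha.1]
  rarr a ha := by
    rw [List.mem_append, not_or] at ha; rw [h'.rarr a ha.2, h.rarr a ha.1]

theorem Agree.mono {I R IA RA I' R' IA' RA' : List ℕ} {s s' : Store}
    (h : Agree I R IA RA s s') (hI : I ⊆ I') (hR : R ⊆ R') (hIA : IA ⊆ IA') (hRA : RA ⊆ RA') :
    Agree I' R' IA' RA' s s' :=
  ⟨fun a ha => h.ireg a fun h' => ha (hI h'), fun a ha => h.rreg a fun h' => ha (hR h'),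
    fun a ha => h.iarr a fun h' => ha (hIA h'), fun a ha => h.rarr a fun h' => ha (hRA h')⟩

theorem Agree.setI {I R IA RA : List ℕ} {s s' : Store} {a v : ℕ} (ha : a ∈ I)
    (h : Agree I R IA RA s s') : Agree I R IA RA s (s'.setI a v) where
  ireg b hb := by
    have : b ≠ a := fun e => hb (e ▸ ha)
    simp [this, h.ireg b hb]
  rreg := h.rreg
  iarr := h.iarr
  rarr := h.rarr

theorem Agree.setR {I R IA RA : List ℕ} {s s' : Store} {a : ℕ} {x : ℝ} (ha : a ∈ R)
    (h : Agree I R IA RA s s') : Agree I R IA RA s (s'.setR a x) where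
  ireg := h.ireg
  rreg b hb := by
    have : b ≠ a := fun e => hb (e ▸ ha)
    simp [this, h.rreg b hb]
  iarr := h.iarr
  rarr := h.rarr

theorem Agree.setIArr {I R IA RA : List ℕ} {s s' : Store} {k j v : ℕ} (hk : k ∈ IA)
    (h : Agree I R IA RA s s') : Agree I R IA RA s (s'.setIArr k j v) where
  ireg := h.ireg
  rreg := h.rreg
  iarr b hb := by
    have : b ≠ k := fun e => hb (e ▸ hk)
    funext c
    simp [this, h.iarr b hb]
  rarr := h.rarr

theorem Agree.setRArr {I R IA RA : List ℕ} {s s' : Store} {k j : ℕ} {x : ℝ} (hk : k ∈ RA)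
    (h : Agree I R IA RA s s') : Agree I R IA RA s (s'.setRArr k j x) where
  ireg := h.ireg
  rreg := h.rreg
  iarr := h.iarr
  rarr b hb := by
    have : b ≠ k := fun e => hb (e ▸ hk)
    funext c
    simp [this, h.rarr b hb]

end RealRAM

namespace TwoSpin

open RealRAM

/-! ## The program

Natural-number registers: `0` holds `n`, `1` and `2` the constants `0` and `1`, `3` the vertex that
is being eliminated, `16` the height of the stack, `17` and `18` the positions of the rows of the
top frame and of its child, `19` and `21` a vertex and its neighbour, `20` and `22` their products
with `n`; `23` to `26` are auxiliary. Real registers: `0`, `1`, `2` hold `β`, `γ`, `ε`, `3` and `4`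
the constants `0` and `1`, `5` the budget, `6` and `7` the lower and the upper estimate, `8` and `9`
the two sides of the stopping test, `19` and `20` the values returned by a call; `16` to `18`, `21`
and `22` are auxiliary. Natural-number arrays: `0` is the adjacency matrix, `1` the table of the
multiples of `n`, `2` and `3` contain the vertex of each frame and its next neighbour. Real arrays:
`0` is the field, `1` the rows of all frames, `2` the budget for the children of each frame, `3` and
`4` the lower and the upper product accumulated so far. -/

/-- The program that does nothing. -/
def skip : Program := block []

/-- Round of `copyChild`. -/
def copyChildStep : Program :=
  .seq (block [.iadd 24 17 23, .rload 16 1 24])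
    (.seq
      (.ite (.ieq 23 19) (block [.rconst 16 0])
        (.seq (block [.iadd 24 20 23, .iload 25 0 24])
          (.ite (.ine 25 1)
            (.ite (.ilt 23 21) (block [.rmul 16 0 16])
              (.ite (.ilt 21 23) (block [.rdiv 16 16 1]) skip))
            skip)))
      (block [.iadd 24 18 23, .rstore 1 24 16, .iadd 23 23 2]))

/-- Write the row of a child. -/
def copyChild : Program :=
  .seq (block [.iconst 23 0]) (.loop (.ilt 23 0) copyChildStep)

/-- Round of `countNbrs`. -/
def countNbrsStep : Program :=
  .seq (block [.iadd 24 22 23, .iload 25 0 24])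
    (.seq
      (.ite (.ine 25 1)
        (.seq (block [.iadd 24 18 23, .rload 16 1 24])
          (.ite (.rlt 3 16) (block [.radd 17 17 4]) skip))
        skip)
      (block [.iadd 23 23 2]))

/-- Compute one plus the number of neighbours. -/
def countNbrs : Program :=
  .seq (block [.iconst 23 0, .rconst 17 1]) (.loop (.ilt 23 0) countNbrsStep)

/-- Initialize the frame on top of the stack. -/
def initFrame : Program :=
  .seq countNbrs
    (.seq (block [.istore 2 16 21, .rdiv 17 18 17, .rstore 2 16 17, .iadd 24 18 21, .rload 16 1 24,
        .rstore 4 16 16])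
      (.ite (.rlt 18 4) (block [.istore 3 16 0, .rstore 3 16 3])
        (block [.istore 3 16 1, .rstore 3 16 16])))

/-- Push the frame of a neighbour. -/
def pushFrame : Program :=
  .seq (block [.iload 22 1 21, .rload 18 2 16, .iadd 18 17 0])
    (.seq copyChild (.seq (block [.iadd 16 16 2, .icopy 17 18]) initFrame))

/-- Pop the top frame and multiply the products of the frame below by its messages. -/
def popFrame : Program :=
  block [.rload 19 3 16, .rload 20 4 16, .isub 16 16 2, .isub 17 17 0,
    .rmul 21 0 19, .radd 21 21 4, .radd 22 19 1, .rdiv 21 21 22, .rload 22 3 16, .rmul 22 22 21,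
    .rstore 3 16 22,
    .rmul 21 0 20, .radd 21 21 4, .radd 22 20 1, .rdiv 21 21 22, .rload 22 4 16, .rmul 22 22 21,
    .rstore 4 16 22]

/-- Round of the depth-first search. -/
def searchStep : Program :=
  .seq (block [.iload 19 2 16, .iload 20 1 19, .iload 21 3 16])
    (.ite (.ilt 21 0)
      (.seq (block [.iadd 26 21 2, .istore 3 16 26, .iadd 24 20 21, .iload 25 0 24, .iadd 24 17 21,
          .rload 16 1 24])
        (.ite (.ine 25 1) (.ite (.rlt 3 16) pushFrame skip) skip))
      popFrame)

/-- The memory holds the constants of the program and the graph. -/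
structure Ready (β γ : ℝ) (n : ℕ) (A : ℕ → ℕ → Prop) [DecidableRel A] (s : Store) : Prop where
  i0 : s.ireg 0 = n
  i1 : s.ireg 1 = 0
  i2 : s.ireg 2 = 1
  r0 : s.rreg 0 = β
  r1 : s.rreg 1 = γ
  r3 : s.rreg 3 = 0
  r4 : s.rreg 4 = 1
  adj : ∀ u < n, ∀ w < n, s.iarr 0 (u * n + w) = if A u w then 1 else 0
  table : ∀ u < n, s.iarr 1 u = u * n

/-! ### Copying the row of a child and counting neighbours. -/

section Specs

variable {A : ℕ → ℕ → Prop} [DecidableRel A] {β γ : ℝ} {n : ℕ}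

/-- A frame rule: code that does not write to the constants, the graph or the table preserves them.
For concrete write lists the side conditions are decidable. -/
theorem Ready.agree {I R IA RA : List ℕ} {s s' : Store} (h : Ready β γ n A s)
    (hs : Agree I R IA RA s s') (hI : ∀ a ∈ [0, 1, 2], a ∉ I) (hR : ∀ a ∈ [0, 1, 3, 4], a ∉ R)
    (hIA : ∀ k ∈ [0, 1], k ∉ IA) : Ready β γ n A s' where
  i0 := (hs.ireg 0 (hI _ (by simp))).trans h.i0
  i1 := (hs.ireg 1 (hI _ (by simp))).trans h.i1
  i2 := (hs.ireg 2 (hI _ (by simp))).trans h.i2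
  r0 := (hs.rreg 0 (hR _ (by simp))).trans h.r0
  r1 := (hs.rreg 1 (hR _ (by simp))).trans h.r1
  r3 := (hs.rreg 3 (hR _ (by simp))).trans h.r3
  r4 := (hs.rreg 4 (hR _ (by simp))).trans h.r4
  adj u hu w hw := by rw [hs.iarr 0 (hIA _ (by simp))]; exact h.adj u hu w hw
  table u hu := by rw [hs.iarr 1 (hIA _ (by simp))]; exact h.table u hu

theorem exec_skip {s : Store} {Q : Store → Prop} (h : Q s) : Exec skip s 1 Q :=
  exec_block [] h

theorem exec_copyChild {s : Store} (hs : Ready β γ n A s) {rb v u : ℕ} {ρ : ℕ → ℝ}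
    (h17 : s.ireg 17 = rb) (h18 : s.ireg 18 = rb + n) (h19 : s.ireg 19 = v)
    (h20 : s.ireg 20 = v * n) (h21 : s.ireg 21 = u) (hv : v < n)
    (hρ : ∀ w < n, s.rarr 1 (rb + w) = ρ w) :
    Exec copyChild s (30 * (n + 1)) fun s' => Agree [23, 24, 25] [16] [] [1] s s' ∧
      (∀ c < rb + n, s'.rarr 1 c = s.rarr 1 c) ∧
      ∀ w < n, s'.rarr 1 (rb + n + w) = childRow β γ A v u ρ w := by
  -- The child's row starts right after the parent's, so the parent's row stays intact while it is
  -- being read.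
  let I : ℕ → Store → Prop := fun i s' => s'.ireg 23 = i ∧ Agree [23, 24, 25] [16] [] [1] s s' ∧
      (∀ c < rb + n, s'.rarr 1 c = s.rarr 1 c) ∧
      ∀ w < i, s'.rarr 1 (rb + n + w) = childRow β γ A v u ρ w
  have hstep : ∀ i s', i < n → I i s' → Exec copyChildStep s' 27 (I (i + 1)) := by
    rintro i s₁ hi ⟨h23, hA, hlow, hrow⟩
    have hR := hs.agree hA (by decide) (by decide) (by decide)
    have e17 := (hA.ireg 17 (by decide)).trans h17
    have e18 := (hA.ireg 18 (by decide)).trans h18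
    have e19 := (hA.ireg 19 (by decide)).trans h19
    have e20 := (hA.ireg 20 (by decide)).trans h20
    have e21 := (hA.ireg 21 (by decide)).trans h21
    have hρi : s₁.rarr 1 (rb + i) = ρ i := (hlow _ (by omega)).trans (hρ i hi)
    have hadj := hR.adj v hv i hi
    have hmid : Exec (.ite (.ieq 23 19) (block [.rconst 16 0])
        (.seq (block [.iadd 24 20 23, .iload 25 0 24])
          (.ite (.ine 25 1)
            (.ite (.ilt 23 21) (block [.rmul 16 0 16])
              (.ite (.ilt 21 23) (block [.rdiv 16 16 1]) skip))
            skip))) ((s₁.setI 24 (rb + i)).setR 16 (ρ i)) 13 fun s₂ =>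
          s₂.ireg 23 = i ∧ Agree [23, 24, 25] [16] [] [1] s s₂ ∧ s₂.rarr = s₁.rarr ∧
          s₂.rreg 16 = childRow β γ A v u ρ i := by
      refine (exec_ite (c := 12) (fun ht => ?_) fun ht => ?_).mono (by omega) fun _ => id
      · simp only [Test.Holds, Store.setR_ireg, Store.setI_ireg, h23, e19] at ht
        refine (exec_block _ ⟨?_, ?_, ?_, ?_⟩).mono (by simp) fun _ => id
        · simp [Op.exec, h23]
        · exact .setR (by decide) (.setR (by decide) (.setI (by decide) hA))
        · simp [Op.exec]
        · simp at ht
          simp [Op.exec, childRow, ht]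
      · simp [Test.Holds, h23, e19] at ht
        refine (exec_seq (c₂ := 6) (exec_block _ (exec_ite (c := 5) (fun ht2 => ?_) fun ht2 => ?_))).mono
          (by simp) fun _ => id
        · simp [Op.exec, Test.Holds, h23, e20, hadj, hR.i1] at ht2
          refine (exec_ite (c := 4) (fun ht3 => ?_) fun ht3 => ?_).mono (by omega) fun _ => id
          · simp [Op.exec, Test.Holds, h23, e21] at ht3
            refine (exec_block _ ⟨?_, ?_, ?_, ?_⟩).mono (by simp) fun _ => id
            · simp [Op.exec, h23]
            · exact .setR (by decide) (.setI (by decide) (.setI (by decide)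
                (.setR (by decide) (.setI (by decide) hA))))
            · simp [Op.exec]
            · simp [Op.exec, childRow, ht, ht2, ht3, hR.r0]
          · simp [Op.exec, Test.Holds, h23, e21] at ht3
            refine (exec_ite (c := 3) (fun ht4 => ?_) fun ht4 => ?_).mono (by omega) fun _ => id
            · simp [Op.exec, Test.Holds, h23, e21] at ht4
              refine (exec_block _ ⟨?_, ?_, ?_, ?_⟩).mono (by simp) fun _ => id
              · simp [Op.exec, h23]
              · exact .setR (by decide) (.setI (by decide) (.setI (by decide)
                  (.setR (by decide) (.setI (by decide) hA))))
              · simp [Op.exec]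
              · simp [Op.exec, childRow, ht, ht2, ht4, hR.r1, ht3.not_gt]
            · simp [Op.exec, Test.Holds, h23, e21] at ht4
              refine (exec_skip ⟨?_, ?_, ?_, ?_⟩).mono (by omega) fun _ => id
              · simp [Op.exec, h23]
              · exact .setI (by decide) (.setI (by decide)
                  (.setR (by decide) (.setI (by decide) hA)))
              · simp [Op.exec]
              · simp [Op.exec, childRow, ht, ht2, ht3.not_gt, ht4.not_gt]
        · simp [Op.exec, Test.Holds, h23, e20, hadj, hR.i1] at ht2
          refine (exec_skip ⟨?_, ?_, ?_, ?_⟩).mono (by omega) fun _ => id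
          · simp [Op.exec, h23]
          · exact .setI (by decide) (.setI (by decide)
              (.setR (by decide) (.setI (by decide) hA)))
          · simp [Op.exec]
          · simp [Op.exec, childRow, ht, ht2]
    refine (exec_seq (exec_block _ ?_)).mono (c := 5 + 21 + 1) (by omega) fun _ => id
    have hpre : List.foldl (fun s o => Op.exec o s) s₁ [.iadd 24 17 23, .rload 16 1 24] =
        (s₁.setI 24 (rb + i)).setR 16 (ρ i) := by
      simp [Op.exec, e17, h23, hρi]
    rw [hpre]
    refine (exec_seq (hmid.mono le_rfl fun s₂ h₂ => exec_block _ ?_)).mono (by simp) fun _ => id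
    obtain ⟨k23, kA, krarr, k16⟩ := h₂
    have k18 := (kA.ireg 18 (by decide)).trans h18
    have k2 := (hs.agree kA (by decide) (by decide) (by decide)).i2
    refine ⟨?_, ?_, ?_, ?_⟩
    · simp [Op.exec, k23, k2]
    · exact .setI (by decide) (.setRArr (by decide) (.setI (by decide) kA))
    · intro c hc
      have : c ≠ rb + n + i := by omega
      simp [Op.exec, k18, k23, krarr, this, hlow c hc]
    · intro w hw
      rcases Nat.lt_succ_iff_lt_or_eq.1 hw with h | rfl
      · simp [Op.exec, k18, k23, krarr, h.ne, hrow w h]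
      · simp [Op.exec, k18, k23, k16]
  refine (exec_seq (exec_block _ ((exec_for n 27 I (fun i s' h => h.1)
    (fun i s' h => (h.2.1.ireg 0 (by decide)).trans hs.i0) hstep ?_)))).mono ?_ ?_
  · refine ⟨by simp [Op.exec], .setI (by decide) (.refl _ _ _ _ _), fun c _ => by simp [Op.exec],
      fun w hw => absurd hw (by omega)⟩
  · simp; omega
  · rintro s' ⟨_, h⟩
    exact h

/-- The bound on the vertices serves as the loop counter: `nbrs i` is the set of neighbours met in
the first `i` rounds. -/
theorem card_nbrs_succ (i : ℕ) (ρ : ℕ → ℝ) (u : ℕ) :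
    (nbrs (i + 1) A ρ u).card = (nbrs i A ρ u).card + if A u i ∧ 0 < ρ i then 1 else 0 := by
  simp only [nbrs, Finset.card_filter, Finset.sum_range_succ]

theorem exec_countNbrs {s : Store} (hs : Ready β γ n A s) {rb u : ℕ} {ρ : ℕ → ℝ}
    (h18 : s.ireg 18 = rb) (h22 : s.ireg 22 = u * n) (hu : u < n)
    (hρ : ∀ w < n, s.rarr 1 (rb + w) = ρ w) :
    Exec countNbrs s (30 * (n + 1)) fun s' => Agree [23, 24, 25] [16, 17] [] [] s s' ∧
      s'.rreg 17 = (nbrs n A ρ u).card + 1 := by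
  let I : ℕ → Store → Prop := fun i s' => s'.ireg 23 = i ∧ Agree [23, 24, 25] [16, 17] [] [] s s' ∧
      s'.rreg 17 = (nbrs i A ρ u).card + 1
  have hstep : ∀ i s', i < n → I i s' → Exec countNbrsStep s' 24 (I (i + 1)) := by
    rintro i s₁ hi ⟨h23, hA, h17⟩
    have hR := hs.agree hA (by decide) (by decide) (by decide)
    have e18 := (hA.ireg 18 (by decide)).trans h18
    have e22 := (hA.ireg 22 (by decide)).trans h22
    have hρi : s₁.rarr 1 (rb + i) = ρ i := by rw [hA.rarr 1 (by decide)]; exact hρ i hi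
    have hadj := hR.adj u hu i hi
    have hmid : ∀ s₂ : Store, s₂.ireg 23 = i → Agree [23, 24, 25] [16, 17] [] [] s s₂ →
        s₂.rreg 17 = (nbrs (i + 1) A ρ u).card + 1 → Exec (block [.iadd 23 23 2]) s₂ 3 (I (i + 1)) := by
      intro s₂ k23 kA k17
      have k2 := (hs.agree kA (by decide) (by decide) (by decide)).i2
      refine exec_block _ ⟨?_, ?_, ?_⟩
      · simp [Op.exec, k23, k2]
      · exact .setI (by decide) kA
      · simp [Op.exec, k17]
    refine (exec_seq (c₂ := 18) (exec_block _ (exec_seq (c₁ := 14) (c₂ := 3) ?_))).mono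
      (by simp) fun _ => id
    refine (exec_ite (c := 10) (fun ht => ?_) fun ht => ?_).mono (by omega) fun _ => id
    · simp [Op.exec, Test.Holds, h23, e22, hadj, hR.i1] at ht
      refine (exec_seq (c₂ := 4) (exec_block _ (exec_ite (c := 3) (fun ht2 => ?_) fun ht2 => ?_))).mono
        (by simp) fun _ => id
      · simp [Op.exec, Test.Holds, h23, hR.r3, e18, hρi] at ht2
        refine exec_block _ (hmid _ ?_ ?_ ?_)
        · simp [Op.exec, h23]
        · exact .setR (by decide) (.setR (by decide) (.setI (by decide) (.setI (by decide)
            (.setI (by decide) hA))))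
        · simp [Op.exec, h17, hR.r4, card_nbrs_succ, ht, ht2]
      · simp [Op.exec, Test.Holds, h23, hR.r3, e18, hρi] at ht2
        refine (exec_skip (hmid _ ?_ ?_ ?_)).mono (by omega) fun _ => id
        · simp [Op.exec, h23]
        · exact .setR (by decide) (.setI (by decide) (.setI (by decide) (.setI (by decide) hA)))
        · simp [Op.exec, h17, card_nbrs_succ, ht2.not_gt]
    · simp [Op.exec, Test.Holds, h23, e22, hadj, hR.i1] at ht
      refine (exec_skip (hmid _ ?_ ?_ ?_)).mono (by omega) fun _ => id
      · simp [Op.exec, h23]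
      · exact .setI (by decide) (.setI (by decide) hA)
      · simp [Op.exec, h17, card_nbrs_succ, ht]
  refine (exec_seq (exec_block _ ((exec_for n 24 I (fun i s' h => h.1)
    (fun i s' h => (h.2.1.ireg 0 (by decide)).trans hs.i0) hstep ?_)))).mono ?_ ?_
  · refine ⟨by simp [Op.exec], .setR (by decide) (.setI (by decide) (.refl _ _ _ _ _)), ?_⟩
    simp [Op.exec, nbrs]
  · simp; omega
  · rintro s' ⟨_, h⟩
    exact h

end Specs

/-! ## The stack -/

/-- A frame of the depth-first search. -/
structure Frame where
  /-- the field -/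
  row : ℕ → ℝ
  /-- the vertex whose ratio is estimated -/
  vtx : ℕ
  /-- the next vertex to be considered as a neighbour -/
  next : ℕ
  /-- the budget for the children -/
  budget : ℝ
  /-- the product for the lower estimate -/
  lo : ℝ
  /-- the product for the upper estimate -/
  hi : ℝ

/-- The initial frame of a call. -/
noncomputable def newFrame (n : ℕ) (A : ℕ → ℕ → Prop) [DecidableRel A] (B : ℝ) (ρ : ℕ → ℝ)
    (u : ℕ) : Frame where
  row := ρ
  vtx := u
  next := if B < 1 then n else 0
  budget := B / ((nbrs n A ρ u).card + 1)
  lo := if B < 1 then 0 else ρ u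
  hi := ρ u

/-- The frame that rests on `k` other frames is in memory. -/
structure FrameAt (n k : ℕ) (f : Frame) (s : Store) : Prop where
  vtx_lt : f.vtx < n
  vtx : s.iarr 2 (k + 1) = f.vtx
  next : s.iarr 3 (k + 1) = f.next
  budget : s.rarr 2 (k + 1) = f.budget
  lo : s.rarr 3 (k + 1) = f.lo
  hi : s.rarr 4 (k + 1) = f.hi
  row : ∀ w < n, s.rarr 1 (k * n + w) = f.row w

/-- A stack, with the top frame first, is in memory. -/
def StackAt (n : ℕ) : List Frame → Store → Prop
  | [], _ => True
  | f :: fs, s => FrameAt n fs.length f s ∧ StackAt n fs s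

/-- The two memories agree on the first `k` frames. -/
structure SameBelow (n k : ℕ) (s s' : Store) : Prop where
  vtx : ∀ c ≤ k, s'.iarr 2 c = s.iarr 2 c
  next : ∀ c ≤ k, s'.iarr 3 c = s.iarr 3 c
  budget : ∀ c ≤ k, s'.rarr 2 c = s.rarr 2 c
  lo : ∀ c ≤ k, s'.rarr 3 c = s.rarr 3 c
  hi : ∀ c ≤ k, s'.rarr 4 c = s.rarr 4 c
  row : ∀ c < k * n, s'.rarr 1 c = s.rarr 1 c

theorem SameBelow.trans {n k : ℕ} {s s' s'' : Store} (h : SameBelow n k s s')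
    (h' : SameBelow n k s' s'') : SameBelow n k s s'' where
  vtx c hc := (h'.vtx c hc).trans (h.vtx c hc)
  next c hc := (h'.next c hc).trans (h.next c hc)
  budget c hc := (h'.budget c hc).trans (h.budget c hc)
  lo c hc := (h'.lo c hc).trans (h.lo c hc)
  hi c hc := (h'.hi c hc).trans (h.hi c hc)
  row c hc := (h'.row c hc).trans (h.row c hc)

theorem SameBelow.mono {n k k' : ℕ} {s s' : Store} (h : SameBelow n k s s') (hk : k' ≤ k) :
    SameBelow n k' s s' where
  vtx c hc := h.vtx c (hc.trans hk)
  next c hc := h.next c (hc.trans hk)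
  budget c hc := h.budget c (hc.trans hk)
  lo c hc := h.lo c (hc.trans hk)
  hi c hc := h.hi c (hc.trans hk)
  row c hc := h.row c (hc.trans_le (Nat.mul_le_mul_right n hk))

theorem SameBelow.of_agree {I R : List ℕ} {n k : ℕ} {s s' : Store} (h : Agree I R [] [] s s') :
    SameBelow n k s s' := by
  constructor <;> intro c _ <;> first | rw [h.iarr _ (by simp)] | rw [h.rarr _ (by simp)]

theorem StackAt.congr {n : ℕ} {fs : List Frame} {s s' : Store} (h : StackAt n fs s)
    (hs : SameBelow n fs.length s s') : StackAt n fs s' := by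
  induction fs with
  | nil => trivial
  | cons f fs ih =>
    refine ⟨?_, ih h.2 (hs.mono (by simp))⟩
    have h1 := h.1
    have hk : fs.length + 1 ≤ (f :: fs).length := by simp
    exact ⟨h1.vtx_lt, (hs.vtx _ hk).trans h1.vtx, (hs.next _ hk).trans h1.next,
      (hs.budget _ hk).trans h1.budget, (hs.lo _ hk).trans h1.lo, (hs.hi _ hk).trans h1.hi,
      fun w hw => (hs.row _ (by simp only [List.length_cons, Nat.add_mul]; omega)).trans
        (h1.row w hw)⟩

/-! ### Frames in memory and the initialization of a frame. -/

section Specs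

variable {A : ℕ → ℕ → Prop} [DecidableRel A] {β γ : ℝ} {n : ℕ}

theorem exec_initFrame {s : Store} (hs : Ready β γ n A s) {k u : ℕ} {ρ : ℕ → ℝ} {B : ℝ}
    (h16 : s.ireg 16 = k + 1) (h18 : s.ireg 18 = k * n) (h21 : s.ireg 21 = u)
    (h22 : s.ireg 22 = u * n) (hB : s.rreg 18 = B) (hu : u < n)
    (hρ : ∀ w < n, s.rarr 1 (k * n + w) = ρ w) :
    Exec initFrame s (60 * (n + 1)) fun s' =>
      Agree [23, 24, 25] [16, 17] [2, 3] [2, 3, 4] s s' ∧ SameBelow n k s s' ∧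
      FrameAt n k (newFrame n A B ρ u) s' := by
  refine (exec_seq ((exec_countNbrs hs h18 h22 hu hρ).mono le_rfl fun s₁ h₁ =>
    exec_seq (c₂ := 6) (exec_block _ (exec_ite (c := 5) (fun ht => ?_) fun ht => ?_)))).mono
    (by simp; omega) fun _ => id
  all_goals
    obtain ⟨hA, h17⟩ := h₁
    have hR := hs.agree hA (by decide) (by decide) (by decide)
    have e16 := (hA.ireg 16 (by decide)).trans h16
    have e18 := (hA.ireg 18 (by decide)).trans h18
    have e21 := (hA.ireg 21 (by decide)).trans h21
    have eB := (hA.rreg 18 (by decide)).trans hB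
    have hsb : SameBelow n k s s₁ := .of_agree hA
    have hA' : Agree [23, 24, 25] [16, 17] [2, 3] [2, 3, 4] s s₁ :=
      hA.mono (by simp) (by simp) (by simp) (by simp)
    have hρ' : ∀ w < n, s₁.rarr 1 (k * n + w) = ρ w := fun w hw => by
      rw [hA.rarr 1 (by decide)]; exact hρ w hw
    simp [Op.exec, Test.Holds, eB, hR.r4] at ht
    refine exec_block _ ⟨?_, hsb.trans ⟨?_, ?_, ?_, ?_, ?_, ?_⟩, hu, ?_, ?_, ?_, ?_, ?_, ?_⟩
    · exact .setRArr (by decide) (.setIArr (by decide) (.setRArr (by decide) (.setR (by decide)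
        (.setI (by decide) (.setRArr (by decide) (.setR (by decide) (.setIArr (by decide) hA')))))))
    all_goals
      first
      | intro c hc
        have hck : c ≠ k + 1 := by omega
        simp [Op.exec, e16, hck]
      | intro c hc
        simp [Op.exec, hρ', hc, newFrame]
      | simp [Op.exec, e16, e21, h17, eB, e18, hR.i0, hR.i1, hR.r3, hρ', hu, newFrame, ht, ht.not_gt]

/-- The memory represents a state of the depth-first search that was started on `s₀`. -/
structure SearchAt (n : ℕ) (s₀ : Store) (x : List Frame × ℝ × ℝ) (s : Store) : Prop where
  agree : Agree [16, 17, 18, 19, 20, 21, 22, 23, 24, 25, 26] [16, 17, 18, 19, 20, 21, 22] [2, 3]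
    [1, 2, 3, 4] s₀ s
  low : ∀ c < n, s.rarr 1 c = s₀.rarr 1 c
  height : s.ireg 16 = x.1.length
  base : x.1 ≠ [] → s.ireg 17 + n = x.1.length * n
  stack : StackAt n x.1 s
  retLo : s.rreg 19 = x.2.1
  retHi : s.rreg 20 = x.2.2

end Specs

/-- Multiply the products of the top frame. -/
def mulTop (a b : ℝ) : List Frame → List Frame
  | [] => []
  | f :: fs => { f with lo := f.lo * a, hi := f.hi * b } :: fs

open Classical in
/-- A round of the depth-first search, on a stack and the values returned last. -/
noncomputable def searchNext (β γ : ℝ) (n : ℕ) (A : ℕ → ℕ → Prop) [DecidableRel A] :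
    List Frame × ℝ × ℝ → List Frame × ℝ × ℝ
  | ([], r) => ([], r)
  | (f :: fs, r) =>
    if f.next < n then
      if A f.vtx f.next ∧ 0 < f.row f.next then
        (newFrame n A f.budget (childRow β γ A f.vtx f.next f.row) f.next ::
          { f with next := f.next + 1 } :: fs, r)
      else ({ f with next := f.next + 1 } :: fs, r)
    else (mulTop (msg β γ f.lo) (msg β γ f.hi) fs, f.lo, f.hi)

/-! ### The search loop simulates the abstract transition `searchNext`. -/

section Specs

variable {A : ℕ → ℕ → Prop} [DecidableRel A] {β γ : ℝ} {n : ℕ}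

theorem exec_popFrame {s₀ s : Store} (hs : Ready β γ n A s) {f : Frame} {fs : List Frame}
    {r : ℝ × ℝ} (h : SearchAt n s₀ (f :: fs, r) s) :
    Exec popFrame s 37 (SearchAt n s₀ (mulTop (msg β γ f.lo) (msg β γ f.hi) fs, f.lo, f.hi)) := by
  have h16 : s.ireg 16 = fs.length + 1 := h.height
  have h17 : s.ireg 17 = fs.length * n := by
    have := h.base (by simp)
    simp only [List.length_cons, Nat.add_mul] at this
    omega
  obtain ⟨hf, hfs⟩ := h.stack
  refine exec_block _ ⟨?_, fun c hc => ?_, ?_, ?_, ?_, ?_, ?_⟩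
  · exact .setRArr (by decide) (.setR (by decide) (.setR (by decide) (.setR (by decide)
      (.setR (by decide) (.setR (by decide) (.setR (by decide) (.setRArr (by decide)
      (.setR (by decide) (.setR (by decide) (.setR (by decide)
      (.setR (by decide) (.setR (by decide) (.setR (by decide) (.setI (by decide)
      (.setI (by decide) (.setR (by decide) (.setR (by decide) h.agree)))))))))))))))))
  · simpa [Op.exec] using h.low c hc
  · cases fs <;> simp [Op.exec, h16, hs.i2, mulTop]
  · intro hne
    cases fs with
    | nil => exact absurd rfl hne
    | cons g gs =>
      simp only [List.length_cons, Nat.add_mul] at h17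
      simp [Op.exec, h17, hs.i0, mulTop, Nat.add_mul]
  -- When the last frame is popped the program still multiplies into cell `0` of the two product
  -- arrays, which belongs to no frame.
  · cases fs with
    | nil => trivial
    | cons g gs =>
      obtain ⟨hg, hgs⟩ := hfs
      have hflo : s.rarr 3 (gs.length + 1 + 1) = f.lo := hf.lo
      have hfhi : s.rarr 4 (gs.length + 1 + 1) = f.hi := hf.hi
      refine ⟨⟨hg.vtx_lt, ?_, ?_, ?_, ?_, ?_, ?_⟩, hgs.congr ⟨?_, ?_, ?_, ?_, ?_, ?_⟩⟩
      · simpa [Op.exec] using hg.vtx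
      · simpa [Op.exec] using hg.next
      · simpa [Op.exec] using hg.budget
      · simp [Op.exec, h16, hs.i2, hflo, hg.lo, hs.r0, hs.r1, hs.r4, msg]
      · simp [Op.exec, h16, hs.i2, hfhi, hg.hi, hs.r0, hs.r1, hs.r4, msg]
      · simpa [Op.exec] using hg.row
      all_goals
        intro c hc
        first
        | simp [Op.exec]; done
        | have hck : c ≠ gs.length + 1 := by omega
          simp [Op.exec, h16, hs.i2, hck]
  · simp [Op.exec, h16, hf.lo]
  · simp [Op.exec, h16, hf.hi]

theorem exec_pushFrame {s₀ s : Store} (hs : Ready β γ n A s) {f : Frame} {fs : List Frame}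
    {r : ℝ × ℝ} (h : SearchAt n s₀ (f :: fs, r) s) {u : ℕ} (h19 : s.ireg 19 = f.vtx)
    (h20 : s.ireg 20 = f.vtx * n) (h21 : s.ireg 21 = u) (hu : u < n) :
    Exec pushFrame s (105 * (n + 1)) (SearchAt n s₀
      (newFrame n A f.budget (childRow β γ A f.vtx u f.row) u :: f :: fs, r)) := by
  have h16 : s.ireg 16 = fs.length + 1 := h.height
  have h17 : s.ireg 17 = fs.length * n := by
    have := h.base (by simp)
    simp only [List.length_cons, Nat.add_mul] at this
    omega
  obtain ⟨hf, hfs⟩ := h.stack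
  refine (exec_seq (exec_block _ ?_)).mono
    (c := 7 + (30 * (n + 1) + (5 + 60 * (n + 1) + 1) + 1) + 1) (by omega) fun _ => id
  set s₁ := List.foldl (fun s o => Op.exec o s) s
    [.iload 22 1 21, .rload 18 2 16, .iadd 18 17 0] with hs₁
  have hA₁ : Agree [18, 22] [18] [] [] s s₁ :=
    .setI (by decide) (.setR (by decide) (.setI (by decide) (.refl _ _ _ _ _)))
  have hR₁ := hs.agree hA₁ (by decide) (by decide) (by decide)
  have k18 : s₁.ireg 18 = fs.length * n + n := by simp [hs₁, Op.exec, h17, hs.i0]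
  have k22 : s₁.ireg 22 = u * n := by simp [hs₁, Op.exec, h21, hs.table u hu]
  have kB : s₁.rreg 18 = f.budget := by simp [hs₁, Op.exec, h16, hf.budget]
  refine (exec_seq ((exec_copyChild (rb := fs.length * n) (v := f.vtx) (u := u) (ρ := f.row) hR₁
    ((hA₁.ireg 17 (by decide)).trans h17) k18 ((hA₁.ireg 19 (by decide)).trans h19)
    ((hA₁.ireg 20 (by decide)).trans h20) ((hA₁.ireg 21 (by decide)).trans h21) hf.vtx_lt
    (fun w hw => (congrFun (hA₁.rarr 1 (by decide)) _).trans (hf.row w hw))).mono le_rfl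
      fun s₂ h₂ => ?_))
  obtain ⟨hA₂, hlow₂, hrow₂⟩ := h₂
  have hR₂ := hR₁.agree hA₂ (by decide) (by decide) (by decide)
  refine exec_seq (exec_block _ ?_)
  set s₃ := List.foldl (fun s o => Op.exec o s) s₂ [.iadd 16 16 2, .icopy 17 18] with hs₃
  have hA₃ : Agree [16, 17] [] [] [] s₂ s₃ :=
    .setI (by decide) (.setI (by decide) (.refl _ _ _ _ _))
  have hR₃ := hR₂.agree hA₃ (by decide) (by decide) (by decide)
  have hA₁₃ := (hA₁.trans hA₂).trans hA₃
  have h16' : s₂.ireg 16 = fs.length + 1 :=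
    ((hA₁.trans hA₂).ireg 16 (by decide)).trans h16
  have l16 : s₃.ireg 16 = fs.length + 1 + 1 := by
    simp [hs₃, Op.exec, h16', hR₂.i2]
  have l18 : s₃.ireg 18 = (fs.length + 1) * n := by
    rw [(hA₂.trans hA₃).ireg 18 (by decide), k18, Nat.add_mul, one_mul]
  have l17 : s₃.ireg 17 = (fs.length + 1) * n := by
    rw [← l18]; simp [hs₃, Op.exec]
  have hlow₃ : ∀ c < (fs.length + 1) * n, s₃.rarr 1 c = s.rarr 1 c := fun c hc => by
    rw [hA₃.rarr 1 (by decide), hlow₂ c (by rw [Nat.add_mul] at hc; omega),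
      hA₁.rarr 1 (by decide)]
  have hrow₃ : ∀ w < n, s₃.rarr 1 ((fs.length + 1) * n + w) =
      childRow β γ A f.vtx u f.row w := fun w hw => by
    rw [hA₃.rarr 1 (by decide), Nat.add_mul, one_mul, hrow₂ w hw]
  refine (exec_initFrame hR₃ l16 l18 ((hA₁₃.ireg 21 (by decide)).trans h21)
    (((hA₂.trans hA₃).ireg 22 (by decide)).trans k22)
    (((hA₂.trans hA₃).rreg 18 (by decide)).trans kB) hu hrow₃).mono le_rfl ?_
  rintro s₄ ⟨hA₄, hsb₄, hfr⟩
  have hA := hA₁₃.trans hA₄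
  -- Everything written for the new frame lies above the old stack, which therefore survives.
  have hsb : SameBelow n (fs.length + 1) s s₄ := by
    refine SameBelow.trans ⟨?_, ?_, ?_, ?_, ?_, hlow₃⟩ hsb₄ <;> intro c _
    · rw [hA₁₃.iarr 2 (by decide)]
    · rw [hA₁₃.iarr 3 (by decide)]
    · rw [hA₁₃.rarr 2 (by decide)]
    · rw [hA₁₃.rarr 3 (by decide)]
    · rw [hA₁₃.rarr 4 (by decide)]
  refine ⟨(h.agree.trans hA).mono (by decide) (by decide) (by decide) (by decide),
    fun c hc => ?_, ?_, fun _ => ?_, ⟨hfr, StackAt.congr ⟨hf, hfs⟩ hsb⟩, ?_, ?_⟩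
  · rw [hsb.row c (by rw [Nat.add_mul]; omega)]
    exact h.low c hc
  · rw [hA₄.ireg 16 (by decide), l16]; rfl
  · rw [hA₄.ireg 17 (by decide), l17]; simp only [List.length_cons]; ring
  · rw [hA.rreg 19 (by decide)]; exact h.retLo
  · rw [hA.rreg 20 (by decide)]; exact h.retHi

theorem exec_searchStep {s₀ s : Store} (hs₀ : Ready β γ n A s₀) {x : List Frame × ℝ × ℝ}
    (h : SearchAt n s₀ x s) (hx : x.1 ≠ []) :
    Exec searchStep s (130 * (n + 1)) (SearchAt n s₀ (searchNext β γ n A x)) := by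
  obtain ⟨_ | ⟨f, fs⟩, r⟩ := x
  · exact absurd rfl hx
  have hs := hs₀.agree h.agree (by decide) (by decide) (by decide)
  obtain ⟨hf, hfs⟩ := h.stack
  have h16 : s.ireg 16 = fs.length + 1 := h.height
  have h17 : s.ireg 17 = fs.length * n := by
    have := h.base (by simp)
    simp only [List.length_cons, Nat.add_mul] at this
    omega
  refine (exec_seq (exec_block _ ?_)).mono (c := 7 + (105 * (n + 1) + 17) + 1) (by omega)
    fun _ => id
  set s₁ := List.foldl (fun s o => Op.exec o s) s
    [.iload 19 2 16, .iload 20 1 19, .iload 21 3 16] with hs₁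
  have hA₁ : Agree [19, 20, 21] [] [] [] s s₁ :=
    .setI (by decide) (.setI (by decide) (.setI (by decide) (.refl _ _ _ _ _)))
  have hR₁ := hs.agree hA₁ (by decide) (by decide) (by decide)
  have k19 : s₁.ireg 19 = f.vtx := by simp [hs₁, Op.exec, h16, hf.vtx]
  have k20 : s₁.ireg 20 = f.vtx * n := by
    simp [hs₁, Op.exec, h16, hf.vtx, hs.table _ hf.vtx_lt]
  have k21 : s₁.ireg 21 = f.next := by simp [hs₁, Op.exec, h16, hf.next]
  have hS₁ : SearchAt n s₀ (f :: fs, r) s₁ :=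
    ⟨(h.agree.trans hA₁).mono (by decide) (by decide) (by decide) (by decide),
      fun c hc => by rw [hA₁.rarr 1 (by decide)]; exact h.low c hc,
      by rw [hA₁.ireg 16 (by decide)]; exact h.height,
      by rw [hA₁.ireg 17 (by decide)]; exact h.base,
      h.stack.congr (.of_agree hA₁), by rw [hA₁.rreg 19 (by decide)]; exact h.retLo,
      by rw [hA₁.rreg 20 (by decide)]; exact h.retHi⟩
  refine (exec_ite (c := 105 * (n + 1) + 16) (fun ht => ?_) fun ht => ?_)
  · simp only [Test.Holds, k21, hR₁.i0] at ht
    refine (exec_seq (exec_block _ ?_)).mono (c := 13 + (105 * (n + 1) + 2) + 1) (by omega)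
      fun _ => id
    set s₂ := List.foldl (fun s o => Op.exec o s) s₁ [.iadd 26 21 2, .istore 3 16 26,
      .iadd 24 20 21, .iload 25 0 24, .iadd 24 17 21, .rload 16 1 24] with hs₂
    have hA₂ : Agree [24, 25, 26] [16] [3] [] s₁ s₂ :=
      .setR (by decide) (.setI (by decide) (.setI (by decide) (.setI (by decide)
        (.setIArr (by decide) (.setI (by decide) (.refl _ _ _ _ _))))))
    have hR₂ := hR₁.agree hA₂ (by decide) (by decide) (by decide)
    have l16 : s₁.ireg 16 = fs.length + 1 := hS₁.height
    have l17 : s₁.ireg 17 = fs.length * n := (hA₁.ireg 17 (by decide)).trans h17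
    have k25 : s₂.ireg 25 = if A f.vtx f.next then 1 else 0 := by
      simp [hs₂, Op.exec, k20, k21, hR₁.adj _ hf.vtx_lt _ ht]
    have kx : s₂.rreg 16 = f.row f.next := by
      simp [hs₂, Op.exec, l17, k21, hS₁.stack.1.row _ ht]
    -- The position is advanced before the candidate is tested, so the parent is ready to resume
    -- whether or not a child is pushed.
    have hS₂ : SearchAt n s₀ ({ f with next := f.next + 1 } :: fs, r) s₂ := by
      obtain ⟨hf₁, hfs₁⟩ := hS₁.stack
      refine ⟨(hS₁.agree.trans hA₂).mono (by decide) (by decide) (by decide) (by decide),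
        fun c hc => by rw [hA₂.rarr 1 (by decide)]; exact hS₁.low c hc,
        by rw [hA₂.ireg 16 (by decide)]; exact hS₁.height,
        fun _ => by rw [hA₂.ireg 17 (by decide)]; exact hS₁.base (by simp),
        ⟨⟨hf.vtx_lt, ?_, ?_, ?_, ?_, ?_, fun w hw => ?_⟩, hfs₁.congr ⟨?_, ?_, ?_, ?_, ?_, ?_⟩⟩,
        by rw [hA₂.rreg 19 (by decide)]; exact hS₁.retLo,
        by rw [hA₂.rreg 20 (by decide)]; exact hS₁.retHi⟩
      · rw [hA₂.iarr 2 (by decide)]; exact hf₁.vtx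
      · simp [hs₂, Op.exec, l16, k21, hR₁.i2]
      · rw [hA₂.rarr 2 (by decide)]; exact hf₁.budget
      · rw [hA₂.rarr 3 (by decide)]; exact hf₁.lo
      · rw [hA₂.rarr 4 (by decide)]; exact hf₁.hi
      · rw [hA₂.rarr 1 (by decide)]; exact hf₁.row w hw
      · intro c _; rw [hA₂.iarr 2 (by decide)]
      · intro c hc
        have hck : c ≠ fs.length + 1 := by omega
        simp [hs₂, Op.exec, l16, hck]
      · intro c _; rw [hA₂.rarr 2 (by decide)]
      · intro c _; rw [hA₂.rarr 3 (by decide)]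
      · intro c _; rw [hA₂.rarr 4 (by decide)]
      · intro c _; rw [hA₂.rarr 1 (by decide)]
    refine (exec_ite (c := 105 * (n + 1) + 1) (fun ht2 => ?_) fun ht2 => ?_)
    · simp [Test.Holds, k25, hR₂.i1] at ht2
      refine (exec_ite (c := 105 * (n + 1)) (fun ht3 => ?_) fun ht3 => ?_)
      · simp only [Test.Holds, kx, hR₂.r3] at ht3
        refine (exec_pushFrame hR₂ hS₂ ((hA₂.ireg 19 (by decide)).trans k19)
          ((hA₂.ireg 20 (by decide)).trans k20) ((hA₂.ireg 21 (by decide)).trans k21) ht).mono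
          le_rfl fun s' hs' => ?_
        rw [searchNext, if_pos ht, if_pos ⟨ht2, ht3⟩]
        exact hs'
      · simp only [Test.Holds, kx, hR₂.r3] at ht3
        refine (exec_skip ?_).mono (by omega) fun _ => id
        rw [searchNext, if_pos ht, if_neg fun h => ht3 h.2]
        exact hS₂
    · simp [Test.Holds, k25, hR₂.i1] at ht2
      refine (exec_skip ?_).mono (by omega) fun _ => id
      rw [searchNext, if_pos ht, if_neg fun h => ht2 h.1]
      exact hS₂
  · simp only [Test.Holds, k21, hR₁.i0] at ht
    refine (exec_popFrame hR₁ hS₁).mono (by omega) fun s' hs' => ?_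
    rw [searchNext, if_neg ht]
    exact hs'

end Specs

/-- A bound on the number of rounds of the depth-first search that a call with budget `B` takes. -/
noncomputable def callBound (n : ℕ) (B : ℝ) : ℝ :=
  if B < 1 then 1 else (2 * B - 1) * (2 * n + 1)

/-- A call spends `n` rounds on scanning, one on returning, and the rest on its `d` children.
Splitting `B` into `d + 1` equal shares leaves one share for the vertex itself, and the `-1` in
`callBound` makes the induction close linearly in `B`. If the children are cut off at once, `n + d +
1 ≤ 2 * n + 1` is enough. -/
theorem callBound_recursion {n d : ℕ} {B : ℝ} (hB : 1 ≤ B) (hd : d ≤ n) :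
    n + d * callBound n (B / (d + 1)) + 1 ≤ callBound n B := by
  have hd' : (d : ℝ) ≤ n := by exact_mod_cast hd
  have hd0 : (0 : ℝ) ≤ d := by positivity
  have hd1 : (0 : ℝ) < d + 1 := by positivity
  rw [callBound, callBound, if_neg hB.not_gt]
  split_ifs with h
  · nlinarith
  · set b := B / ((d : ℝ) + 1)
    have hb : B = b * (d + 1) := by simp only [b]; field_simp
    rw [hb]
    push Not at h
    nlinarith [mul_nonneg hd0 (show (0 : ℝ) ≤ n by positivity),
      mul_nonneg (sub_nonneg.2 h) (show (0 : ℝ) ≤ n by positivity)]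

section Search

variable {A : ℕ → ℕ → Prop} [DecidableRel A] {β γ : ℝ} {n : ℕ}

/-- Induction on the number `i` of candidates not yet scanned. The calls are assumed correct above
any stack, since the partially scanned frame lies beneath them. -/
theorem searchNext_scan {ρ : ℕ → ℝ} {v : ℕ} {b T : ℝ} {est₀ est₁ : ℕ → ℝ}
    (hcall : ∀ u ∈ nbrs n A ρ v, ∀ (fs : List Frame) (r : ℝ × ℝ), ∃ m : ℕ, (m : ℝ) ≤ T ∧
      (searchNext β γ n A)^[m] (newFrame n A b (childRow β γ A v u ρ) u :: fs, r) =
        (mulTop (msg β γ (est₀ u)) (msg β γ (est₁ u)) fs, est₀ u, est₁ u))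
    (fs : List Frame) (i : ℕ) :
    ∀ (j : ℕ) (lo hi : ℝ) (r : ℝ × ℝ), j + i = n → ∃ (m : ℕ) (r' : ℝ × ℝ),
      (m : ℝ) ≤ i + ((nbrs n A ρ v).filter (j ≤ ·)).card * T ∧
      (searchNext β γ n A)^[m] (⟨ρ, v, j, b, lo, hi⟩ :: fs, r) =
        (⟨ρ, v, n, b, lo * ∏ u ∈ (nbrs n A ρ v).filter (j ≤ ·), msg β γ (est₀ u),
          hi * ∏ u ∈ (nbrs n A ρ v).filter (j ≤ ·), msg β γ (est₁ u)⟩ :: fs, r') := by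
  induction i with
  | zero =>
    intro j lo hi r hj
    obtain rfl : j = n := hj
    have : (nbrs j A ρ v).filter (j ≤ ·) = ∅ := by
      ext u; simp only [nbrs, Finset.mem_filter, Finset.mem_range, Finset.notMem_empty]; grind
    exact ⟨0, r, by simp [this], by simp [this]⟩
  | succ i ih =>
    intro j lo hi r hj
    have hjn : j < n := by omega
    by_cases hmem : A v j ∧ 0 < ρ j
    · have hjN : j ∈ nbrs n A ρ v := by simp [nbrs, hjn, hmem]
      have hfil : (nbrs n A ρ v).filter (j ≤ ·) =
          insert j ((nbrs n A ρ v).filter (j + 1 ≤ ·)) := by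
        ext u
        simp only [Finset.mem_filter, Finset.mem_insert]
        constructor
        · rintro ⟨h1, h2⟩
          rcases h2.eq_or_lt with rfl | h3
          exacts [Or.inl rfl, Or.inr ⟨h1, h3⟩]
        · rintro (rfl | ⟨h1, h2⟩)
          exacts [⟨hjN, le_rfl⟩, ⟨h1, by omega⟩]
      have hnot : j ∉ (nbrs n A ρ v).filter (j + 1 ≤ ·) := by simp
      obtain ⟨m₁, hm₁, he₁⟩ := hcall j hjN (⟨ρ, v, j + 1, b, lo, hi⟩ :: fs) r
      obtain ⟨m₂, r', hm₂, he₂⟩ := ih (j + 1) (lo * msg β γ (est₀ j)) (hi * msg β γ (est₁ j))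
        (est₀ j, est₁ j) (by omega)
      refine ⟨m₂ + (m₁ + 1), r', ?_, ?_⟩
      · rw [hfil, Finset.card_insert_of_notMem hnot]
        push_cast
        linarith
      · rw [Function.iterate_add_apply, Function.iterate_succ_apply]
        have : searchNext β γ n A (⟨ρ, v, j, b, lo, hi⟩ :: fs, r) =
            (newFrame n A b (childRow β γ A v j ρ) j :: ⟨ρ, v, j + 1, b, lo, hi⟩ :: fs, r) := by
          rw [searchNext, if_pos hjn, if_pos hmem]
        rw [this, he₁, mulTop, he₂, hfil, Finset.prod_insert hnot, Finset.prod_insert hnot,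
          mul_assoc, mul_assoc]
    · have hfil : (nbrs n A ρ v).filter (j ≤ ·) = (nbrs n A ρ v).filter (j + 1 ≤ ·) := by
        refine Finset.filter_congr fun u hu => ⟨fun h => ?_, fun h => by omega⟩
        rcases h.eq_or_lt with rfl | h
        · exact absurd (Finset.mem_filter.1 hu).2 hmem
        · exact h
      obtain ⟨m₂, r', hm₂, he₂⟩ := ih (j + 1) lo hi r (by omega)
      refine ⟨m₂ + 1, r', ?_, ?_⟩
      · rw [hfil]; push_cast; linarith
      · rw [Function.iterate_succ_apply]
        have : searchNext β γ n A (⟨ρ, v, j, b, lo, hi⟩ :: fs, r) =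
            (⟨ρ, v, j + 1, b, lo, hi⟩ :: fs, r) := by
          rw [searchNext, if_pos hjn, if_neg hmem]
        rw [this, he₂, hfil]

/-- A call of the depth-first search returns the estimates. -/
theorem searchNext_call (hβ : 0 < β) (hγ : 0 < γ) (hirr : ∀ u, ¬A u u) (k : ℕ) :
    ∀ (B : ℝ) (ρ : ℕ → ℝ) (v : ℕ) (fs : List Frame) (r : ℝ × ℝ),
      (supp n ρ).card ≤ k → v ∈ supp n ρ → ∃ m : ℕ, (m : ℝ) ≤ callBound n B ∧
      (searchNext β γ n A)^[m] (newFrame n A B ρ v :: fs, r) =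
        (mulTop (msg β γ (estimate β γ n A 0 k B ρ v)) (msg β γ (estimate β γ n A 1 k B ρ v)) fs,
          estimate β γ n A 0 k B ρ v, estimate β γ n A 1 k B ρ v) := by
  induction k with
  | zero =>
    intro B ρ v fs r hk hv
    simp [Finset.card_eq_zero.1 (Nat.le_zero.1 hk)] at hv
  | succ k ih =>
    intro B ρ v fs r hk hv
    by_cases hB : B < 1
    -- A frame with budget below `1` starts with its scan already complete and with the products `0`
    -- and `ρ v`, so the first round returns the truncated values.
    · refine ⟨1, by simp [callBound, hB], ?_⟩
      simp [newFrame, searchNext, estimate, hB]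
    · push Not at hB
      set d := (nbrs n A ρ v).card with hd
      have hdn : d ≤ n := by
        have := Finset.card_filter_le (Finset.range n) fun u => A v u ∧ 0 < ρ u
        rwa [Finset.card_range] at this
      obtain ⟨m, r', hm, he⟩ := searchNext_scan (β := β) (γ := γ) (A := A) (n := n) (ρ := ρ) (v := v)
        (b := B / (d + 1)) (T := callBound n (B / (d + 1)))
        (est₀ := fun u => estimate β γ n A 0 k (B / (d + 1)) (childRow β γ A v u ρ) u)
        (est₁ := fun u => estimate β γ n A 1 k (B / (d + 1)) (childRow β γ A v u ρ) u)
        (fun u hu fs r => ih (B / (d + 1)) _ u fs r (card_supp_childRow hβ hγ hv hk u)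
          (mem_supp_childRow_of_mem_nbrs hβ hγ hirr hu)) fs n 0 (ρ v) (ρ v) r (zero_add n)
      have hnew : newFrame n A B ρ v = ⟨ρ, v, 0, B / (d + 1), ρ v, ρ v⟩ := by
        simp [newFrame, hB.not_gt, hd]
      simp only [zero_le, Finset.filter_true] at hm he
      refine ⟨m + 1, ?_, ?_⟩
      · push_cast
        exact (add_le_add_left hm 1).trans (callBound_recursion hB hdn)
      · rw [Function.iterate_succ_apply', hnew, he]
        simp [searchNext, estimate, hB.not_gt, hd]

end Search

/-! ## The main program -/

/-- Estimate the ratio at the vertex that is being eliminated. -/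
def estimateVertex : Program :=
  .seq (block [.iconst 16 1, .icopy 17 1, .icopy 18 1, .icopy 21 3, .iload 22 1 21, .rcopy 18 5])
    (.seq initFrame (.loop (.ilt 1 16) searchStep))

/-- Round of `advance`. -/
def advanceStep : Program :=
  .seq (block [.iadd 24 22 23, .iload 25 0 24])
    (.seq
      (.ite (.ine 25 1)
        (.seq (block [.rload 16 1 23, .rdiv 16 16 1, .rstore 1 23 16])
          (.ite (.rlt 3 16) (block [.rmul 6 6 1, .rmul 7 7 1]) skip))
        skip)
      (block [.iadd 23 23 2]))

/-- Multiply the estimates by the factor of a vertex and delete it. -/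
def advance : Program :=
  .seq (block [.radd 19 19 4, .rmul 6 6 19, .radd 20 20 4, .rmul 7 7 20, .iload 22 1 3,
      .iconst 23 0])
    (.seq (.loop (.ilt 23 0) advanceStep) (block [.rstore 1 3 3, .iadd 3 3 2]))

/-- Eliminate all vertices. -/
def estimateAll : Program :=
  .seq (block [.iconst 3 0]) (.loop (.ilt 3 0) (.seq estimateVertex advance))

/-- Double the budget and estimate the partition function. -/
def doubleBudget : Program :=
  .seq (block [.radd 5 5 5, .rconst 6 1, .rconst 7 1, .iconst 23 0])
    (.seq (.loop (.ilt 23 0) (block [.rload 16 0 23, .rstore 1 23 16, .iadd 23 23 2]))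
      (.seq estimateAll (block [.rmul 8 2 6, .rsub 9 7 6])))

/-- Prepare the constants and the table of multiples. -/
def setup : Program :=
  .seq (block [.iconst 2 1, .rconst 4 1, .rconst 5 1, .rconst 8 0, .rconst 9 1, .iconst 23 0,
      .iconst 24 0])
    (.loop (.ilt 23 0) (block [.istore 1 23 24, .iadd 24 24 0, .iadd 23 23 2]))

/-- The approximation scheme: double the budget until the estimates are close to each other. -/
def approximate : Program :=
  .seq setup (.seq (.loop (.rlt 8 9) doubleBudget) (block [.rcopy 0 6]))

/-! ### Correctness and cost of the main program. -/

section Specs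

variable {A : ℕ → ℕ → Prop} [DecidableRel A] {β γ : ℝ} {n : ℕ}

/-- The current row of the elimination doubles as the row of the bottom frame. The search writes
rows only from cell `n` on, so this row is still there for the deletion step. -/
theorem exec_estimateVertex (hβ : 0 < β) (hγ : 0 < γ) (hirr : ∀ u, ¬A u u) {s : Store}
    (hs : Ready β γ n A s) {v M : ℕ} {B : ℝ} {ρ : ℕ → ℝ} (h3 : s.ireg 3 = v) (h5 : s.rreg 5 = B)
    (hv : v ∈ supp n ρ) (hρ : ∀ w < n, s.rarr 1 w = ρ w) (hM : callBound n B ≤ M) :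
    Exec estimateVertex s (80 * (n + 1) + M * (130 * (n + 1) + 1)) fun s' =>
      Agree [16, 17, 18, 19, 20, 21, 22, 23, 24, 25, 26] [16, 17, 18, 19, 20, 21, 22] [2, 3]
        [1, 2, 3, 4] s s' ∧ (∀ c < n, s'.rarr 1 c = s.rarr 1 c) ∧
      s'.rreg 19 = estimate β γ n A 0 n B ρ v ∧ s'.rreg 20 = estimate β γ n A 1 n B ρ v := by
  have hvn := (mem_supp.1 hv).1
  refine (exec_seq (exec_block _ ?_)).mono
    (c := 13 + (60 * (n + 1) + (M * (130 * (n + 1) + 1) + 1) + 1) + 1) (by omega) fun _ => id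
  set s₁ := List.foldl (fun s o => Op.exec o s) s
    [.iconst 16 1, .icopy 17 1, .icopy 18 1, .icopy 21 3, .iload 22 1 21, .rcopy 18 5] with hs₁
  have hA₁ : Agree [16, 17, 18, 21, 22] [18] [] [] s s₁ :=
    .setR (by decide) (.setI (by decide) (.setI (by decide) (.setI (by decide)
      (.setI (by decide) (.setI (by decide) (.refl _ _ _ _ _))))))
  have hR₁ := hs.agree hA₁ (by decide) (by decide) (by decide)
  have k16 : s₁.ireg 16 = 0 + 1 := by simp [hs₁, Op.exec]
  have k17 : s₁.ireg 17 = 0 := by simp [hs₁, Op.exec, hs.i1]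
  have k18 : s₁.ireg 18 = 0 * n := by simp [hs₁, Op.exec, hs.i1]
  have k21 : s₁.ireg 21 = v := by simp [hs₁, Op.exec, h3]
  have k22 : s₁.ireg 22 = v * n := by simp [hs₁, Op.exec, h3, hs.table v hvn]
  have kB : s₁.rreg 18 = B := by simp [hs₁, Op.exec, h5]
  have hρ₁ : ∀ w < n, s₁.rarr 1 (0 * n + w) = ρ w := fun w hw => by
    rw [hA₁.rarr 1 (by decide), zero_mul, zero_add]; exact hρ w hw
  refine exec_seq ((exec_initFrame hR₁ k16 k18 k21 k22 kB hvn hρ₁).mono le_rfl ?_)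
  rintro s₂ ⟨hA₂, -, hfr⟩
  have hcard : (supp n ρ).card ≤ n := by
    have := Finset.card_filter_le (Finset.range n) (0 < ρ ·)
    rwa [Finset.card_range] at this
  obtain ⟨m, hm, he⟩ := searchNext_call hβ hγ hirr n B ρ v [] (s₂.rreg 19, s₂.rreg 20) hcard hv
  have hmM : m ≤ M := by exact_mod_cast hm.trans hM
  have hrep : SearchAt n s ([newFrame n A B ρ v], s₂.rreg 19, s₂.rreg 20) s₂ := by
    refine ⟨(hA₁.trans hA₂).mono (by decide) (by decide) (by decide) (by decide), fun c _ => ?_,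
      ?_, fun _ => ?_, ⟨hfr, trivial⟩, rfl, rfl⟩
    · rw [(hA₁.trans hA₂).rarr 1 (by decide)]
    · rw [hA₂.ireg 16 (by decide), k16]; rfl
    · rw [hA₂.ireg 17 (by decide), k17]; simp
  refine (exec_loop_simulation (searchNext β γ n A) (fun x => x.1 = []) (SearchAt n s)
    (c := 130 * (n + 1)) ?_ ?_ (fun x s' hx hd => exec_searchStep hs hx hd) m hrep
    (by rw [he]; rfl)).mono (Nat.add_le_add_right (Nat.mul_le_mul_right _ hmM) 1) ?_
  · rintro ⟨_ | ⟨f, fs⟩, r⟩ hx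
    · rfl
    · exact absurd hx (by simp)
  · intro x s' hx
    have h1 := (hx.agree.ireg 1 (by decide)).trans hs.i1
    simp [Test.Holds, h1, hx.height, List.length_pos_iff]
  · intro s' hs'
    rw [he] at hs'
    exact ⟨hs'.agree, hs'.low, hs'.retLo, hs'.retHi⟩

theorem exec_advance (hγ : 0 < γ) {s : Store}
    (hs : Ready β γ n A s) {v : ℕ} {a b : ℝ} {ρ : ℕ → ℝ} (h3 : s.ireg 3 = v) (hv : v < n)
    (h19 : s.rreg 19 = a) (h20 : s.rreg 20 = b) (hρ : ∀ w < n, s.rarr 1 w = ρ w) :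
    Exec advance s (50 * (n + 1)) fun s' =>
      Agree [3, 22, 23, 24, 25] [6, 7, 16, 19, 20] [] [1] s s' ∧ s'.ireg 3 = v + 1 ∧
      (∀ w < n, s'.rarr 1 w = nextRow γ A v ρ w) ∧
      s'.rreg 6 = s.rreg 6 * ((1 + a) * γ ^ (nbrs n A ρ v).card) ∧
      s'.rreg 7 = s.rreg 7 * ((1 + b) * γ ^ (nbrs n A ρ v).card) := by
  let I : ℕ → Store → Prop := fun i s' => s'.ireg 23 = i ∧ s'.ireg 22 = v * n ∧
    Agree [22, 23, 24, 25] [6, 7, 16, 19, 20] [] [1] s s' ∧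
    (∀ w < n, s'.rarr 1 w = if w < i ∧ A v w then ρ w / γ else ρ w) ∧
    s'.rreg 6 = s.rreg 6 * ((1 + a) * γ ^ (nbrs i A ρ v).card) ∧
    s'.rreg 7 = s.rreg 7 * ((1 + b) * γ ^ (nbrs i A ρ v).card)
  have hstep : ∀ i s', i < n → I i s' → Exec advanceStep s' 30 (I (i + 1)) := by
    rintro i s₁ hi ⟨h23, h22, hA, hrow, h6, h7⟩
    have hR := hs.agree hA (by decide) (by decide) (by decide)
    have hadj := hR.adj v hv i hi
    have hρi : s₁.rarr 1 i = ρ i := by rw [hrow i hi]; simp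
    have hmid : ∀ s₂ : Store, s₂.ireg 23 = i → s₂.ireg 22 = v * n →
        Agree [22, 23, 24, 25] [6, 7, 16, 19, 20] [] [1] s s₂ →
        (∀ w < n, s₂.rarr 1 w = if w < i + 1 ∧ A v w then ρ w / γ else ρ w) →
        s₂.rreg 6 = s.rreg 6 * ((1 + a) * γ ^ (nbrs (i + 1) A ρ v).card) →
        s₂.rreg 7 = s.rreg 7 * ((1 + b) * γ ^ (nbrs (i + 1) A ρ v).card) →
        Exec (block [.iadd 23 23 2]) s₂ 3 (I (i + 1)) := by
      intro s₂ k23 k22 kA krow k6 k7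
      have k2 := (hs.agree kA (by decide) (by decide) (by decide)).i2
      refine exec_block _ ⟨?_, ?_, ?_, ?_, ?_, ?_⟩
      · simp [Op.exec, k23, k2]
      · simp [Op.exec, k22]
      · exact .setI (by decide) kA
      · simpa [Op.exec] using krow
      · simpa [Op.exec] using k6
      · simpa [Op.exec] using k7
    refine (exec_seq (c₂ := 22) (exec_block _ (exec_seq (c₁ := 18) (c₂ := 3) ?_))).mono
      (by simp) fun _ => id
    refine (exec_ite (c := 17) (fun ht => ?_) fun ht => ?_).mono (by omega) fun _ => id
    · simp [Op.exec, Test.Holds, h22, h23, hadj, hR.i1] at ht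
      have hrow' : ∀ w < n, (if w = i then ρ i / γ else s₁.rarr 1 w) =
          if w < i + 1 ∧ A v w then ρ w / γ else ρ w := by
        intro w hw
        by_cases hwi : w = i
        · subst hwi; simp [ht]
        · have : w < i + 1 ↔ w < i := by omega
          simp only [if_neg hwi, hrow w hw, this]
      refine (exec_seq (c₂ := 6) (exec_block _ (exec_ite (c := 5) (fun ht2 => ?_) fun ht2 => ?_))).mono
        (by simp) fun _ => id
      · simp [Op.exec, Test.Holds, h23, hR.r3, hR.r1, hρi, hγ] at ht2
        refine exec_block _ (hmid _ ?_ ?_ ?_ ?_ ?_ ?_)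
        · simp [Op.exec, h23]
        · simp [Op.exec, h22]
        · exact .setR (by decide) (.setR (by decide) (.setRArr (by decide) (.setR (by decide)
            (.setR (by decide) (.setI (by decide) (.setI (by decide) hA))))))
        · simpa [Op.exec, h23, hρi, hR.r1] using hrow'
        · simp [Op.exec, h6, hR.r1, card_nbrs_succ, ht, ht2, pow_succ]; ring
        · simp [Op.exec, h7, hR.r1, card_nbrs_succ, ht, ht2, pow_succ]; ring
      · simp [Op.exec, Test.Holds, h23, hR.r3, hR.r1, hρi] at ht2
        -- The program tests the entry after dividing it by `γ`, which does not change its sign.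
        have ht2' : ¬0 < ρ i := fun h => absurd ht2 (not_le.2 (div_pos h hγ))
        refine (exec_skip (hmid _ ?_ ?_ ?_ ?_ ?_ ?_)).mono (by omega) fun _ => id
        · simp [Op.exec, h23]
        · simp [Op.exec, h22]
        · exact .setRArr (by decide) (.setR (by decide)
            (.setR (by decide) (.setI (by decide) (.setI (by decide) hA))))
        · simpa [Op.exec, h23, hρi, hR.r1] using hrow'
        · simp [Op.exec, h6, card_nbrs_succ, ht2']
        · simp [Op.exec, h7, card_nbrs_succ, ht2']
    · simp [Op.exec, Test.Holds, h22, h23, hadj, hR.i1] at ht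
      refine (exec_skip (hmid _ ?_ ?_ ?_ ?_ ?_ ?_)).mono (by omega) fun _ => id
      · simp [Op.exec, h23]
      · simp [Op.exec, h22]
      · exact .setI (by decide) (.setI (by decide) hA)
      · intro w hw
        by_cases hwi : w = i
        · subst hwi; simp [Op.exec, hρi, ht]
        · have : w < i + 1 ↔ w < i := by omega
          simp [Op.exec, hrow w hw, this]
      · simp [Op.exec, h6, card_nbrs_succ, ht]
      · simp [Op.exec, h7, card_nbrs_succ, ht]
  refine (exec_seq (exec_block _ (exec_seq (c₂ := 5) ((exec_for n 30 I (fun i s' h => h.1)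
    (fun i s' h => (h.2.2.1.ireg 0 (by decide)).trans hs.i0) hstep ?_).mono le_rfl ?_)))).mono
    ?_ fun _ => id
  · refine ⟨by simp [Op.exec], by simp [Op.exec, h3, hs.table v hv],
      .setI (by decide) (.setI (by decide) (.setR (by decide) (.setR (by decide) (.setR (by decide)
        (.setR (by decide) (.refl _ _ _ _ _)))))), fun w hw => by simp [Op.exec, hρ w hw], ?_, ?_⟩
    · simp [Op.exec, nbrs, h19, hs.r4, add_comm]
    · simp [Op.exec, nbrs, h20, hs.r4, add_comm]
  · rintro s' ⟨-, -, hA, hrow, h6, h7⟩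
    have hR := hs.agree hA (by decide) (by decide) (by decide)
    have k3 := (hA.ireg 3 (by decide)).trans h3
    refine exec_block _ ⟨?_, ?_, ?_, ?_, ?_⟩
    · exact .setI (by decide) (.setRArr (by decide)
        (hA.mono (by decide) (by decide) (by decide) (by decide)))
    · simp [Op.exec, k3, hR.i2]
    · intro w hw
      by_cases hwv : w = v
      · simp [Op.exec, k3, hwv, hR.r3, nextRow]
      · simp [Op.exec, k3, hwv, nextRow, hrow w hw, hw]
    · simpa [Op.exec] using h6
    · simpa [Op.exec] using h7
  · simp; omega

theorem exec_estimateAll (hβ : 0 < β) (hγ : 0 < γ) (hirr : ∀ u, ¬A u u) {s : Store}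
    (hs : Ready β γ n A s) {M : ℕ} {B : ℝ} {π : ℕ → ℝ} (h5 : s.rreg 5 = B)
    (h6 : s.rreg 6 = 1) (h7 : s.rreg 7 = 1) (hπ : ∀ w < n, 0 < π w)
    (hrow : ∀ w < n, s.rarr 1 w = π w) (hM : callBound n B ≤ M) :
    Exec estimateAll s (n * (132 * (n + 1) + M * (130 * (n + 1) + 1)) + 5) fun s' =>
      Agree [3, 16, 17, 18, 19, 20, 21, 22, 23, 24, 25, 26] [6, 7, 16, 17, 18, 19, 20, 21, 22]
        [2, 3] [1, 2, 3, 4] s s' ∧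
      s'.rreg 6 = estimateZ β γ n A 0 B π n ∧ s'.rreg 7 = estimateZ β γ n A 1 B π n := by
  let I : ℕ → Store → Prop := fun j s' => s'.ireg 3 = j ∧
    Agree [3, 16, 17, 18, 19, 20, 21, 22, 23, 24, 25, 26] [6, 7, 16, 17, 18, 19, 20, 21, 22]
        [2, 3] [1, 2, 3, 4] s s' ∧
    (∀ w < n, s'.rarr 1 w = rowAt γ A π j w) ∧
    s'.rreg 6 = estimateZ β γ n A 0 B π j ∧ s'.rreg 7 = estimateZ β γ n A 1 B π j
  have hstep : ∀ j s', j < n → I j s' → Exec (.seq estimateVertex advance) s'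
      (131 * (n + 1) + M * (130 * (n + 1) + 1)) (I (j + 1)) := by
    rintro j s₁ hj ⟨h3, hA, hrow, k6, k7⟩
    have hR := hs.agree hA (by decide) (by decide) (by decide)
    have hjs : j ∈ supp n (rowAt γ A π j) := by
      rw [supp_rowAt hγ hπ, Finset.mem_Ico]; exact ⟨le_rfl, hj⟩
    refine (exec_seq (c₂ := 50 * (n + 1)) ((exec_estimateVertex hβ hγ hirr hR h3
      ((hA.rreg 5 (by decide)).trans h5) hjs hrow hM).mono le_rfl ?_)).mono (by omega) fun _ => id
    rintro s₂ ⟨hA₂, hlow, k19, k20⟩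
    have hR₂ := hR.agree hA₂ (by decide) (by decide) (by decide)
    refine (exec_advance hγ hR₂ ((hA₂.ireg 3 (by decide)).trans h3) hj k19 k20
      (fun w hw => (hlow w hw).trans (hrow w hw))).mono le_rfl ?_
    rintro s₃ ⟨hA₃, l3, lrow, l6, l7⟩
    refine ⟨l3, ((hA.trans hA₂).trans hA₃).mono (by decide) (by decide) (by decide) (by decide),
      lrow, ?_, ?_⟩
    · rw [l6, hA₂.rreg 6 (by decide), k6, estimateZ]
    · rw [l7, hA₂.rreg 7 (by decide), k7, estimateZ]
  refine (exec_seq (exec_block _ ((exec_for n _ I (fun i s' h => h.1)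
    (fun i s' h => (h.2.1.ireg 0 (by decide)).trans hs.i0) hstep ?_)))).mono ?_ ?_
  · exact ⟨by simp [Op.exec], .setI (by decide) (.refl _ _ _ _ _),
      fun w hw => by simpa [Op.exec, rowAt] using hrow w hw, by simp [Op.exec, h6, estimateZ],
      by simp [Op.exec, h7, estimateZ]⟩
  · have : n * (131 * (n + 1) + M * (130 * (n + 1) + 1) + 1) ≤
        n * (132 * (n + 1) + M * (130 * (n + 1) + 1)) := Nat.mul_le_mul_left _ (by omega)
    simp; omega
  · rintro s' ⟨-, hA, -, h6, h7⟩
    exact ⟨hA, h6, h7⟩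

/-- The memory after `i` doublings of the budget. -/
structure Doubled (β γ ε : ℝ) (n : ℕ) (A : ℕ → ℕ → Prop) [DecidableRel A] (π : ℕ → ℝ) (i : ℕ)
    (s : Store) : Prop where
  ready : Ready β γ n A s
  r2 : s.rreg 2 = ε
  r5 : s.rreg 5 = 2 ^ i
  field : ∀ w < n, s.rarr 0 w = π w
  start : i = 0 → s.rreg 8 = 0 ∧ s.rreg 9 = 1
  value : i ≠ 0 → s.rreg 6 = estimateZ β γ n A 0 (2 ^ i) π n ∧
    s.rreg 8 = ε * estimateZ β γ n A 0 (2 ^ i) π n ∧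
    s.rreg 9 = estimateZ β γ n A 1 (2 ^ i) π n - estimateZ β γ n A 0 (2 ^ i) π n

theorem callBound_le (n i : ℕ) : callBound n (2 ^ i) ≤ (2 ^ (i + 1) * (2 * n + 1) : ℕ) := by
  have : (1 : ℝ) ≤ 2 ^ i := one_le_pow₀ (by norm_num)
  rw [callBound, if_neg this.not_gt]
  push_cast
  rw [pow_succ]
  nlinarith [n.cast_nonneg (α := ℝ)]

theorem exec_doubleBudget (hβ : 0 < β) (hγ : 0 < γ) (hirr : ∀ u, ¬A u u) {ε : ℝ} {π : ℕ → ℝ}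
    (hπ : ∀ w < n, 0 < π w) {i : ℕ} {s : Store} (h : Doubled β γ ε n A π i s) :
    Exec doubleBudget s (5000 * (n + 1) ^ 3 * 2 ^ i) (Doubled β γ ε n A π (i + 1)) := by
  have hs := h.ready
  let I : ℕ → Store → Prop := fun j s' => s'.ireg 23 = j ∧
    Agree [23] [5, 6, 7, 16] [] [1] s s' ∧ s'.rreg 5 = 2 ^ (i + 1) ∧ s'.rreg 6 = 1 ∧
    s'.rreg 7 = 1 ∧ ∀ w < j, s'.rarr 1 w = π w
  have hstep : ∀ j s', j < n → I j s' →
      Exec (block [.rload 16 0 23, .rstore 1 23 16, .iadd 23 23 2]) s' 7 (I (j + 1)) := by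
    rintro j s₁ hj ⟨h23, hA, h5, h6, h7, hrow⟩
    have hR := hs.agree hA (by decide) (by decide) (by decide)
    refine exec_block _ ⟨?_, ?_, ?_, ?_, ?_, ?_⟩
    · simp [Op.exec, h23, hR.i2]
    · exact .setI (by decide) (.setRArr (by decide) (.setR (by decide) hA))
    · simpa [Op.exec] using h5
    · simpa [Op.exec] using h6
    · simpa [Op.exec] using h7
    · intro w hw
      rcases Nat.lt_succ_iff_lt_or_eq.1 hw with hw' | rfl
      · simp [Op.exec, h23, hw'.ne, hrow w hw']
      · simp [Op.exec, h23, hA.rarr 0 (by decide), h.field w hj]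
  refine (exec_seq (exec_block _ (exec_seq ((exec_for n 7 I (fun i s' h => h.1)
    (fun i s' h => (h.2.1.ireg 0 (by decide)).trans hs.i0) hstep ?_).mono le_rfl ?_)))).mono
    (c := 9 + (n * (7 + 1) + 1 +
      (n * (132 * (n + 1) + 2 ^ (i + 2) * (2 * n + 1) * (130 * (n + 1) + 1)) + 5 + 5 + 1) + 1) + 1)
    ?_ fun _ => id
  · refine ⟨by simp [Op.exec], .setI (by decide) (.setR (by decide) (.setR (by decide)
      (.setR (by decide) (.refl _ _ _ _ _)))), ?_, by simp [Op.exec], by simp [Op.exec],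
      fun w hw => absurd hw (by omega)⟩
    simp only [List.foldl, Op.exec, Store.setI_rreg, Store.setR_rreg, h.r5]
    norm_num [pow_succ]
    ring
  · rintro s₁ ⟨-, hA₁, h5, h6, h7, hrow⟩
    have hR₁ := hs.agree hA₁ (by decide) (by decide) (by decide)
    refine exec_seq (c₂ := 5) ((exec_estimateAll hβ hγ hirr hR₁ h5 h6 h7 hπ hrow
      (callBound_le n (i + 1))).mono le_rfl ?_)
    rintro s₂ ⟨hA₂, k6, k7⟩
    have hA := hA₁.trans hA₂
    have hR₂ := hs.agree hA (by decide) (by decide) (by decide)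
    have k2 := (hA.rreg 2 (by decide)).trans h.r2
    refine exec_block _ ⟨?_, ?_, ?_, ?_, fun h0 => absurd h0 (by omega), fun _ => ⟨?_, ?_, ?_⟩⟩
    · exact hR₂.agree (I := []) (R := [8, 9]) (IA := []) (RA := [])
        (.setR (by decide) (.setR (by decide) (.refl _ _ _ _ _))) (by decide) (by decide) (by decide)
    · simpa [Op.exec] using k2
    · have := (hA₂.rreg 5 (by decide)).trans h5
      simpa [Op.exec] using this
    · intro w hw
      simpa [Op.exec, hA.rarr 0 (by decide)] using h.field w hw
    · simpa [Op.exec] using k6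
    · simp [Op.exec, k2, k6]
    · simp [Op.exec, k6, k7]
  -- The dominant term is `n` vertices times `2 ^ (i + 2) * (2 * n + 1)` rounds times `130 * (n + 1)
  -- + 1` steps per round; the remaining terms are absorbed into the constant.
  · have h2 : 1 ≤ 2 ^ i := Nat.one_le_two_pow
    rw [pow_add]
    generalize 2 ^ i = p at h2 ⊢
    have hp : 1 ≤ (n + 1) ^ 3 * p := Nat.mul_pos (by positivity) h2
    have h3 : n + 1 ≤ (n + 1) ^ 3 * p :=
      (Nat.le_self_pow (by norm_num) _).trans (Nat.le_mul_of_pos_right _ h2)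
    have h4 : n * (132 * (n + 1)) ≤ 132 * ((n + 1) ^ 3 * p) :=
      calc n * (132 * (n + 1)) ≤ (n + 1) * (132 * (n + 1)) * (n + 1) * p := by
            refine le_trans (Nat.mul_le_mul_right _ (Nat.le_succ n)) ?_
            exact (Nat.le_mul_of_pos_right _ n.succ_pos).trans (Nat.le_mul_of_pos_right _ h2)
        _ = 132 * ((n + 1) ^ 3 * p) := by ring
    have h5 : n * (p * 2 ^ 2 * (2 * n + 1) * (130 * (n + 1) + 1)) ≤ 1048 * ((n + 1) ^ 3 * p) :=
      calc n * (p * 2 ^ 2 * (2 * n + 1) * (130 * (n + 1) + 1))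
          ≤ (n + 1) * (p * 2 ^ 2 * (2 * (n + 1)) * (131 * (n + 1))) := by
            gcongr <;> omega
        _ = 1048 * ((n + 1) ^ 3 * p) := by ring
    rw [mul_add n (132 * (n + 1))]
    have h6 : 5000 * (n + 1) ^ 3 * p = 5000 * ((n + 1) ^ 3 * p) := by ring
    omega

theorem exec_setup {ε : ℝ} {π : ℕ → ℝ} {s : Store} (h0 : s.ireg 0 = n) (h1 : s.ireg 1 = 0)
    (r0 : s.rreg 0 = β) (r1 : s.rreg 1 = γ) (r2 : s.rreg 2 = ε) (r3 : s.rreg 3 = 0)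
    (hadj : ∀ u < n, ∀ w < n, s.iarr 0 (u * n + w) = if A u w then 1 else 0)
    (hπ : ∀ w < n, s.rarr 0 w = π w) :
    Exec setup s (30 * (n + 1)) (Doubled β γ ε n A π 0) := by
  let I : ℕ → Store → Prop := fun j s' => s'.ireg 23 = j ∧ s'.ireg 24 = j * n ∧ s'.ireg 2 = 1 ∧
    Agree [2, 23, 24] [4, 5, 8, 9] [1] [] s s' ∧ s'.rreg 4 = 1 ∧ s'.rreg 5 = 1 ∧
    s'.rreg 8 = 0 ∧ s'.rreg 9 = 1 ∧ ∀ u < j, s'.iarr 1 u = u * n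
  have hstep : ∀ j s', j < n → I j s' →
      Exec (block [.istore 1 23 24, .iadd 24 24 0, .iadd 23 23 2]) s' 7 (I (j + 1)) := by
    rintro j s₁ hj ⟨h23, h24, h2, hA, h4, h5, h8, h9, htab⟩
    have k0 := (hA.ireg 0 (by decide)).trans h0
    refine exec_block _ ⟨?_, ?_, ?_, ?_, ?_, ?_, ?_, ?_, ?_⟩
    · simp [Op.exec, h23, h2]
    · simp [Op.exec, h24, k0, Nat.add_mul]
    · simpa [Op.exec] using h2
    · exact .setI (by decide) (.setI (by decide) (.setIArr (by decide) hA))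
    · simpa [Op.exec] using h4
    · simpa [Op.exec] using h5
    · simpa [Op.exec] using h8
    · simpa [Op.exec] using h9
    · intro u hu
      rcases Nat.lt_succ_iff_lt_or_eq.1 hu with hu' | rfl
      · simp [Op.exec, h23, hu'.ne, htab u hu']
      · simp [Op.exec, h23, h24]
  refine (exec_seq (exec_block _ (exec_for n 7 I (fun i s' h => h.1)
    (fun i s' h => (h.2.2.2.1.ireg 0 (by decide)).trans h0) hstep ?_))).mono ?_ ?_
  · refine ⟨by simp [Op.exec], by simp [Op.exec], by simp [Op.exec], .setI (by decide)
      (.setI (by decide) (.setR (by decide) (.setR (by decide) (.setR (by decide)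
      (.setR (by decide) (.setI (by decide) (.refl _ _ _ _ _))))))), by simp [Op.exec],
      by simp [Op.exec], by simp [Op.exec], by simp [Op.exec], fun w hw => absurd hw (by omega)⟩
  · simp; omega
  · rintro s' ⟨-, -, h2, hA, h4, h5, h8, h9, htab⟩
    refine ⟨⟨(hA.ireg 0 (by decide)).trans h0, (hA.ireg 1 (by decide)).trans h1, h2,
      (hA.rreg 0 (by decide)).trans r0, (hA.rreg 1 (by decide)).trans r1,
      (hA.rreg 3 (by decide)).trans r3, h4, fun u hu w hw => ?_, htab⟩,
      (hA.rreg 2 (by decide)).trans r2, by simpa using h5, fun w hw => ?_, fun _ => ⟨h8, h9⟩,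
      fun h => absurd rfl h⟩
    · rw [hA.iarr 0 (by decide)]; exact hadj u hu w hw
    · rw [hA.rarr 0 (by decide)]; exact hπ w hw

/-- The cost doubles with the budget, so all attempts together cost only a constant multiple of the
last one. -/
theorem sum_two_pow_mul_le (K N : ℕ) (hK : 1 ≤ K) :
    ∑ i ∈ Finset.range N, (K * 2 ^ i + 1) ≤ 2 * K * 2 ^ N := by
  induction N with
  | zero => simp
  | succ N ih =>
    rw [Finset.sum_range_succ, pow_succ]
    have : 1 ≤ 2 ^ N := Nat.one_le_two_pow
    nlinarith

/-- The program halts with a certified estimate, with a cost governed by the first budget at which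
the estimates are close to each other. -/
theorem exec_approximate (hβ : 0 < β) (hγ : 0 < γ) (hirr : ∀ u, ¬A u u) {ε : ℝ} {π : ℕ → ℝ}
    (hπ : ∀ w < n, 0 < π w) {s : Store} (h0 : s.ireg 0 = n) (h1 : s.ireg 1 = 0)
    (r0 : s.rreg 0 = β) (r1 : s.rreg 1 = γ) (r2 : s.rreg 2 = ε) (r3 : s.rreg 3 = 0)
    (hadj : ∀ u < n, ∀ w < n, s.iarr 0 (u * n + w) = if A u w then 1 else 0)
    (hfield : ∀ w < n, s.rarr 0 w = π w) {N : ℕ} (hN : N ≠ 0)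
    (hclose : estimateZ β γ n A 1 (2 ^ N) π n - estimateZ β γ n A 0 (2 ^ N) π n ≤
      ε * estimateZ β γ n A 0 (2 ^ N) π n) :
    Exec approximate s (11000 * (n + 1) ^ 3 * 2 ^ N) fun s' => ∃ B : ℝ,
      s'.rreg 0 = estimateZ β γ n A 0 B π n ∧
      estimateZ β γ n A 1 B π n - estimateZ β γ n A 0 B π n ≤ ε * estimateZ β γ n A 0 B π n := by
  refine (exec_seq (c₂ := 10000 * (n + 1) ^ 3 * 2 ^ N + 5)
    ((exec_setup h0 h1 r0 r1 r2 r3 hadj hfield).mono le_rfl fun s₁ h₁ =>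
    (exec_seq (c₂ := 3) ((exec_loop N (fun i => 5000 * (n + 1) ^ 3 * 2 ^ i) (Doubled β γ ε n A π)
      (fun i s' _ h _ => exec_doubleBudget hβ hγ hirr hπ h) (fun s' h => ?_) h₁).mono le_rfl
      ?_)).mono ?_ fun _ => id)).mono ?_ fun _ => id
  · obtain ⟨-, h8, h9⟩ := h.value hN
    rw [Test.Holds, h8, h9]
    exact not_lt.2 hclose
  · rintro s₂ ⟨⟨i, -, h⟩, ht⟩
    -- Registers `8` and `9` start as `0` and `1`, so the loop cannot be left before the first
    -- estimates have been computed.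
    have hi : i ≠ 0 := by
      rintro rfl
      obtain ⟨h8, h9⟩ := h.start rfl
      simp [Test.Holds, h8, h9] at ht
    obtain ⟨h6, h8, h9⟩ := h.value hi
    rw [Test.Holds, h8, h9, not_lt] at ht
    exact exec_block _ ⟨2 ^ i, by simpa [Op.exec] using h6, ht⟩
  · have h5 : 1 ≤ (n + 1) ^ 3 := Nat.one_le_pow _ _ (by omega)
    have := sum_two_pow_mul_le (5000 * (n + 1) ^ 3) N (by omega)
    linarith
  · have h2 : 1 ≤ 2 ^ N := Nat.one_le_two_pow
    have h3 : n + 1 ≤ (n + 1) ^ 3 := Nat.le_self_pow (by norm_num) _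
    have h4 : (n + 1) ^ 3 ≤ (n + 1) ^ 3 * 2 ^ N := Nat.le_mul_of_pos_right _ (by positivity)
    have h5 : 1 ≤ (n + 1) ^ 3 := Nat.one_le_pow _ _ (by omega)
    nlinarith

end Specs

/-! ## The graph of the input -/

section Transport

variable {n : ℕ}

/-- The adjacency relation of a graph on `Fin n`, on the natural numbers. -/
def natAdj (G : SimpleGraph (Fin n)) (u w : ℕ) : Prop :=
  ∃ i j : Fin n, u = i ∧ w = j ∧ G.Adj i j

/-- A field on `Fin n`, extended by zero. -/
noncomputable def natField (π : Fin n → ℝ) (w : ℕ) : ℝ := if h : w < n then π ⟨w, h⟩ else 0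

theorem natAdj_coe {G : SimpleGraph (Fin n)} {i j : Fin n} : natAdj G i j ↔ G.Adj i j := by
  constructor
  · rintro ⟨i', j', hi, hj, h⟩
    rwa [Fin.ext hi, Fin.ext hj]
  · exact fun h => ⟨i, j, rfl, rfl, h⟩

theorem natAdj_symm (G : SimpleGraph (Fin n)) (u w : ℕ) (h : natAdj G u w) : natAdj G w u := by
  obtain ⟨i, j, rfl, rfl, h⟩ := h
  exact natAdj_coe.2 h.symm

theorem natAdj_irrefl (G : SimpleGraph (Fin n)) (u : ℕ) : ¬natAdj G u u := by
  rintro ⟨i, j, rfl, hj, h⟩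
  exact G.loopless.irrefl i (by rwa [← Fin.ext hj] at h)

open Classical in
-- Each unordered edge corresponds to exactly one increasing pair.
theorem ncard_edges_eq_edgesIn (G : SimpleGraph (Fin n)) (s : Finset (Fin n)) :
    {e ∈ G.edgeSet | ∀ v ∈ e, v ∈ s}.ncard = edgesIn (natAdj G) (s.map Fin.valEmbedding) := by
  have hE : edgesIn (natAdj G) (s.map Fin.valEmbedding) =
      ((s ×ˢ s).filter fun p => p.1 < p.2 ∧ G.Adj p.1 p.2).card := by
    rw [edgesIn, Finset.sum_map, Finset.card_filter, Finset.sum_product]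
    refine Finset.sum_congr rfl fun i _ => ?_
    rw [Finset.sum_map]
    refine Finset.sum_congr rfl fun j _ => ?_
    simp only [Fin.valEmbedding_apply, natAdj_coe, Fin.lt_def]
  have hinj : Set.InjOn (fun p : Fin n × Fin n => s(p.1, p.2))
      ((s ×ˢ s).filter fun p => p.1 < p.2 ∧ G.Adj p.1 p.2 : Finset (Fin n × Fin n)) := by
    rintro ⟨a, b⟩ hab ⟨c, d⟩ hcd he
    simp only [Finset.coe_filter, Set.mem_ofPred_eq] at hab hcd
    rcases Sym2.eq_iff.1 he with ⟨rfl, rfl⟩ | ⟨rfl, rfl⟩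
    · rfl
    · exact absurd hab.2.1 hcd.2.1.not_gt
  rw [hE, ← Set.ncard_coe_finset, ← hinj.ncard_image]
  · congr 1
    ext e
    induction e with
    | _ i j =>
      simp only [Set.mem_ofPred_eq, SimpleGraph.mem_edgeSet, Sym2.mem_iff, Set.mem_image,
        Finset.coe_filter, Finset.mem_product, Prod.exists, forall_eq_or_imp, forall_eq]
      constructor
      · rintro ⟨h, hi, hj⟩
        rcases lt_or_gt_of_ne h.ne with hij | hij
        · exact ⟨i, j, ⟨⟨hi, hj⟩, hij, h⟩, rfl⟩
        · exact ⟨j, i, ⟨⟨hj, hi⟩, hij, h.symm⟩, Sym2.eq_swap⟩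
      · rintro ⟨a, b, ⟨⟨ha, hb⟩, -, h⟩, he⟩
        rcases Sym2.eq_iff.1 he with ⟨rfl, rfl⟩ | ⟨rfl, rfl⟩
        exacts [⟨h, ha, hb⟩, ⟨h.symm, hb, ha⟩]

open Classical in
-- A configuration is identified with its set of vertices of spin `0`.
theorem partitionFunction_eq_setPartition (β γ : ℝ) (π : Fin n → ℝ) (G : SimpleGraph (Fin n)) :
    partitionFunction β γ π G =
      setPartition β γ (natAdj G) (Finset.range n) (natField π) := by
  have hr : (Finset.univ : Finset (Fin n)).map Fin.valEmbedding = Finset.range n := by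
    ext w; simp
  have hpow : (Finset.range n).powerset =
      (Finset.univ : Finset (Finset (Fin n))).map (Finset.mapEmbedding Fin.valEmbedding).toEmbedding := by
    rw [← hr]
    ext T
    simp only [Finset.mem_powerset, Finset.mem_map, Finset.mem_univ, true_and, Finset.subset_map_iff,
      RelEmbedding.coe_toEmbedding, Finset.mapEmbedding_apply]
    exact ⟨fun ⟨u, _, h⟩ => ⟨u, h.symm⟩, fun ⟨u, h⟩ => ⟨u, Finset.subset_univ u, h.symm⟩⟩
  rw [setPartition, hpow, Finset.sum_map, partitionFunction]
  have h01 : ∀ x : Fin 2, x ≠ 0 ↔ x = 1 := by decide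
  refine Finset.sum_bij' (fun σ _ => Finset.univ.filter (σ · = 0))
    (fun s _ i => if i ∈ s then 0 else 1) (fun _ _ => Finset.mem_univ _) (fun _ _ => Finset.mem_univ _)
    (fun σ _ => ?_) (fun s _ => ?_) fun σ _ => ?_
  · funext i
    by_cases h : σ i = 0
    · simp [h]
    · simp [(h01 _).1 h]
  · ext i; simp
  · have hset : Finset.range n \ (Finset.univ.filter (σ · = 0)).map Fin.valEmbedding =
        (Finset.univ.filter (σ · = 1)).map Fin.valEmbedding := by
      rw [← hr, ← Finset.map_sdiff]
      congr 1
      ext i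
      simpa using h01 (σ i)
    simp only [RelEmbedding.coe_toEmbedding, Finset.mapEmbedding_apply, hset,
      ← ncard_edges_eq_edgesIn, Finset.mem_filter, Finset.mem_univ, true_and, Finset.prod_map, weight,
      monoEdges]
    congr 1
    rw [Finset.prod_filter]
    refine Finset.prod_congr rfl fun i _ => ?_
    simp [natField]

/-- Cell numbers determine their row and column, because dividing by `n` recovers the row. -/
theorem input_adj (β γ ε : ℝ) (G : SimpleGraph (Fin n)) [DecidableRel (natAdj G)] (π : Fin n → ℝ)
    {u w : ℕ} (hu : u < n) (hw : w < n) :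
    (input β γ n G π ε).iarr 0 (u * n + w) = if natAdj G u w then 1 else 0 := by
  have : (∃ i j : Fin n, u * n + w = i * n + j ∧ G.Adj i j) ↔ natAdj G u w := by
    constructor
    · rintro ⟨i, j, h, hG⟩
      have hn : 0 < n := by omega
      have h1 : (n * u + w) / n = (n * (i : ℕ) + j) / n := by rw [mul_comm n, mul_comm n, h]
      rw [Nat.mul_add_div hn, Nat.mul_add_div hn, Nat.div_eq_of_lt hw, Nat.div_eq_of_lt j.2] at h1
      have h2 : u = i := h1
      subst h2
      exact ⟨i, j, rfl, by omega, hG⟩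
    · rintro ⟨i, j, rfl, rfl, h⟩
      exact ⟨i, j, rfl, h⟩
  simp only [input, true_and, this]

end Transport

/-! ## The running time -/

theorem exists_pow_two_between {X : ℝ} : ∃ N : ℕ, N ≠ 0 ∧ X ≤ 2 ^ N ∧ (2 : ℝ) ^ N ≤ 2 * max 1 X := by
  obtain ⟨m, hm, hm'⟩ := exists_nat_pow_near (le_max_left 1 X) one_lt_two
  refine ⟨m + 1, by omega, (le_max_right 1 X).trans hm'.le, ?_⟩
  rw [pow_succ']
  linarith

theorem estimates_close_of_exp {ε x Z₀ Z₁ : ℝ} (hx : x ≤ ε / 2) (hε0 : 0 < ε) (hε : ε < 1)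
    (hZ₀ : 0 < Z₀) (hZ₁ : Z₁ ≤ Real.exp x * Z₀) : Z₁ - Z₀ ≤ ε * Z₀ := by
  -- `exp (ε / 2) ≤ 1 / (1 - ε / 2) ≤ 1 + ε` for `0 < ε < 1`.
  have h1 : Real.exp x ≤ 1 + ε := by
    refine (Real.exp_le_exp.2 hx).trans ?_
    have h2 := Real.add_one_le_exp (-(ε / 2))
    rw [Real.exp_neg] at h2
    have h3 := Real.exp_pos (ε / 2)
    have h4 : (1 - ε / 2) * Real.exp (ε / 2) ≤ 1 := by
      have := mul_le_mul_of_nonneg_right h2 h3.le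
      rw [inv_mul_cancel₀ h3.ne'] at this
      linarith
    nlinarith
  nlinarith

/-- A budget of at least `(2 * K * n / ε) ^ (1 / κ)` makes the total exponent `n * K * B ^ (-κ)` at
most `ε / 2`, which triggers the stopping test. The least suitable power of two may overshoot only
by a constant factor. -/
theorem exists_approximatesWithin {β γ lam : ℝ} (hβ : 0 < β) (hβ1 : β ≤ 1) (hβγ : 1 < β * γ)
    (hγ : 1 < γ) (hlam : 0 < lam) (hlc : lam < criticalField β γ) :
    ∃ (C : ℝ) (k : ℕ), k ≠ 0 ∧ 0 ≤ C ∧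
      ApproximatesWithin approximate β γ lam fun n ε => C * ((n : ℝ) / ε) ^ k := by
  obtain ⟨K, κ, hK, hκ, hdec⟩ := exists_estimate_decay hβ hβ1 hβγ hγ hlam hlc
  have hγ0 : 0 < γ := by linarith
  set a := ⌈1 / κ⌉₊ with ha
  -- The `8` comes from `(n + 1) ^ 3 ≤ 8 * (n / ε) ^ 3`, the last factor from the bound on `2 ^ N`.
  -- The exponent is `3` for the polynomial overhead plus `1 / κ`, rounded up, for the budget.
  refine ⟨11000 * 8 * (2 * max 1 ((2 * K) ^ (1 / κ))), a + 3, by omega, by positivity, ?_⟩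
  intro n G π ε hn hπ hε hε1
  classical
  have hn1 : (1 : ℝ) ≤ n := by exact_mod_cast hn
  have hq : 1 ≤ (n : ℝ) / ε := by rw [le_div_iff₀ hε]; linarith
  have hfp : ∀ w < n, 0 < natField π w := fun w hw => by
    rw [natField, dif_pos hw]; exact (hπ _).1
  have hfl : ∀ w < n, natField π w ≤ lam := fun w hw => by
    rw [natField, dif_pos hw]; exact (hπ _).2
  obtain ⟨N, hN0, hN, hN'⟩ := exists_pow_two_between (X := (2 * K * (n / ε)) ^ (1 / κ))
  have hb := fun B => estimateZ_bounds hβ hβ1 hβγ hγ (natAdj_symm G) (natAdj_irrefl G) hfp B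
  have hclose : estimateZ β γ n (natAdj G) 1 (2 ^ N) (natField π) n -
      estimateZ β γ n (natAdj G) 0 (2 ^ N) (natField π) n ≤
      ε * estimateZ β γ n (natAdj G) 0 (2 ^ N) (natField π) n := by
    refine estimates_close_of_exp ?_ hε hε1 (hb _).1
      (estimateZ_le_exp_mul hβ hβ1 hβγ hγ (natAdj_symm G) (natAdj_irrefl G) hfp hfl
      fun ρ v => hdec (natAdj G) n n (2 ^ N) ρ v (natAdj_symm G) (natAdj_irrefl G) (by positivity))
    have h1 : 2 * K * (n / ε) ≤ ((2 : ℝ) ^ N) ^ κ := by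
      have := Real.rpow_le_rpow (by positivity) hN hκ.le
      rwa [← Real.rpow_mul (by positivity), one_div, inv_mul_cancel₀ hκ.ne', Real.rpow_one] at this
    rw [Real.rpow_neg (by positivity)]
    have h2 : (0 : ℝ) < ((2 : ℝ) ^ N) ^ κ := by positivity
    have h3 : 2 * K * n ≤ ((2 : ℝ) ^ N) ^ κ * ε := by
      rw [mul_div_assoc', div_le_iff₀ hε] at h1; exact h1
    rw [← div_eq_mul_inv, mul_div_assoc', div_le_iff₀ h2]
    linarith
  obtain ⟨m, s, hrun, hm, B, hs, hcl⟩ := (exec_approximate (A := natAdj G) (β := β) (γ := γ) (n := n)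
    (ε := ε) (π := natField π) (s := input β γ n G π ε) hβ hγ0 (natAdj_irrefl G) hfp
    (by simp [input]) (by simp [input]) (by simp [input]) (by simp [input]) (by simp [input])
    (by simp [input]) (fun u hu w hw => input_adj β γ ε G π hu hw)
    (fun w hw => by simp [input, natField]) hN0 hclose).haltsIn
  refine ⟨m, s, hrun, ?_, ?_⟩
  · have h1 : (2 : ℝ) ^ N ≤ 2 * max 1 ((2 * K) ^ (1 / κ)) * (n / ε) ^ a := by
      refine hN'.trans ?_
      rw [mul_assoc 2 (max 1 ((2 * K) ^ (1 / κ)))]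
      refine mul_le_mul_of_nonneg_left ?_ (zero_le_two (α := ℝ))
      have h2 : (n / ε) ^ (1 / κ) ≤ (n / ε) ^ a := by
        rw [← Real.rpow_natCast]
        exact Real.rpow_le_rpow_of_exponent_le hq (Nat.le_ceil _)
      have h3 : 1 ≤ (n / ε) ^ a := one_le_pow₀ hq
      refine max_le ?_ ?_
      · nlinarith [le_max_left 1 ((2 * K) ^ (1 / κ))]
      · rw [Real.mul_rpow (by positivity) (by positivity)]
        exact mul_le_mul (le_max_right _ _) h2 (by positivity) (by positivity)
    have h4 : ((n : ℝ) + 1) ^ 3 ≤ 8 * (n / ε) ^ 3 := by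
      have h5 : (n : ℝ) + 1 ≤ 2 * (n / ε) := by
        have : (n : ℝ) ≤ n / ε := by
          rw [le_div_iff₀ hε]; nlinarith
        linarith
      calc ((n : ℝ) + 1) ^ 3 ≤ (2 * (n / ε)) ^ 3 := pow_le_pow_left₀ (by positivity) h5 3
        _ = _ := by ring
    calc (m : ℝ) ≤ ((11000 * (n + 1) ^ 3 * 2 ^ N : ℕ) : ℝ) := by exact_mod_cast hm
      _ = 11000 * ((n : ℝ) + 1) ^ 3 * 2 ^ N := by push_cast; ring
      _ ≤ 11000 * (8 * (n / ε) ^ 3) * (2 * max 1 ((2 * K) ^ (1 / κ)) * (n / ε) ^ a) := by gcongr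
      _ = _ := by ring
  -- The returned lower estimate `L` and the upper estimate `U` enclose the partition function, so
  -- the error is at most `U - L ≤ ε * L`. This holds for whichever budget passed the test.
  · obtain ⟨hb0, hb1, hb2⟩ := hb B
    rw [hs, partitionFunction_eq_setPartition, abs_sub_comm, abs_of_nonneg (by linarith)]
    nlinarith

end TwoSpin

theorem theorem3p4 (β γ : ℝ) (hβγ : 1 < β * γ) (hβ : β ≤ 1) (hγ : 1 < γ) :
    ∃ P : RealRAM.Program, ∀ lam : ℝ, 0 < lam → lam < TwoSpin.criticalField β γ →
      (∃ M α C : ℝ, 1 < M ∧ 0 < α ∧ α < 1 ∧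
        TwoSpin.ApproximatesWithin P β γ lam fun n ε =>
          C * ((n : ℝ) * ((n : ℝ) * lam / ε) ^ (Real.log M / -Real.log α))) ∧
      TwoSpin.IsFPTAS P β γ lam := by
  have hβ0 : 0 < β := by
    by_contra h
    nlinarith
  refine ⟨TwoSpin.approximate, fun lam hlam hlc => ?_⟩
  obtain ⟨C, k, hk, hC, h⟩ := TwoSpin.exists_approximatesWithin hβ0 hβ hβγ hγ hlam hlc
  have hk0 : (0 : ℝ) < k := by exact_mod_cast Nat.pos_of_ne_zero hk
  -- With `M = exp k` and `α = exp (-1)` the exponent `log M / -log α` is the polynomial degree `k`;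
  -- these are not the branching and contraction constants of the analysis. Dividing `C` by `lam ^
  -- k` compensates for `lam` in the base, and the extra factor `n ≥ 1` is given away.
  refine ⟨⟨Real.exp k, Real.exp (-1), C / lam ^ k, Real.one_lt_exp_iff.2 hk0, Real.exp_pos _,
    Real.exp_lt_one_iff.2 (by norm_num), ?_⟩, C, k, ?_⟩
  · intro n G π ε hn hπ hε hε1
    obtain ⟨m, s, h1, h2, h3⟩ := h n G π ε hn hπ hε hε1
    refine ⟨m, s, h1, h2.trans ?_, h3⟩
    have hn1 : (1 : ℝ) ≤ n := by exact_mod_cast hn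
    simp only [Real.log_exp, neg_neg, div_one, Real.rpow_natCast]
    calc C * ((n : ℝ) / ε) ^ k = 1 * (C * ((n : ℝ) / ε) ^ k) := (one_mul _).symm
      _ ≤ n * (C * ((n : ℝ) / ε) ^ k) := by gcongr
      _ = C / lam ^ k * (n * ((n : ℝ) * lam / ε) ^ k) := by
        rw [mul_div_right_comm, mul_pow]; field_simp
  · intro n G π ε hn hπ hε hε1
    obtain ⟨m, s, h1, h2, h3⟩ := h n G π ε hn hπ hε hε1
    exact ⟨m, s, h1, by simpa only [← div_eq_mul_one_div] using h2, h3⟩
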